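/- Let $\nu\ge 2$ and $l\ge 1$ be integers and $D=-i\,d/dx$. For $\eta\in\mathbb R$, $\alpha=(\alpha_1,\alpha_2,\alpha_3)\in\mathbb R^3$ and $\beta=(\beta_1,\beta_2)\in\mathbb R^2$ with $\beta_j^2\ge\alpha_j^2/2$ for $j=1,2$, consider on the real line the operator $$\mathbf a(\eta)=(1+\alpha_1x+\beta_1^2x^2)D^2+(1+\alpha_2x+\beta_2^2x^2)\Bigl(\eta-\frac{x^\nu}{\nu}\Bigr)^2-(2l+1)(1+\alpha_3x)x^{\nu-1},$$ which for $\alpha=\beta=0$ is $\mathbf a^0(\eta)=D^2+(\eta-x^\nu/\nu)^2-(2l+1)x^{\nu-1}$. An eigenvalue is a real $\lambda$ for which $\mathbf a(\eta)u=\lambda u$ has a non-zero solution $u\in C^2\cap L^2(\mathbb R)$; the eigenvalues, in increasing order and counted with multiplicity, are $\lambda_0\le\lambda_1\le\dots$. The eigenvalue $\lambda_l=\lambda_l(\eta;\alpha,\beta)$ exists for all these parameters and, for every $\eta$, is (Fréchet) differentiable at $\alpha=\beta=0$ as a function of $(\alpha,\beta)$ in the parameter set $\{\beta_j^2\ge\alpha_j^2/2,\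 j=1,2\}$; $\partial_{\alpha_j}\lambda_l(\eta)|_{\alpha=\beta=0}$ denotes the components of this derivative, and $\lambda_l(\eta)=\lambda_l(\eta;0,0)$. There are real constants $\kappa_1,\kappa_2,\kappa_3,\kappa_4$, depending only on $\nu$ and $l$, such that the following holds. (i) As $\eta\to+\infty$, $$\lambda_l(\eta)=\kappa\,\eta^{-2/\nu}+O\bigl(\eta^{-(\nu+3)/\nu}\bigr),\qquad \kappa=\tfrac12(\nu-1)\,l(l+1)\,\nu^{-2/\nu}>0.$$ If $\nu$ is odd, the same holds as $\eta\to-\infty$ with $\eta$ replaced by $|\eta|$ on the right-hand side. (ii) As $\eta\to+\infty$, $$\partial_{\alpha_j}\lambda_l(\eta)\bigr|_{\alpha=\beta=0}=\kappa_j\,\eta+O\bigl(\eta^{-1/\nu}\bigr)\quad(j=1,2,3),\qquad \kappa_1=\kappa_2=-\kappa_3/2,$$ and furthermore $$\sum_{1\le j\le3}\partial_{\alpha_j}\lambda_l(\eta)\bigr|_{\alpha=\beta=0}=\kappa_4\,\eta^{1/\nu}\lambda_l(\eta)+O\bigl(\eta^{-2/\nu}\bigr).$$ If $\nu$ is odd,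 both formulas also hold as $\eta\to-\infty$, with the same constants, where $\eta^{1/\nu}=-|\eta|^{1/\nu}$ is the real root and the error terms are $O(|\eta|^{-1/\nu})$ and $O(|\eta|^{-2/\nu})$. -/

import Mathlib

open Filter Topology Asymptotics MeasureTheory

/-- The action of the one-dimensional operator `p(x) D² + q(x)`, `D = -i d/dx`, on a function. -/
noncomputable def opApply (p q : ℝ → ℝ) (u : ℝ → ℂ) (x : ℝ) : ℂ :=
  (p x : ℂ) * (-deriv (deriv u) x) + (q x : ℂ) * u x

/-- The eigenspace of `p D² + q` at the real number `μ`: all twice continuously differentiable,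
square integrable `u : ℝ → ℂ` with `p D² u + q u = μ u`. -/
noncomputable def opEigenspace (p q : ℝ → ℝ) (μ : ℝ) : Submodule ℂ (ℝ → ℂ) where
  carrier := {u | ContDiff ℝ 2 u ∧ MemLp u 2 volume ∧ ∀ x, opApply p q u x = (μ : ℂ) * u x}
  zero_mem' := by
    refine ⟨contDiff_const, MemLp.zero, fun x => ?_⟩
    have h : deriv (0 : ℝ → ℂ) = 0 := by funext y; simp
    simp [opApply, h]
  add_mem' := by
    rintro u v ⟨hu, hu2, hue⟩ ⟨hv, hv2, hve⟩
    refine ⟨hu.add hv, hu2.add hv2, fun x => ?_⟩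
    have du : Differentiable ℝ u := hu.differentiable (by norm_num)
    have dv : Differentiable ℝ v := hv.differentiable (by norm_num)
    have hu' : ContDiff ℝ (1 + 1) u := by simpa [one_add_one_eq_two] using hu
    have hv' : ContDiff ℝ (1 + 1) v := by simpa [one_add_one_eq_two] using hv
    have ddu : Differentiable ℝ (deriv u) :=
      (contDiff_succ_iff_deriv.1 hu').2.2.differentiable (by norm_num)
    have ddv : Differentiable ℝ (deriv v) :=
      (contDiff_succ_iff_deriv.1 hv').2.2.differentiable (by norm_num)
    have h1 : deriv (u + v) = deriv u + deriv v := by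
      funext y; exact deriv_add (du y) (dv y)
    have h2 : deriv (deriv u + deriv v) x = deriv (deriv u) x + deriv (deriv v) x :=
      deriv_add (ddu x) (ddv x)
    have e1 := hue x
    have e2 := hve x
    simp only [opApply, h1, h2, Pi.add_apply] at *
    linear_combination e1 + e2
  smul_mem' := by
    rintro c u ⟨hu, hu2, hue⟩
    refine ⟨contDiff_const.smul hu, hu2.const_smul c, fun x => ?_⟩
    have h1 : deriv (c • u) = c • deriv u := by
      funext y; exact deriv_const_smul_field c u
    have h2 : deriv (c • deriv u) x = c • deriv (deriv u) x := deriv_const_smul_field c (deriv u)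
    have e1 := hue x
    simp only [opApply, h1, h2, Pi.smul_apply, smul_eq_mul] at *
    linear_combination c * e1

/-- `lam` is the `n`-th eigenvalue (`n = 0, 1, …`) of `p D² + q`, in increasing order and counted
with multiplicity: the least real number such that the eigenspaces up to and including it have
total dimension greater than `n`. -/
def IsNthEigenvalue (p q : ℝ → ℝ) (n : ℕ) (lam : ℝ) : Prop :=
  IsLeast {μ : ℝ |
    (n : Cardinal) < Module.rank ℂ ↥(⨆ τ ∈ Set.Iic μ, opEigenspace p q τ)} lam

/-- The parameters `(α, β)`: `α = (α 0, α 1, α 2)` stands for `(α₁, α₂, α₃)` and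
`β = (β 0, β 1)` for `(β₁, β₂)`. -/
abbrev Params : Type := (Fin 3 → ℝ) × (Fin 2 → ℝ)

/-- The coefficient `1 + α₁ x + β₁² x²` of `D²` in the perturbed operator. -/
def pertP (θ : Params) (x : ℝ) : ℝ := 1 + θ.1 0 * x + θ.2 0 ^ 2 * x ^ 2

/-- The potential
`(1 + α₂ x + β₂² x²) (η - x^ν / ν)² - (2l+1) (1 + α₃ x) x^(ν-1)` of the perturbed operator. -/
noncomputable def pertQ (ν l : ℕ) (η : ℝ) (θ : Params) (x : ℝ) : ℝ :=
  (1 + θ.1 1 * x + θ.2 1 ^ 2 * x ^ 2) * (η - x ^ ν / ν) ^ 2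
    - (2 * l + 1) * (1 + θ.1 2 * x) * x ^ (ν - 1)

/-- The admissible parameters, `α_j² / 2 ≤ β_j²` for `j = 1, 2`. Then
`1 + α_j x + β_j² x² ≥ 1/2` for all `x`; the unperturbed operator is the point `0`. -/
def admissible : Set Params :=
  {θ | θ.1 0 ^ 2 / 2 ≤ θ.2 0 ^ 2 ∧ θ.1 1 ^ 2 / 2 ≤ θ.2 1 ^ 2}

/-! Let `x₀` be the real root of `x₀^ν = ν η`, let `s > 0` satisfy `s² x₀^(ν+1) = 1`, and put `x =
x₀ (1 + s z)`. Then `a⁰(η)` becomes `x₀^(ν-1) (D² + V_s(z))`, where `V_s` is polynomial in `s` and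
`z` and `V_0 = z² - (2l+1)`. Hence `λ_l(η) = x₀^(ν-1) E(s)`, and `E(s) → 0` as `s → 0` because
`2l+1` is exactly the `l`-th oscillator eigenvalue. Part (i) amounts to `E(s) = (ν-1) l (l+1) s² / 2
+ O(s⁴)`.

No perturbation series is needed for this expansion. The hypervirial identities
(`expectation_virial`) with test function `z^n` give a recursion for the moments `⟨z^k⟩` in the
`l`-th state (`moment_recursion`), and the Hellmann–Feynman formula `E' = ⟨∂_s V_s⟩`
(`hasDerivAt_scaledEigenvalue`) closes the system. Since all moments stay bounded as `s → 0`
(`isBigO_mean`), a bootstrap gives odd moments of order `s`, then `E = O(s²)`, then sharper moments,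
and finally `E` up to `O(s⁴)` (`isOrder_scaledEigenvalue`).

The derivatives in `α` come from an exact identity: eigenfunctions of two equations `u'' = G u` are
orthogonal with respect to the difference of their coefficients (`integral_coeff_sub_mul_eq_zero`).
Comparing the perturbed with the unperturbed problem and passing to the limit makes `∂_{α_j} λ_l`
the expectation of an explicit weight, while `β` enters only through squares
(`hasFDerivWithinAt_eigenvalue`). After scaling, each expectation is `x₀^ν = ν η` times a limit
found from the same virial identities (`isOrder_mean_scaledWeight`). The three weights add up to `x
(a⁰(η) - D²)` minus the same with the equation inserted, that is to `λ_l x`, so the sum of the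
derivatives is `λ_l ⟨x⟩`, which is close to `x₀ λ_l` (`sum_scaledWeight`).

The spectral theory rests on Prüfer angles. If `G ≥ 1` near `±∞`, exactly one angle stays in `[0,
π/4]` near `-∞`; it belongs to the decaying solution. The angles of the two decaying solutions,
added at `0`, form `totalAngle`. It is strictly increasing and continuous in the spectral parameter,
and the `n`-th eigenvalue is where it equals `(n+1) π` (`ConfiningPair.isNthEigenvalue`). Comparison
with the harmonic oscillator, solved by ladder operators, shows that all these values are attained.
-/

namespace SturmLiouville
open Real Set

/-! ### Prüfer angles: existence, comparison, continuous dependence. -/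

/-- `θ` is a Prüfer angle for `u'' = G u`, that is `u = r sin θ`, `u' = r cos θ`. -/
def IsPrufer (G θ : ℝ → ℝ) : Prop :=
  ∀ x, HasDerivAt θ (cos (θ x) ^ 2 - G x * sin (θ x) ^ 2) x

theorem IsPrufer.continuous {G θ : ℝ → ℝ} (h : IsPrufer G θ) : Continuous θ :=
  continuous_iff_continuousAt.2 fun x => (h x).continuousAt

theorem sin_sq_sub_sin_sq (x y : ℝ) :
    sin y ^ 2 - sin x ^ 2 = sin (x + y) * sin (y - x) := by
  rw [sin_add, sin_sub]; nlinarith [sin_sq_add_cos_sq x, sin_sq_add_cos_sq y]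

theorem sin_eq_sinc_mul (x : ℝ) : sin x = sinc x * x := by
  rcases eq_or_ne x 0 with rfl | h
  · simp
  · rw [sinc_of_ne_zero h]; field_simp

/-- Writing the difference with `sinc` keeps the cofactor of `b - a` continuous and bounded even
where the angles meet. The difference of two angles thus obeys a linear equation and has an
integrating factor, which replaces a Grönwall argument throughout. -/
theorem prufer_field_sub (g a b : ℝ) :
    (cos b ^ 2 - g * sin b ^ 2) - (cos a ^ 2 - g * sin a ^ 2)
      = -(1 + g) * (sin (a + b) * sinc (b - a)) * (b - a) := by
  have h1 := sin_sq_sub_sin_sq a b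
  rw [sin_eq_sinc_mul (b - a)] at h1
  have h2 := cos_sq_add_sin_sq a
  have h3 := cos_sq_add_sin_sq b
  linear_combination (-(1 + g)) * h1 + h3 - h2

theorem abs_sin_mul_sinc_le_one (a b : ℝ) : |sin a * sinc b| ≤ 1 := by
  rw [abs_mul]
  exact mul_le_one₀ (abs_sin_le_one a) (abs_nonneg _) (abs_sinc_le_one b)

theorem exists_bound_Icc {G : ℝ → ℝ} (hG : Continuous G) (a b : ℝ) :
    ∃ M, 0 ≤ M ∧ ∀ x ∈ Icc a b, |G x| ≤ M := by
  obtain ⟨M, hM⟩ := isCompact_Icc.exists_bound_of_continuousOn (hG.continuousOn (s := Icc a b))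
  exact ⟨max M 0, le_max_right _ _, fun x hx => (hM x hx).trans (le_max_left _ _)⟩

theorem lipschitz_prufer_field {g M : ℝ} (hM : 0 ≤ M) (hg : |g| ≤ M) :
    LipschitzWith (Real.toNNReal (1 + M)) fun t : ℝ => cos t ^ 2 - g * sin t ^ 2 := by
  refine LipschitzWith.of_dist_le_mul fun a b => ?_
  rw [Real.coe_toNNReal _ (by positivity), dist_comm, dist_comm a b, Real.dist_eq, Real.dist_eq,
    prufer_field_sub, abs_mul, abs_mul]
  have h1 := abs_sin_mul_sinc_le_one (a + b) (b - a)
  have h2 : |-(1 + g)| ≤ 1 + M := by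
    rw [abs_neg]
    calc |1 + g| ≤ |1| + |g| := abs_add_le _ _
      _ ≤ 1 + M := by simpa using hg
  gcongr
  calc _ ≤ |-(1 + g)| * 1 := by gcongr
    _ ≤ 1 + M := by simpa using h2

theorem exists_prufer_Icc {G : ℝ → ℝ} (hG : Continuous G) (x₀ θ₀ : ℝ) (n : ℕ) :
    ∃ α : ℝ → ℝ, α x₀ = θ₀ ∧ ∀ t ∈ Icc (x₀ - n) (x₀ + n),
      HasDerivWithinAt α (cos (α t) ^ 2 - G t * sin (α t) ^ 2) (Icc (x₀ - n) (x₀ + n)) t := by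
  obtain ⟨M, hM, hGM⟩ := exists_bound_Icc hG (x₀ - n) (x₀ + n)
  have hmem : x₀ ∈ Icc (x₀ - n) (x₀ + n) := by constructor <;> simp
  -- The field is bounded by `1 + M`, so an angle moves at most `(1 + M) * n` in time `n`; a ball of
  -- that radius is never left.
  have hpl : IsPicardLindelof (fun t x : ℝ => cos x ^ 2 - G t * sin x ^ 2)
      (⟨x₀, hmem⟩ : Icc (x₀ - n) (x₀ + n)) θ₀ (Real.toNNReal ((1 + M) * n)) 0
      (Real.toNNReal (1 + M)) (Real.toNNReal (1 + M)) := by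
    constructor
    · exact fun t ht => (lipschitz_prufer_field hM (hGM t ht)).lipschitzOnWith
    · intro x _; fun_prop
    · intro t ht x _
      rw [Real.coe_toNNReal _ (by positivity), Real.norm_eq_abs]
      have h1 := hGM t ht
      have h2 : sin x ^ 2 ≤ 1 := sin_sq_le_one x
      have h3 : cos x ^ 2 ≤ 1 := cos_sq_le_one x
      calc |cos x ^ 2 - G t * sin x ^ 2| ≤ |cos x ^ 2| + |G t * sin x ^ 2| := abs_sub _ _
        _ = cos x ^ 2 + |G t| * sin x ^ 2 := by
          rw [abs_mul, abs_of_nonneg (sq_nonneg _), abs_of_nonneg (sq_nonneg (sin x))]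
        _ ≤ 1 + M * 1 := by gcongr
        _ = 1 + M := by ring
    · simp only [add_sub_cancel_left, sub_sub_cancel, max_self]
      rw [Real.coe_toNNReal _ (by positivity), Real.coe_toNNReal _ (by positivity)]
      simp
  exact hpl.exists_eq_forall_mem_Icc_hasDerivWithinAt₀

theorem exists_isPrufer {G : ℝ → ℝ} (hG : Continuous G) (x₀ θ₀ : ℝ) :
    ∃ θ, IsPrufer G θ ∧ θ x₀ = θ₀ := by
  choose α hα0 hα using exists_prufer_Icc hG x₀ θ₀
  have hsub : ∀ {m n : ℕ}, m ≤ n → Icc (x₀ - m) (x₀ + m) ⊆ Icc (x₀ - n) (x₀ + n) := by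
    intro m n h
    have : (m : ℝ) ≤ n := by exact_mod_cast h
    exact Icc_subset_Icc (by linarith) (by linarith)
  have hder : ∀ {m n : ℕ}, m ≤ n → ∀ t ∈ Ioo (x₀ - m) (x₀ + m),
      HasDerivAt (α n) (cos (α n t) ^ 2 - G t * sin (α n t) ^ 2) t := by
    intro m n h t ht
    have := (hα n t (hsub h (Ioo_subset_Icc_self ht))).mono (hsub h)
    exact this.hasDerivAt (Icc_mem_nhds ht.1 ht.2)
  have huniq : ∀ {m n : ℕ}, 1 ≤ m → m ≤ n → EqOn (α m) (α n) (Icc (x₀ - m) (x₀ + m)) := by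
    intro m n hm h
    obtain ⟨M, hM, hGM⟩ := exists_bound_Icc hG (x₀ - m) (x₀ + m)
    have hm' : (1 : ℝ) ≤ m := by exact_mod_cast hm
    refine ODE_solution_unique_of_mem_Icc (v := fun t x : ℝ => cos x ^ 2 - G t * sin x ^ 2)
      (s := fun _ => univ) (K := Real.toNNReal (1 + M)) (t₀ := x₀)
      (fun t ht => (lipschitz_prufer_field hM (hGM t (Ioo_subset_Icc_self ht))).lipschitzOnWith)
      ⟨by linarith, by linarith⟩ (fun t ht => (hα m t ht).continuousWithinAt)
      (hder le_rfl) (fun _ _ => mem_univ _)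
      (fun t ht => ((hα n t (hsub h ht)).mono (hsub h)).continuousWithinAt)
      (hder h) (fun _ _ => mem_univ _) (by rw [hα0, hα0])
  -- The index varies with `x`. One index higher serves all points near `x` at once, so
  -- differentiability can be read off from a single `α n`.
  refine ⟨fun x => α (⌈|x - x₀|⌉₊ + 1) x, fun x => ?_, by simp [hα0]⟩
  set n := ⌈|x - x₀|⌉₊ + 2 with hn
  have hle : |x - x₀| ≤ ⌈|x - x₀|⌉₊ := Nat.le_ceil _
  have hx : x ∈ Ioo (x₀ - n) (x₀ + n) := by
    rw [hn]; push_cast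
    constructor <;> [linarith [neg_abs_le (x - x₀)]; linarith [le_abs_self (x - x₀)]]
  have key : ∀ y ∈ Ioo (x₀ - (⌈|x - x₀|⌉₊ + 1 : ℕ)) (x₀ + (⌈|x - x₀|⌉₊ + 1 : ℕ)),
      α (⌈|y - x₀|⌉₊ + 1) y = α n y := by
    intro y hy
    have hyb : |y - x₀| < (⌈|x - x₀|⌉₊ + 1 : ℕ) := by
      rw [abs_lt]; constructor <;> linarith [hy.1, hy.2]
    apply huniq (by omega)
    · rw [hn]
      have : ⌈|y - x₀|⌉₊ ≤ ⌈|x - x₀|⌉₊ + 1 := Nat.ceil_le.2 hyb.le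
      omega
    · have : |y - x₀| ≤ ⌈|y - x₀|⌉₊ := Nat.le_ceil _
      push_cast
      constructor <;> [linarith [neg_abs_le (y - x₀)]; linarith [le_abs_self (y - x₀)]]
  have hx1 : x ∈ Ioo (x₀ - (⌈|x - x₀|⌉₊ + 1 : ℕ)) (x₀ + (⌈|x - x₀|⌉₊ + 1 : ℕ)) := by
    push_cast
    constructor <;> [linarith [neg_abs_le (x - x₀)]; linarith [le_abs_self (x - x₀)]]
  have h1 := hder le_rfl x hx
  have hev : (fun x => α (⌈|x - x₀|⌉₊ + 1) x) =ᶠ[𝓝 x] α n := by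
    filter_upwards [Ioo_mem_nhds hx1.1 hx1.2] with y hy using key y hy
  have h2 := h1.congr_of_eventuallyEq hev
  rwa [← key x hx1] at h2

theorem exists_antideriv {f : ℝ → ℝ} (hf : Continuous f) (x₀ : ℝ) :
    ∃ A : ℝ → ℝ, A x₀ = 0 ∧ ∀ x, HasDerivAt A (f x) x :=
  ⟨fun x => ∫ t in x₀..x, f t, by simp, fun x => (hf.integral_hasStrictDerivAt x₀ x).hasDerivAt⟩

/-- The difference of two Prüfer angles, up to a positive factor, has an explicit derivative. -/
theorem IsPrufer.exists_factor {G₁ G₂ θ₁ θ₂ : ℝ → ℝ} (hG : Continuous G₁)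
    (h₁ : IsPrufer G₁ θ₁) (h₂ : IsPrufer G₂ θ₂) (x₀ : ℝ) :
    ∃ A : ℝ → ℝ, A x₀ = 0 ∧
      (∀ x, HasDerivAt A ((1 + G₁ x) * (sin (θ₁ x + θ₂ x) * sinc (θ₂ x - θ₁ x))) x) ∧
      ∀ x, HasDerivAt (fun y => (θ₂ y - θ₁ y) * exp (A y))
        (-(G₂ x - G₁ x) * sin (θ₂ x) ^ 2 * exp (A x)) x := by
  have hc : Continuous fun x => (1 + G₁ x) * (sin (θ₁ x + θ₂ x) * sinc (θ₂ x - θ₁ x)) := by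
    have := h₁.continuous; have := h₂.continuous; have := continuous_sinc
    fun_prop
  obtain ⟨A, hA0, hA⟩ := exists_antideriv hc x₀
  refine ⟨A, hA0, hA, fun x => ?_⟩
  refine (((h₂ x).sub (h₁ x)).mul (hA x).exp).congr_deriv ?_
  have := prufer_field_sub (G₁ x) (θ₁ x) (θ₂ x)
  simp only [Pi.sub_apply]
  linear_combination exp (A x) * this

/-- Prüfer angles are ordered opposite to the coefficients. -/
theorem IsPrufer.antitoneOn {G₁ G₂ θ₁ θ₂ : ℝ → ℝ} (hG : Continuous G₁)
    (h₁ : IsPrufer G₁ θ₁) (h₂ : IsPrufer G₂ θ₂) {D : Set ℝ} (hD : Convex ℝ D)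
    (hle : ∀ x ∈ D, G₁ x ≤ G₂ x) :
    ∃ A : ℝ → ℝ, AntitoneOn (fun y => (θ₂ y - θ₁ y) * exp (A y)) D := by
  obtain ⟨A, -, -, hA⟩ := h₁.exists_factor hG h₂ 0
  refine ⟨A, antitoneOn_of_hasDerivWithinAt_nonpos hD
    (fun x _ => (hA x).continuousAt.continuousWithinAt)
    (fun x _ => (hA x).hasDerivWithinAt) fun x hx => ?_⟩
  have := hle x (interior_subset hx)
  rw [neg_mul, neg_mul, neg_nonpos]
  have : 0 ≤ G₂ x - G₁ x := by linarith
  positivity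

theorem IsPrufer.le_of_le {G₁ G₂ θ₁ θ₂ : ℝ → ℝ} (hG : Continuous G₁)
    (h₁ : IsPrufer G₁ θ₁) (h₂ : IsPrufer G₂ θ₂) {a b : ℝ} (hab : a ≤ b)
    (hle : ∀ x ∈ Icc a b, G₁ x ≤ G₂ x) (h : θ₂ a ≤ θ₁ a) : θ₂ b ≤ θ₁ b := by
  obtain ⟨A, hA⟩ := h₁.antitoneOn hG h₂ (convex_Icc a b) hle
  have h3 := hA (left_mem_Icc.2 hab) (right_mem_Icc.2 hab) hab
  have h4 : (θ₂ a - θ₁ a) * exp (A a) ≤ 0 :=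
    mul_nonpos_of_nonpos_of_nonneg (by linarith) (exp_pos _).le
  have h5 : (θ₂ b - θ₁ b) * exp (A b) ≤ 0 := h3.trans h4
  have := nonpos_of_mul_nonpos_left h5 (exp_pos _)
  linarith

/-- Convergence of coefficients, uniformly on bounded intervals. -/
def TendstoLocUnif {ι : Type*} (G : ι → ℝ → ℝ) (l : Filter ι) (G₀ : ℝ → ℝ) : Prop :=
  ∀ a, ∀ ε > 0, ∀ᶠ i in l, ∀ x ∈ Icc (-a) a, |G i x - G₀ x| ≤ ε

/-- With the integrating factor `exp A`, where `|A| ≤ (1 + M) T` between `x₀` and `x`, the weighted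
difference of the angles has derivative at most `ε K`; the mean value inequality does the rest. -/
theorem IsPrufer.tendsto {ι : Type*} {l : Filter ι} {G : ι → ℝ → ℝ} {G₀ : ℝ → ℝ}
    {θ : ι → ℝ → ℝ} {θ₀ : ℝ → ℝ} (hG₀ : Continuous G₀) (hG : TendstoLocUnif G l G₀)
    (hθ : ∀ᶠ i in l, IsPrufer (G i) (θ i)) (hθ₀ : IsPrufer G₀ θ₀) {x₀ : ℝ}
    (h : Tendsto (fun i => θ i x₀) l (𝓝 (θ₀ x₀))) (x : ℝ) :
    Tendsto (fun i => θ i x) l (𝓝 (θ₀ x)) := by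
  obtain ⟨M, hM, hGM⟩ := exists_bound_Icc hG₀ (-(|x₀| + |x|)) (|x₀| + |x|)
  set T := |x - x₀| with hT
  set K := exp ((1 + M) * T) with hK
  have hsub : uIcc x₀ x ⊆ Icc (-(|x₀| + |x|)) (|x₀| + |x|) := by
    intro y hy
    rw [mem_uIcc] at hy
    have := neg_abs_le x; have := neg_abs_le x₀; have := le_abs_self x; have := le_abs_self x₀
    have := abs_nonneg x; have := abs_nonneg x₀
    rcases hy with hy | hy <;> constructor <;> linarith [hy.1, hy.2]
  have key : ∀ ε > 0, ∀ᶠ i in l, |θ i x - θ₀ x| ≤ K * (|θ i x₀ - θ₀ x₀| + ε * K * T) := by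
    intro ε hε
    filter_upwards [hθ, hG (|x₀| + |x|) ε hε] with i hi hGi
    obtain ⟨A, hA0, hA, hd⟩ := hθ₀.exists_factor hG₀ hi x₀
    have hAb : ∀ y ∈ uIcc x₀ x, |A y| ≤ (1 + M) * T := by
      intro y hy
      have := Convex.norm_image_sub_le_of_norm_hasDerivWithin_le (C := 1 + M)
        (fun z (_ : z ∈ uIcc x₀ x) => (hA z).hasDerivWithinAt) (fun z hz => ?_)
        (convex_uIcc _ _) left_mem_uIcc hy
      · rw [hA0, sub_zero, Real.norm_eq_abs, Real.norm_eq_abs] at this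
        exact this.trans
          (mul_le_mul_of_nonneg_left (abs_sub_left_of_mem_uIcc hy) (by positivity))
      · rw [Real.norm_eq_abs, abs_mul]
        calc _ ≤ |1 + G₀ z| * 1 := by gcongr; exact abs_sin_mul_sinc_le_one _ _
          _ ≤ |1| + |G₀ z| := by rw [mul_one]; exact abs_add_le _ _
          _ ≤ 1 + M := by rw [abs_one]; gcongr; exact hGM z (hsub hz)
    have h1 := Convex.norm_image_sub_le_of_norm_hasDerivWithin_le (C := ε * K)
        (fun z (_ : z ∈ uIcc x₀ x) => (hd z).hasDerivWithinAt) (fun z hz => ?_)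
        (convex_uIcc _ _) left_mem_uIcc right_mem_uIcc
    · simp only [hA0, exp_zero, mul_one, Real.norm_eq_abs] at h1
      rw [← hT] at h1
      have h2 : |(θ i x - θ₀ x) * exp (A x)| ≤ |θ i x₀ - θ₀ x₀| + ε * K * T := by
        have := abs_sub_abs_le_abs_sub ((θ i x - θ₀ x) * exp (A x)) (θ i x₀ - θ₀ x₀)
        linarith
      have h3 : exp (-A x) ≤ K := by
        rw [hK, exp_le_exp]; linarith [neg_abs_le (A x), hAb x right_mem_uIcc]
      calc |θ i x - θ₀ x| = exp (-A x) * |(θ i x - θ₀ x) * exp (A x)| := by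
            rw [abs_mul, abs_of_pos (exp_pos (A x)), mul_comm, mul_assoc, ← exp_add]; simp
        _ ≤ _ := by gcongr
    · rw [Real.norm_eq_abs, abs_mul, abs_mul, abs_neg, abs_of_pos (exp_pos _),
        abs_of_nonneg (sq_nonneg (sin (θ i z)))]
      have e1 := hGi z (hsub hz)
      have e2 : exp (A z) ≤ K := by
        rw [hK, exp_le_exp]; exact (le_abs_self _).trans (hAb z hz)
      calc _ ≤ ε * 1 * K := by gcongr; exact sin_sq_le_one _
        _ = ε * K := by ring
  rw [Metric.tendsto_nhds]
  intro δ hδ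
  have hKpos : 0 < K := exp_pos _
  set ε := δ / (4 * K * K * (T + 1)) with hε
  have hTn : 0 ≤ T := abs_nonneg _
  have hεpos : 0 < ε := by positivity
  have h0 : ∀ᶠ i in l, dist (θ i x₀) (θ₀ x₀) < δ / (4 * K) :=
    Metric.tendsto_nhds.1 h _ (by positivity)
  filter_upwards [key ε hεpos, h0] with i hi h0i
  rw [Real.dist_eq] at h0i ⊢
  calc |θ i x - θ₀ x| ≤ K * (|θ i x₀ - θ₀ x₀| + ε * K * T) := hi
    _ ≤ K * (δ / (4 * K) + ε * K * (T + 1)) := by gcongr; linarith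
    _ = δ / 2 := by rw [hε]; field_simp; ring
    _ < δ := by linarith

end SturmLiouville

/-! ### The angle of the solution decaying at `-∞`. -/

namespace SturmLiouville
open Real Set

/-- This is the angle of `exp x`, an equilibrium for `G = 1`. For `G ≥ 1` it is a barrier that
angles cannot cross upwards. -/
theorem isPrufer_const_pi_div_four : IsPrufer (fun _ => 1) fun _ => π / 4 := fun x => by
  have h : cos (π / 4) ^ 2 - 1 * sin (π / 4) ^ 2 = 0 := by simp
  rw [h]; exact hasDerivAt_const x _

theorem IsPrufer.le_pi_div_four {G θ : ℝ → ℝ} (h : IsPrufer G θ) {a b : ℝ} (hab : a ≤ b)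
    (hG : ∀ x ∈ Icc a b, 1 ≤ G x) (ha : θ a ≤ π / 4) : θ b ≤ π / 4 :=
  isPrufer_const_pi_div_four.le_of_le continuous_const h hab hG ha

/-- The angle satisfies `θ' + (G sin θ sinc θ) θ = cos² θ ≥ 0`, so `θ` times an integrating factor
is monotone. -/
theorem IsPrufer.nonneg {G θ : ℝ → ℝ} (hG : Continuous G) (h : IsPrufer G θ) {a b : ℝ}
    (hab : a ≤ b) (ha : 0 ≤ θ a) : 0 ≤ θ b := by
  have hc : Continuous fun x => G x * sin (θ x) * sinc (θ x) := by
    have := h.continuous; have := continuous_sinc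
    fun_prop
  obtain ⟨A, -, hA⟩ := exists_antideriv hc 0
  have hd : ∀ x, HasDerivAt (fun y => θ y * exp (A y)) (cos (θ x) ^ 2 * exp (A x)) x := by
    intro x
    refine ((h x).mul (hA x).exp).congr_deriv ?_
    have := sin_eq_sinc_mul (θ x)
    linear_combination (-exp (A x) * G x * sin (θ x)) * this
  have hmono : Monotone fun y => θ y * exp (A y) :=
    monotone_of_hasDerivAt_nonneg hd fun x => by positivity
  have h1 : 0 ≤ θ b * exp (A b) := le_trans (mul_nonneg ha (exp_pos _).le) (hmono hab)
  exact nonneg_of_mul_nonneg_left h1 (exp_pos _)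

theorem IsPrufer.mem_Icc {G θ : ℝ → ℝ} (hG : Continuous G) (h : IsPrufer G θ) {a b : ℝ}
    (hab : a ≤ b) (hG1 : ∀ x ∈ Icc a b, 1 ≤ G x) (ha : θ a ∈ Icc 0 (π / 4)) :
    θ b ∈ Icc 0 (π / 4) :=
  ⟨h.nonneg hG hab ha.1, h.le_pi_div_four hab hG1 ha.2⟩

/-- The Prüfer angle of a solution that decays at `-∞`. -/
def IsLeftAngle (G θ : ℝ → ℝ) : Prop :=
  IsPrufer G θ ∧ ∀ᶠ x in atBot, θ x ∈ Icc 0 (π / 4)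

theorem IsLeftAngle.mem_Icc {G θ : ℝ → ℝ} (hG : Continuous G) (h : IsLeftAngle G θ) {a : ℝ}
    (hG1 : ∀ x ≤ a, 1 ≤ G x) {x : ℝ} (hx : x ≤ a) : θ x ∈ Icc 0 (π / 4) := by
  obtain ⟨y, hy, hyx⟩ := (h.2.and (eventually_le_atBot x)).exists
  exact h.1.mem_Icc hG hyx (fun z hz => hG1 z (hz.2.trans hx)) hy

theorem IsLeftAngle.nonneg {G θ : ℝ → ℝ} (hG : Continuous G) (h : IsLeftAngle G θ) (x : ℝ) :
    0 ≤ θ x := by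
  obtain ⟨y, hy, hyx⟩ := (h.2.and (eventually_le_atBot x)).exists
  exact h.1.nonneg hG hyx hy.1

/-- A zero would be a minimum of the nonnegative angle, yet the derivative there is `cos² 0 = 1`. -/
theorem IsLeftAngle.pos {G θ : ℝ → ℝ} (hG : Continuous G) (h : IsLeftAngle G θ) (x : ℝ) :
    0 < θ x := by
  refine (h.nonneg hG x).lt_of_ne' fun h0 => ?_
  have hmin : IsLocalMin θ x := Eventually.of_forall fun y => by
    rw [h0]; exact h.nonneg hG y
  have := hmin.hasDerivAt_eq_zero (h.1 x)
  simp [h0] at this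

/-- Left angles are ordered opposite to the coefficients. -/
theorem IsLeftAngle.le {G₁ G₂ θ₁ θ₂ : ℝ → ℝ} (hG : Continuous G₁)
    (hb : ∀ᶠ x in atBot, 1 ≤ G₁ x) (h₁ : IsLeftAngle G₁ θ₁) (h₂ : IsLeftAngle G₂ θ₂)
    {x₀ : ℝ} (hle : ∀ x ≤ x₀, G₁ x ≤ G₂ x) : θ₂ x₀ ≤ θ₁ x₀ := by
  -- A positive difference `d = θ₂ - θ₁` stays positive to the left. Where both angles lie in `[0,
  -- π/4]` and `G₁ ≥ 1` it satisfies `d' ≤ -2 sin² d`, so it grows at least linearly towards `-∞`.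
  -- This contradicts `d ≤ π/4`.
  by_contra! hlt
  obtain ⟨A, hA⟩ := h₁.1.antitoneOn hG h₂.1 (convex_Iic x₀) (fun x hx => hle x hx)
  have hpos : ∀ x ≤ x₀, θ₁ x < θ₂ x := by
    intro x hx
    have h1 : 0 < (θ₂ x₀ - θ₁ x₀) * exp (A x₀) := mul_pos (by linarith) (exp_pos _)
    have h2 : 0 < (θ₂ x - θ₁ x) * exp (A x) :=
      h1.trans_le (hA (mem_Iic.2 hx) self_mem_Iic hx)
    have := pos_of_mul_pos_left h2 (exp_pos _).le
    linarith
  obtain ⟨a, ha⟩ := eventually_atBot.1 ((hb.and h₁.2).and (h₂.2.and (eventually_le_atBot x₀)))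
  set δ := θ₂ a - θ₁ a with hδ
  have hδ0 : 0 < δ := by have := hpos a (ha a le_rfl).2.2; linarith
  have hder : ∀ x, HasDerivAt (fun y => θ₂ y - θ₁ y)
      (-(1 + G₁ x) * (sin (θ₁ x + θ₂ x) * sin (θ₂ x - θ₁ x))
        - (G₂ x - G₁ x) * sin (θ₂ x) ^ 2) x := fun x => by
    refine ((h₂.1 x).sub (h₁.1 x)).congr_deriv ?_
    have := prufer_field_sub (G₁ x) (θ₁ x) (θ₂ x)
    rw [sin_eq_sinc_mul (θ₂ x - θ₁ x)]
    linear_combination this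
  have hpi := pi_pos
  have hd0 : ∀ x ≤ a, -(1 + G₁ x) * (sin (θ₁ x + θ₂ x) * sin (θ₂ x - θ₁ x))
        - (G₂ x - G₁ x) * sin (θ₂ x) ^ 2 ≤ -2 * sin (θ₂ x - θ₁ x) ^ 2 := by
    intro x hx
    obtain ⟨⟨hg, hm1⟩, hm2, hxx⟩ := ha x hx
    have h3 := hpos x hxx
    have h4 := hle x hxx
    have h5 : 0 ≤ sin (θ₂ x - θ₁ x) := sin_nonneg_of_nonneg_of_le_pi (by linarith)
      (by linarith [hm1.1, hm2.2])
    have h6 : sin (θ₂ x - θ₁ x) ≤ sin (θ₁ x + θ₂ x) :=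
      sin_le_sin_of_le_of_le_pi_div_two (by linarith) (by linarith [hm1.2, hm2.2])
        (by linarith [hm1.1])
    have h7 : 0 ≤ (G₂ x - G₁ x) * sin (θ₂ x) ^ 2 := mul_nonneg (by linarith) (sq_nonneg _)
    have h8 : 2 * (sin (θ₂ x - θ₁ x) * sin (θ₂ x - θ₁ x))
        ≤ (1 + G₁ x) * (sin (θ₁ x + θ₂ x) * sin (θ₂ x - θ₁ x)) := by
      gcongr; linarith
    nlinarith
  have hanti : AntitoneOn (fun y => θ₂ y - θ₁ y) (Iic a) :=
    antitoneOn_of_hasDerivWithinAt_nonpos (convex_Iic a)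
      (fun x _ => (hder x).continuousAt.continuousWithinAt)
      (fun x _ => (hder x).hasDerivWithinAt) fun x hx => by
        have := hd0 x (mem_Iic.1 (interior_subset hx))
        nlinarith [sq_nonneg (sin (θ₂ x - θ₁ x))]
  set s := 2 * sin δ ^ 2 with hs
  have hδπ : δ ≤ π / 4 := by
    have := ha a le_rfl
    linarith [this.1.2.1, this.2.1.2]
  have hs0 : 0 < s := by
    have : 0 < sin δ := sin_pos_of_pos_of_lt_pi hδ0 (by linarith)
    positivity
  have hanti2 : AntitoneOn (fun y => θ₂ y - θ₁ y + s * y) (Iic a) := by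
    refine antitoneOn_of_hasDerivWithinAt_nonpos (convex_Iic a)
      (fun x _ => ((hder x).add ((hasDerivAt_id x).const_mul s)).continuousAt.continuousWithinAt)
      (fun x _ => ((hder x).add ((hasDerivAt_id x).const_mul s)).hasDerivWithinAt) fun x hx => ?_
    have hxa : x ≤ a := mem_Iic.1 (interior_subset hx)
    have h9 : δ ≤ θ₂ x - θ₁ x := hanti (mem_Iic.2 hxa) self_mem_Iic hxa
    have h10 : θ₂ x - θ₁ x ≤ π / 4 := by
      have := ha x hxa
      linarith [this.1.2.1, this.2.1.2]
    have h11 : sin δ ≤ sin (θ₂ x - θ₁ x) :=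
      sin_le_sin_of_le_of_le_pi_div_two (by linarith) (by linarith) h9
    have h12 : 0 ≤ sin δ := sin_nonneg_of_nonneg_of_le_pi hδ0.le (by linarith)
    have := hd0 x hxa
    have : sin δ ^ 2 ≤ sin (θ₂ x - θ₁ x) ^ 2 := by gcongr
    simp only [mul_one]
    linarith
  have hx1 : a - (π / 4) / s ≤ a := by have : 0 < (π / 4) / s := by positivity
                                       linarith
  have h13 := hanti2 (mem_Iic.2 hx1) self_mem_Iic hx1
  have h14 := ha _ hx1
  have h15 : s * (a - (π / 4) / s) = s * a - π / 4 := by field_simp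
  simp only [h15] at h13
  linarith [h14.1.2.1, h14.2.1.2]

theorem IsLeftAngle.unique {G θ₁ θ₂ : ℝ → ℝ} (hG : Continuous G)
    (hb : ∀ᶠ x in atBot, 1 ≤ G x) (h₁ : IsLeftAngle G θ₁) (h₂ : IsLeftAngle G θ₂) : θ₁ = θ₂ :=
  funext fun _ => le_antisymm (h₂.le hG hb h₁ fun _ _ => le_rfl) (h₁.le hG hb h₂ fun _ _ => le_rfl)

/-- A limit, along an ultrafilter, of Prüfer angles in `[0, π/4]` is a left angle. -/
theorem exists_isLeftAngle_ultrafilter {ι : Type*} (l : Ultrafilter ι) {G : ι → ℝ → ℝ}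
    {G₀ : ℝ → ℝ} {θ : ι → ℝ → ℝ} (hG₀ : Continuous G₀) (hG : TendstoLocUnif G l G₀) {a : ℝ}
    (hθ : ∀ᶠ i in l, IsPrufer (G i) (θ i))
    (hm : ∀ x ≤ a, ∀ᶠ i in (l : Filter ι), θ i x ∈ Icc 0 (π / 4)) :
    ∃ θ₀, IsLeftAngle G₀ θ₀ ∧ ∀ x, Tendsto (fun i => θ i x) l (𝓝 (θ₀ x)) := by
  obtain ⟨c, -, hc⟩ := isCompact_Icc.ultrafilter_le_nhds (l.map fun i => θ i a)
    (le_principal_iff.2 (hm a le_rfl))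
  obtain ⟨θ₀, hθ₀, h0⟩ := exists_isPrufer hG₀ a c
  have ht : ∀ x, Tendsto (fun i => θ i x) l (𝓝 (θ₀ x)) :=
    hθ₀.tendsto hG₀ hG hθ (x₀ := a) (by rw [h0]; exact hc)
  refine ⟨θ₀, ⟨hθ₀, ?_⟩, ht⟩
  filter_upwards [eventually_le_atBot a] with x hx
  exact isClosed_Icc.mem_of_tendsto (ht x) (hm x hx)

/-- Start the angle at `0` in the point `-n` and let `n → ∞` along a free ultrafilter; the barriers
keep it in `[0, π/4]`. -/
theorem exists_isLeftAngle {G : ℝ → ℝ} (hG : Continuous G) (hb : ∀ᶠ x in atBot, 1 ≤ G x) :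
    ∃ θ, IsLeftAngle G θ := by
  obtain ⟨a, ha⟩ := eventually_atBot.1 hb
  choose θ hθ hθ0 using fun n : ℕ => exists_isPrufer hG (-n : ℝ) 0
  obtain ⟨θ₀, h, -⟩ := exists_isLeftAngle_ultrafilter (hyperfilter ℕ) (G := fun _ => G) hG
    (fun _ ε hε => Eventually.of_forall fun _ _ _ => by simpa using hε.le)
    (θ := θ) (a := a) (Eventually.of_forall hθ) fun x hx => by
      apply Nat.hyperfilter_le_atTop
      have : ∀ᶠ n : ℕ in atTop, -x ≤ n := tendsto_natCast_atTop_atTop.eventually_ge_atTop (-x)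
      filter_upwards [this] with n hn
      refine (hθ n).mem_Icc hG (a := -n) (by linarith) (fun z hz => ha z (hz.2.trans hx)) ?_
      rw [hθ0]; constructor <;> positivity
  exact ⟨θ₀, h⟩

/-- Left angles depend continuously on the coefficient. -/
theorem IsLeftAngle.tendsto {ι : Type*} {l : Filter ι} {G : ι → ℝ → ℝ} {G₀ : ℝ → ℝ}
    {θ : ι → ℝ → ℝ} {θ₀ : ℝ → ℝ} (hG₀ : Continuous G₀) (hG : TendstoLocUnif G l G₀) {a : ℝ}
    (hG₀a : ∀ x ≤ a, 1 ≤ G₀ x) (hGa : ∀ᶠ i in l, ∀ x ≤ a, 1 ≤ G i x)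
    (hGc : ∀ᶠ i in l, Continuous (G i))
    (hθ : ∀ᶠ i in l, IsLeftAngle (G i) (θ i)) (hθ₀ : IsLeftAngle G₀ θ₀) (x : ℝ) :
    Tendsto (fun i => θ i x) l (𝓝 (θ₀ x)) := by
  -- By compactness the limit along any ultrafilter exists and is a left angle; uniqueness
  -- identifies it.
  rw [tendsto_iff_ultrafilter]
  intro g hg
  obtain ⟨θ', h', ht⟩ := exists_isLeftAngle_ultrafilter g hG₀
    (fun b ε hε => hg (hG b ε hε)) (θ := θ) (a := a)
    ((hθ.filter_mono hg).mono fun i hi => hi.1) fun x hx => by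
      filter_upwards [hθ.filter_mono hg, hGa.filter_mono hg, hGc.filter_mono hg] with i h1 h2 h3
      exact h1.mem_Icc h3 h2 hx
  rw [hθ₀.unique hG₀ (eventually_atBot.2 ⟨a, hG₀a⟩) h']
  exact ht x

end SturmLiouville

/-! ### Total angle, decaying solutions and their exponential bounds. -/

namespace SturmLiouville
open Real Set

/-- Coefficients of `u'' = G u` for which there are solutions decaying at `±∞`. -/
structure Confining (G : ℝ → ℝ) : Prop where
  continuous : Continuous G
  atBot : ∀ᶠ x in atBot, 1 ≤ G x
  atTop : ∀ᶠ x in atTop, 1 ≤ G x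

/-- The coefficient reflected at the origin. -/
def reflect (G : ℝ → ℝ) (x : ℝ) : ℝ := G (-x)

theorem Confining.reflect {G : ℝ → ℝ} (h : Confining G) : Confining (reflect G) where
  continuous := h.continuous.comp continuous_neg
  atBot := tendsto_neg_atBot_atTop.eventually h.atTop
  atTop := tendsto_neg_atTop_atBot.eventually h.atBot

theorem Confining.of_forall {G : ℝ → ℝ} (hG : Continuous G) {R : ℝ}
    (h : ∀ x, R ≤ |x| → 1 ≤ G x) : Confining G where
  continuous := hG
  atBot := by
    filter_upwards [eventually_le_atBot (-|R|)] with x hx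
    refine h x ?_
    have := le_abs_self R; have := neg_abs_le x; have := neg_le_abs x; linarith
  atTop := by
    filter_upwards [eventually_ge_atTop |R|] with x hx
    exact h x ((le_abs_self R).trans (hx.trans (le_abs_self x)))

theorem Confining.exists_radius {G : ℝ → ℝ} (h : Confining G) :
    ∃ R, 0 ≤ R ∧ ∀ x, R ≤ |x| → 1 ≤ G x := by
  obtain ⟨a, ha⟩ := eventually_atBot.1 h.atBot
  obtain ⟨b, hb⟩ := eventually_atTop.1 h.atTop
  refine ⟨|a| + |b|, by positivity, fun x hx => ?_⟩
  have := neg_abs_le a; have := le_abs_self b; have := abs_nonneg a; have := abs_nonneg b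
  rcases abs_cases x with h' | h'
  · exact hb x (by linarith)
  · exact ha x (by linarith)

open Classical in
/-- The left angle of a coefficient. -/
noncomputable def leftAngle (G : ℝ → ℝ) : ℝ → ℝ :=
  if h : ∃ θ, IsLeftAngle G θ then h.choose else 0

theorem Confining.isLeftAngle {G : ℝ → ℝ} (h : Confining G) : IsLeftAngle G (leftAngle G) := by
  have he := exists_isLeftAngle h.continuous h.atBot
  rw [leftAngle, dif_pos he]
  exact he.choose_spec

/-- The total Prüfer angle; it is a multiple of `π` exactly when `u'' = G u` has a solution
decaying at both ends. -/
noncomputable def totalAngle (G : ℝ → ℝ) : ℝ := leftAngle G 0 + leftAngle (reflect G) 0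

theorem totalAngle_pos {G : ℝ → ℝ} (h : Confining G) : 0 < totalAngle G :=
  add_pos (h.isLeftAngle.pos h.continuous 0) (h.reflect.isLeftAngle.pos h.reflect.continuous 0)

theorem totalAngle_anti {G₁ G₂ : ℝ → ℝ} (h₁ : Confining G₁) (h₂ : Confining G₂)
    (hlt : ∀ x, G₁ x < G₂ x) : totalAngle G₂ < totalAngle G₁ := by
  have h2 : leftAngle (reflect G₂) 0 ≤ leftAngle (reflect G₁) 0 :=
    h₁.reflect.isLeftAngle.le h₁.reflect.continuous h₁.reflect.atBot h₂.reflect.isLeftAngle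
      fun x _ => (hlt (-x)).le
  have hle : ∀ x, leftAngle G₂ x ≤ leftAngle G₁ x := fun x =>
    h₁.isLeftAngle.le h₁.continuous h₁.atBot h₂.isLeftAngle fun x _ => (hlt x).le
  -- Equality at `0` would force equality on the whole half-line, since the weighted difference is
  -- nonpositive and decreasing there. Its derivative then vanishes, hence so does `sin (leftAngle
  -- G₂)`, which is impossible near `-∞`.
  have h1 : leftAngle G₂ 0 < leftAngle G₁ 0 := by
    refine (hle 0).lt_of_ne fun heq => ?_
    obtain ⟨A, -, -, hA⟩ := h₁.isLeftAngle.1.exists_factor h₁.continuous h₂.isLeftAngle.1 0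
    have hs : ∀ x ≤ 0, sin (leftAngle G₂ x) = 0 := by
      intro x hx
      obtain ⟨B, hB⟩ := h₁.isLeftAngle.1.antitoneOn h₁.continuous h₂.isLeftAngle.1
        (convex_Iic 0) (fun x _ => (hlt x).le)
      have h3 : leftAngle G₂ x = leftAngle G₁ x := by
        have := hB (mem_Iic.2 hx) self_mem_Iic hx
        simp only [heq, sub_self, zero_mul] at this
        have := nonneg_of_mul_nonneg_left this (exp_pos _)
        linarith [hle x]
      have hmax : IsLocalMax (fun y => (leftAngle G₂ y - leftAngle G₁ y) * exp (A y)) x :=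
        Eventually.of_forall fun y => by
          simp only [h3, sub_self, zero_mul]
          exact mul_nonpos_of_nonpos_of_nonneg (by linarith [hle y]) (exp_pos _).le
      have h4 := hmax.hasDerivAt_eq_zero (hA x)
      have h5 : G₁ x - G₂ x ≠ 0 := (sub_neg.2 (hlt x)).ne
      simpa [h5, (exp_pos (A x)).ne'] using h4
    obtain ⟨y, hy, hy0⟩ := (h₂.isLeftAngle.2.and (eventually_le_atBot 0)).exists
    have h6 : 0 < sin (leftAngle G₂ y) :=
      sin_pos_of_pos_of_lt_pi (h₂.isLeftAngle.pos h₂.continuous y) (by linarith [hy.2, pi_pos])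
    exact h6.ne' (hs y hy0)
  rw [totalAngle, totalAngle]; linarith

theorem TendstoLocUnif.reflect {ι : Type*} {l : Filter ι} {G : ι → ℝ → ℝ} {G₀ : ℝ → ℝ}
    (h : TendstoLocUnif G l G₀) :
    TendstoLocUnif (fun i => reflect (G i)) l (reflect G₀) := fun a ε hε => by
  filter_upwards [h a ε hε] with i hi x hx
  exact hi (-x) ⟨by linarith [hx.2], by linarith [hx.1]⟩

/-- Convergence of confining coefficients with a common radius of confinement. -/
structure ConfinedTendsto {ι : Type*} (G : ι → ℝ → ℝ) (l : Filter ι) (G₀ : ℝ → ℝ) (R : ℝ) :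
    Prop where
  cont : ∀ᶠ i in l, Continuous (G i)
  cont₀ : Continuous G₀
  unif : TendstoLocUnif G l G₀
  conf : ∀ᶠ i in l, ∀ x, R ≤ |x| → 1 ≤ G i x
  conf₀ : ∀ x, R ≤ |x| → 1 ≤ G₀ x

namespace ConfinedTendsto
variable {ι : Type*} {l : Filter ι} {G : ι → ℝ → ℝ} {G₀ : ℝ → ℝ} {R : ℝ}

theorem reflect (h : ConfinedTendsto G l G₀ R) :
    ConfinedTendsto (fun i => reflect (G i)) l (SturmLiouville.reflect G₀) R where
  cont := h.cont.mono fun _ hi => hi.comp continuous_neg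
  cont₀ := h.cont₀.comp continuous_neg
  unif := h.unif.reflect
  conf := h.conf.mono fun i hi x hx => hi (-x) (by simpa using hx)
  conf₀ := fun x hx => h.conf₀ (-x) (by simpa using hx)

theorem confining (h : ConfinedTendsto G l G₀ R) : ∀ᶠ i in l, Confining (G i) := by
  filter_upwards [h.cont, h.conf] with i h1 h2 using Confining.of_forall h1 h2

theorem confining₀ (h : ConfinedTendsto G l G₀ R) : Confining G₀ :=
  Confining.of_forall h.cont₀ h.conf₀

theorem leftAngle (h : ConfinedTendsto G l G₀ R) (x : ℝ) :
    Tendsto (fun i => leftAngle (G i) x) l (𝓝 (SturmLiouville.leftAngle G₀ x)) := by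
  have hR : ∀ x ≤ -R, R ≤ |x| := fun x hx => le_trans (by linarith) (neg_le_abs x)
  exact IsLeftAngle.tendsto h.cont₀ h.unif (a := -R) (fun x hx => h.conf₀ x (hR x hx))
    (h.conf.mono fun i hi x hx => hi x (hR x hx)) h.cont
    (h.confining.mono fun i hi => hi.isLeftAngle) h.confining₀.isLeftAngle x

theorem totalAngle (h : ConfinedTendsto G l G₀ R) :
    Tendsto (fun i => totalAngle (G i)) l (𝓝 (SturmLiouville.totalAngle G₀)) :=
  (h.leftAngle 0).add (h.reflect.leftAngle 0)

end ConfinedTendsto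

/-- The amplitude belonging to a Prüfer angle, normalized to be `1` at `0`. -/
noncomputable def amplitude (G θ : ℝ → ℝ) (x : ℝ) : ℝ :=
  exp (∫ t in (0 : ℝ)..x, (1 + G t) * (sin (θ t) * cos (θ t)))

theorem amplitude_pos (G θ : ℝ → ℝ) (x : ℝ) : 0 < amplitude G θ x := exp_pos _

theorem amplitude_zero (G θ : ℝ → ℝ) : amplitude G θ 0 = 1 := by simp [amplitude]

theorem hasDerivAt_amplitude {G θ : ℝ → ℝ} (hG : Continuous G) (hθ : Continuous θ) (x : ℝ) :
    HasDerivAt (amplitude G θ) (amplitude G θ x * ((1 + G x) * (sin (θ x) * cos (θ x)))) x := by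
  have hc : Continuous fun t => (1 + G t) * (sin (θ t) * cos (θ t)) := by fun_prop
  exact ((hc.integral_hasStrictDerivAt 0 x).hasDerivAt).exp

/-- The solution of `u'' = G u` decaying at `-∞`. -/
noncomputable def leftSol (G : ℝ → ℝ) (x : ℝ) : ℝ :=
  amplitude G (leftAngle G) x * sin (leftAngle G x)

/-- The derivative of `leftSol G`. -/
noncomputable def leftSol' (G : ℝ → ℝ) (x : ℝ) : ℝ :=
  amplitude G (leftAngle G) x * cos (leftAngle G x)

theorem hasDerivAt_leftSol {G : ℝ → ℝ} (h : Confining G) (x : ℝ) :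
    HasDerivAt (leftSol G) (leftSol' G x) x := by
  have hθ := h.isLeftAngle.1
  refine ((hasDerivAt_amplitude h.continuous hθ.continuous x).mul (hθ x).sin).congr_deriv ?_
  have := sin_sq_add_cos_sq (leftAngle G x)
  rw [leftSol']
  linear_combination (amplitude G (leftAngle G) x * cos (leftAngle G x)) * this

theorem hasDerivAt_leftSol' {G : ℝ → ℝ} (h : Confining G) (x : ℝ) :
    HasDerivAt (leftSol' G) (G x * leftSol G x) x := by
  have hθ := h.isLeftAngle.1
  refine ((hasDerivAt_amplitude h.continuous hθ.continuous x).mul (hθ x).cos).congr_deriv ?_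
  have := sin_sq_add_cos_sq (leftAngle G x)
  rw [leftSol]
  linear_combination (amplitude G (leftAngle G) x * sin (leftAngle G x) * G x) * this

theorem continuous_leftSol {G : ℝ → ℝ} (h : Confining G) : Continuous (leftSol G) :=
  continuous_iff_continuousAt.2 fun x => (hasDerivAt_leftSol h x).continuousAt

theorem continuous_leftSol' {G : ℝ → ℝ} (h : Confining G) : Continuous (leftSol' G) :=
  continuous_iff_continuousAt.2 fun x => (hasDerivAt_leftSol' h x).continuousAt

theorem leftSol_sq_add_sq (G : ℝ → ℝ) (x : ℝ) :
    leftSol G x ^ 2 + leftSol' G x ^ 2 = amplitude G (leftAngle G) x ^ 2 := by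
  rw [leftSol, leftSol']
  linear_combination amplitude G (leftAngle G) x ^ 2 * sin_sq_add_cos_sq (leftAngle G x)

/-- The angle lies in `[0, π/4]`, where `0 ≤ sin ≤ cos`. As a consequence `u exp (-x)` increases,
which is the source of all exponential decay below. -/
theorem leftSol_bounds_of_le {G : ℝ → ℝ} (hG : Confining G) {a : ℝ}
    (h : ∀ x ≤ a, 1 ≤ G x) {x : ℝ} (hx : x ≤ a) :
    0 ≤ leftSol G x ∧ leftSol G x ≤ leftSol' G x := by
  have hm := hG.isLeftAngle.mem_Icc hG.continuous h hx
  have hp := pi_pos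
  have h1 : 0 ≤ sin (leftAngle G x) :=
    sin_nonneg_of_nonneg_of_le_pi hm.1 (by linarith [hm.2])
  have h2 : sin (leftAngle G x) ≤ cos (leftAngle G x) := by
    rw [← cos_pi_div_two_sub]
    exact cos_le_cos_of_nonneg_of_le_pi (by linarith [hm.1]) (by linarith [hm.2, hm.1])
      (by linarith [hm.2])
  exact ⟨mul_nonneg (amplitude_pos _ _ _).le h1,
    mul_le_mul_of_nonneg_left h2 (amplitude_pos _ _ _).le⟩

theorem leftSol_le_exp {G : ℝ → ℝ} (hG : Confining G) {a : ℝ}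
    (h : ∀ x ≤ a, 1 ≤ G x) {x : ℝ} (hx : x ≤ a) :
    leftSol G x ≤ leftSol G a * exp (x - a) := by
  have hd : ∀ x, HasDerivAt (fun y => leftSol G y * exp (-y))
      ((leftSol' G x - leftSol G x) * exp (-x)) x := fun x => by
    refine ((hasDerivAt_leftSol hG x).mul (hasDerivAt_neg x).exp).congr_deriv ?_
    ring
  have hm : MonotoneOn (fun y => leftSol G y * exp (-y)) (Iic a) :=
    monotoneOn_of_hasDerivWithinAt_nonneg (convex_Iic a)
      (fun x _ => (hd x).continuousAt.continuousWithinAt)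
      (fun x _ => (hd x).hasDerivWithinAt) fun x hx =>
        mul_nonneg (by linarith [(leftSol_bounds_of_le hG h (mem_Iic.1 (interior_subset hx))).2])
          (exp_pos _).le
  have h1 := hm (mem_Iic.2 hx) self_mem_Iic hx
  simp only at h1
  calc leftSol G x = leftSol G x * exp (-x) * exp x := by
        rw [mul_assoc, ← exp_add]; simp
    _ ≤ leftSol G a * exp (-a) * exp x := by gcongr
    _ = leftSol G a * exp (x - a) := by rw [mul_assoc, ← exp_add]; ring_nf

theorem amplitude_le {G θ : ℝ → ℝ} {M R : ℝ} (hM : ∀ x ∈ Icc (-R) R, |G x| ≤ M) {x : ℝ}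
    (hx : |x| ≤ R) : amplitude G θ x ≤ exp ((1 + M) * R) := by
  have hR : 0 ≤ R := (abs_nonneg x).trans hx
  have hM0 : 0 ≤ M := (abs_nonneg _).trans (hM 0 ⟨by linarith, hR⟩)
  rw [amplitude, exp_le_exp]
  have h1 := intervalIntegral.norm_integral_le_of_norm_le_const (a := 0) (b := x) (C := 1 + M)
    (f := fun t => (1 + G t) * (sin (θ t) * cos (θ t))) fun t ht => ?_
  · rw [Real.norm_eq_abs, sub_zero] at h1
    calc _ ≤ _ := le_abs_self _
      _ ≤ (1 + M) * |x| := h1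
      _ ≤ (1 + M) * R := by gcongr
  · have ht' : t ∈ Icc (-R) R := by
      have ht := uIoc_subset_uIcc ht
      rw [mem_uIcc] at ht
      have := abs_le.1 hx
      rcases ht with ht | ht <;> constructor <;> linarith [ht.1, ht.2]
    rw [Real.norm_eq_abs, abs_mul, abs_mul]
    calc _ ≤ (|1| + |G t|) * (1 * 1) := by
          gcongr
          · exact abs_add_le _ _
          · exact abs_sin_le_one _
          · exact abs_cos_le_one _
      _ ≤ 1 + M := by rw [abs_one]; linarith [hM t ht']

/-- An exponential bound of the left solution that depends on the coefficient only through its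
size on a bounded interval. -/
theorem abs_leftSol_le {G : ℝ → ℝ} (hG : Confining G) {M R : ℝ} (hR : 0 ≤ R)
    (hM : ∀ x ∈ Icc (-R) R, |G x| ≤ M) (h : ∀ x, R ≤ |x| → 1 ≤ G x) {x : ℝ} (hx : x ≤ 0) :
    |leftSol G x| ≤ exp ((1 + M) * R + R) * exp x := by
  have h0 : ∀ y, |y| ≤ R → |leftSol G y| ≤ exp ((1 + M) * R) := by
    intro y hy
    rw [leftSol, abs_mul, abs_of_pos (amplitude_pos _ _ _)]
    calc _ ≤ exp ((1 + M) * R) * 1 := by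
          gcongr
          · exact amplitude_le hM hy
          · exact abs_sin_le_one _
      _ = _ := mul_one _
  have hl : ∀ x ≤ -R, 1 ≤ G x := fun x hx => h x (le_trans (by linarith) (neg_le_abs x))
  rcases le_total (-R) x with hxR | hxR
  · refine (h0 x (abs_le.2 ⟨hxR, hx.trans hR⟩)).trans ?_
    rw [← exp_add, exp_le_exp]; linarith
  · rw [abs_of_nonneg (leftSol_bounds_of_le hG hl hxR).1]
    calc leftSol G x ≤ leftSol G (-R) * exp (x - -R) := leftSol_le_exp hG hl hxR
      _ ≤ exp ((1 + M) * R) * exp (x - -R) := by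
        gcongr
        exact (le_abs_self _).trans (h0 (-R) (by simp [abs_of_nonneg hR]))
      _ = _ := by rw [← exp_add, ← exp_add]; ring_nf

theorem exists_abs_leftSol_le {G : ℝ → ℝ} (hG : Confining G) :
    ∃ C, ∀ x ≤ 0, |leftSol G x| ≤ C * exp x := by
  obtain ⟨R, hR, h⟩ := hG.exists_radius
  obtain ⟨M, -, hM⟩ := exists_bound_Icc hG.continuous (-R) R
  exact ⟨_, fun x hx => abs_leftSol_le hG hR hM h hx⟩

theorem exists_abs_leftSol'_le {G : ℝ → ℝ} (hG : Confining G) :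
    ∃ C, ∀ x ≤ 0, |leftSol' G x| ≤ C * exp x := by
  obtain ⟨C, hC⟩ := exists_abs_leftSol_le hG
  obtain ⟨R, hR, h⟩ := hG.exists_radius
  have hl : ∀ x ≤ -R, 1 ≤ G x := fun x hx => h x (le_trans (by linarith) (neg_le_abs x))
  obtain ⟨M, hM0, hM⟩ := exists_bound_Icc (continuous_leftSol' hG) (-(R + 1)) 0
  refine ⟨max (C * exp 1) (M * exp (R + 1)), fun x hx => ?_⟩
  rcases le_total (-(R + 1)) x with hxR | hxR
  · calc |leftSol' G x| ≤ M := hM x ⟨hxR, hx⟩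
      _ ≤ M * exp (R + 1) * exp x := by
        rw [mul_assoc, ← exp_add]
        exact le_mul_of_one_le_right hM0 (one_le_exp (by linarith))
      _ ≤ _ := by gcongr; exact le_max_right _ _
  · have hb := leftSol_bounds_of_le hG hl (x := x) (by linarith)
    rw [abs_of_nonneg (hb.1.trans hb.2)]
    -- Left of `-R` the solution is convex because `u'' = G u ≥ 0`. So `u' x` is at most the slope
    -- of `u` over `[x, x + 1]`, and decay of `u` passes to `u'`.
    obtain ⟨ξ, hξ, he⟩ := exists_hasDerivAt_eq_slope (leftSol G) (leftSol' G)
      (show x < x + 1 by linarith) (continuous_leftSol hG).continuousOn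
      fun y _ => hasDerivAt_leftSol hG y
    have hmono : MonotoneOn (leftSol' G) (Iic (-R)) :=
      monotoneOn_of_hasDerivWithinAt_nonneg (convex_Iic _)
        (continuous_leftSol' hG).continuousOn
        (fun x _ => (hasDerivAt_leftSol' hG x).hasDerivWithinAt) fun y hy => by
          have hy := mem_Iic.1 (interior_subset hy)
          exact mul_nonneg (by linarith [hl y hy]) (leftSol_bounds_of_le hG hl hy).1
    calc leftSol' G x ≤ leftSol' G ξ :=
          hmono (mem_Iic.2 (by linarith)) (mem_Iic.2 (by linarith [hξ.2])) hξ.1.le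
      _ = leftSol G (x + 1) - leftSol G x := by rw [he]; simp
      _ ≤ leftSol G (x + 1) := by linarith [hb.1]
      _ ≤ C * exp (x + 1) := (le_abs_self _).trans (hC _ (by linarith))
      _ = C * exp 1 * exp x := by rw [exp_add]; ring
      _ ≤ _ := by gcongr; exact le_max_left _ _

theorem ConfinedTendsto.leftSol {ι : Type*} {l : Filter ι} {G : ι → ℝ → ℝ} {G₀ : ℝ → ℝ} {R : ℝ}
    [l.IsCountablyGenerated] (h : ConfinedTendsto G l G₀ R) (x : ℝ) :
    Tendsto (fun i => leftSol (G i) x) l (𝓝 (SturmLiouville.leftSol G₀ x)) := by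
  obtain ⟨M, hM0, hM⟩ := exists_bound_Icc h.cont₀ (-|x|) |x|
  have hGx : ∀ t ∈ Icc (-|x|) |x|, Tendsto (fun i => G i t) l (𝓝 (G₀ t)) := by
    intro t ht
    rw [Metric.tendsto_nhds]
    intro ε hε
    filter_upwards [h.unif |x| (ε / 2) (by linarith)] with i hi
    rw [Real.dist_eq]; linarith [hi t ht]
  have hsub : ∀ t ∈ Set.uIoc 0 x, t ∈ Icc (-|x|) |x| := by
    intro t ht
    have ht := uIoc_subset_uIcc ht
    rw [mem_uIcc] at ht
    have := neg_abs_le x; have := le_abs_self x; have := abs_nonneg x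
    rcases ht with ht | ht <;> constructor <;> linarith [ht.1, ht.2]
  refine Tendsto.mul ((continuous_exp.tendsto _).comp ?_)
    ((continuous_sin.tendsto _).comp (h.leftAngle x))
  refine intervalIntegral.tendsto_integral_filter_of_dominated_convergence (fun _ => 2 + M)
    ?_ ?_ (by simp) ?_
  · filter_upwards [h.confining] with i hi
    have := hi.continuous; have := hi.isLeftAngle.1.continuous
    exact Continuous.aestronglyMeasurable (by fun_prop)
  · filter_upwards [h.unif |x| 1 one_pos] with i hi
    refine Eventually.of_forall fun t ht => ?_
    rw [Real.norm_eq_abs, abs_mul, abs_mul]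
    have h1 := hi t (hsub t ht)
    have h2 := hM t (hsub t ht)
    have h3 : |G i t| ≤ 1 + M := by
      calc |G i t| = |(G i t - G₀ t) + G₀ t| := by ring_nf
        _ ≤ _ := (abs_add_le _ _).trans (by linarith)
    calc _ ≤ (|1| + |G i t|) * (1 * 1) := by
          gcongr
          · exact abs_add_le _ _
          · exact abs_sin_le_one _
          · exact abs_cos_le_one _
      _ ≤ 2 + M := by rw [abs_one]; linarith
  · refine Eventually.of_forall fun t ht => ?_
    exact (tendsto_const_nhds.add (hGx t (hsub t ht))).mul
      (((continuous_sin.tendsto _).comp (h.leftAngle t)).mul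
        ((continuous_cos.tendsto _).comp (h.leftAngle t)))

end SturmLiouville

/-! ### Growth classes, and square integrable solutions as multiples of the decaying one. -/

namespace SturmLiouville
open Real Set

/-- Functions of at most polynomial growth. -/
def PolyBdd (f : ℝ → ℝ) : Prop := ∃ C, ∃ N : ℕ, 0 ≤ C ∧ ∀ x, |f x| ≤ C * (1 + |x|) ^ N

/-- Functions bounded by a polynomial times `exp (-|x|)`. -/
def ExpDecay (f : ℝ → ℝ) : Prop :=
  ∃ C, ∃ N : ℕ, 0 ≤ C ∧ ∀ x, |f x| ≤ C * (1 + |x|) ^ N * exp (-|x|)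

theorem PolyBdd.mul {f g : ℝ → ℝ} (hf : PolyBdd f) (hg : PolyBdd g) :
    PolyBdd fun x => f x * g x := by
  obtain ⟨C, N, hC, h⟩ := hf
  obtain ⟨D, M, hD, h'⟩ := hg
  refine ⟨C * D, N + M, by positivity, fun x => ?_⟩
  rw [abs_mul]
  calc _ ≤ (C * (1 + |x|) ^ N) * (D * (1 + |x|) ^ M) := by gcongr; exacts [h x, h' x]
    _ = _ := by ring

theorem PolyBdd.add {f g : ℝ → ℝ} (hf : PolyBdd f) (hg : PolyBdd g) :
    PolyBdd fun x => f x + g x := by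
  obtain ⟨C, N, hC, h⟩ := hf
  obtain ⟨D, M, hD, h'⟩ := hg
  refine ⟨C + D, N + M, by positivity, fun x => (abs_add_le _ _).trans ?_⟩
  have h1 : 1 ≤ 1 + |x| := by linarith [abs_nonneg x]
  calc _ ≤ C * (1 + |x|) ^ N + D * (1 + |x|) ^ M := add_le_add (h x) (h' x)
    _ ≤ C * (1 + |x|) ^ (N + M) + D * (1 + |x|) ^ (N + M) := by
      gcongr <;> first | exact h1 | omega
    _ = _ := by ring

theorem polyBdd_const (c : ℝ) : PolyBdd fun _ => c := ⟨|c|, 0, abs_nonneg c, by simp⟩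

theorem polyBdd_id : PolyBdd fun x => x := ⟨1, 1, by simp, fun x => by simp⟩

theorem PolyBdd.pow {f : ℝ → ℝ} (hf : PolyBdd f) (n : ℕ) : PolyBdd fun x => f x ^ n := by
  induction n with
  | zero => simpa using polyBdd_const 1
  | succ n ih => simpa [pow_succ] using ih.mul hf

theorem PolyBdd.neg {f : ℝ → ℝ} (hf : PolyBdd f) : PolyBdd fun x => -f x := by
  simpa using (polyBdd_const (-1)).mul hf

theorem PolyBdd.sub {f g : ℝ → ℝ} (hf : PolyBdd f) (hg : PolyBdd g) :
    PolyBdd fun x => f x - g x := by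
  simpa [sub_eq_add_neg] using hf.add hg.neg

theorem ExpDecay.polyBdd {f : ℝ → ℝ} (hf : ExpDecay f) : PolyBdd f := by
  obtain ⟨C, N, hC, h⟩ := hf
  refine ⟨C, N, hC, fun x => (h x).trans (mul_le_of_le_one_right (by positivity) ?_)⟩
  simp

theorem PolyBdd.mul_expDecay {f g : ℝ → ℝ} (hf : PolyBdd f) (hg : ExpDecay g) :
    ExpDecay fun x => f x * g x := by
  obtain ⟨C, N, hC, h⟩ := hf
  obtain ⟨D, M, hD, h'⟩ := hg
  refine ⟨C * D, N + M, by positivity, fun x => ?_⟩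
  rw [abs_mul]
  calc _ ≤ (C * (1 + |x|) ^ N) * (D * (1 + |x|) ^ M * exp (-|x|)) := by
        gcongr; exacts [h x, h' x]
    _ = _ := by ring

theorem ExpDecay.mul {f g : ℝ → ℝ} (hf : ExpDecay f) (hg : ExpDecay g) :
    ExpDecay fun x => f x * g x := hf.polyBdd.mul_expDecay hg

theorem ExpDecay.add {f g : ℝ → ℝ} (hf : ExpDecay f) (hg : ExpDecay g) :
    ExpDecay fun x => f x + g x := by
  obtain ⟨C, N, hC, h⟩ := hf
  obtain ⟨D, M, hD, h'⟩ := hg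
  refine ⟨C + D, N + M, by positivity, fun x => (abs_add_le _ _).trans ?_⟩
  have h1 : 1 ≤ 1 + |x| := by linarith [abs_nonneg x]
  calc _ ≤ C * (1 + |x|) ^ N * exp (-|x|) + D * (1 + |x|) ^ M * exp (-|x|) :=
        add_le_add (h x) (h' x)
    _ ≤ C * (1 + |x|) ^ (N + M) * exp (-|x|) + D * (1 + |x|) ^ (N + M) * exp (-|x|) := by
      gcongr <;> first | exact h1 | omega
    _ = _ := by ring

theorem ExpDecay.neg {f : ℝ → ℝ} (hf : ExpDecay f) : ExpDecay fun x => -f x := by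
  simpa using (polyBdd_const (-1)).mul_expDecay hf

theorem ExpDecay.sub {f g : ℝ → ℝ} (hf : ExpDecay f) (hg : ExpDecay g) :
    ExpDecay fun x => f x - g x := by
  simpa [sub_eq_add_neg] using hf.add hg.neg

theorem one_add_abs_pow_mul_exp_le (N : ℕ) (x : ℝ) :
    (1 + |x|) ^ N * exp (-|x|) ≤ (N + 2).factorial * exp 1 * (1 + x ^ 2)⁻¹ := by
  have hx := abs_nonneg x
  have h1 := pow_div_factorial_le_exp (1 + |x|) (by positivity) (N + 2)
  rw [div_le_iff₀ (by positivity)] at h1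
  have h2 : 1 + x ^ 2 ≤ (1 + |x|) ^ 2 := by nlinarith [sq_abs x]
  rw [← div_eq_mul_inv, le_div_iff₀ (by positivity)]
  calc (1 + |x|) ^ N * exp (-|x|) * (1 + x ^ 2)
      ≤ (1 + |x|) ^ N * exp (-|x|) * (1 + |x|) ^ 2 := by gcongr
    _ = (1 + |x|) ^ (N + 2) * exp (-|x|) := by ring
    _ ≤ (exp (1 + |x|) * (N + 2).factorial) * exp (-|x|) := by gcongr
    _ = (N + 2).factorial * (exp (1 + |x|) * exp (-|x|)) := by ring
    _ = _ := by rw [← exp_add]; simp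

theorem integrable_one_add_abs_pow_mul_exp (C : ℝ) (N : ℕ) :
    Integrable fun x : ℝ => C * (1 + |x|) ^ N * exp (-|x|) := by
  have : Integrable fun x : ℝ => (1 + |x|) ^ N * exp (-|x|) := by
    refine (integrable_inv_one_add_sq.const_mul ((N + 2).factorial * exp 1)).mono'
      (Continuous.aestronglyMeasurable (by fun_prop)) (Eventually.of_forall fun x => ?_)
    rw [Real.norm_eq_abs, abs_of_nonneg (by positivity)]
    exact one_add_abs_pow_mul_exp_le N x
  simpa [mul_assoc] using this.const_mul C

theorem ExpDecay.integrable {f : ℝ → ℝ} (hf : ExpDecay f) (hc : Continuous f) :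
    Integrable f := by
  obtain ⟨C, N, hC, h⟩ := hf
  exact (integrable_one_add_abs_pow_mul_exp C N).mono' hc.aestronglyMeasurable
    (Eventually.of_forall h)

/-- A solution that is proportional to `leftSol G` at one point is a multiple of it. -/
theorem exists_eq_mul_leftSol {G : ℝ → ℝ} (hG : Confining G) {u u' : ℝ → ℂ}
    (hu : ∀ x, HasDerivAt u (u' x) x) (hu' : ∀ x, HasDerivAt u' (G x * u x) x) {x₀ : ℝ}
    (h0 : u x₀ * leftSol' G x₀ - u' x₀ * leftSol G x₀ = 0) :
    ∀ x, u x = (u 0 * leftSol G 0 + u' 0 * leftSol' G 0) * leftSol G x ∧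
      u' x = (u 0 * leftSol G 0 + u' 0 * leftSol' G 0) * leftSol' G x := by
  have hw : ∀ x, HasDerivAt (fun y => (leftSol G y : ℂ)) (leftSol' G x) x :=
    fun x => (hasDerivAt_leftSol hG x).ofReal_comp
  have hw' : ∀ x, HasDerivAt (fun y => (leftSol' G y : ℂ)) (G x * leftSol G x) x :=
    fun x => by simpa using (hasDerivAt_leftSol' hG x).ofReal_comp
  have hW : ∀ x, u x * leftSol' G x - u' x * leftSol G x = 0 := by
    have hd : ∀ x, HasDerivAt (fun y => u y * leftSol' G y - u' y * leftSol G y) 0 x := by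
      intro x
      refine (((hu x).mul (hw' x)).sub ((hu' x).mul (hw x))).congr_deriv ?_
      ring
    intro x
    rw [← h0]
    exact is_const_of_deriv_eq_zero (fun x => (hd x).differentiableAt) (fun x => (hd x).deriv) x x₀
  -- The factor of proportionality is taken as `P / N`, since `leftSol` may have zeros while `N`,
  -- the squared amplitude, has none. A vanishing Wronskian makes this quotient constant.
  set N : ℝ → ℂ := fun x => (leftSol G x : ℂ) ^ 2 + (leftSol' G x : ℂ) ^ 2 with hN
  set P : ℝ → ℂ := fun x => u x * leftSol G x + u' x * leftSol' G x with hP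
  have hN0 : ∀ x, N x ≠ 0 := by
    intro x
    have : N x = ((amplitude G (leftAngle G) x ^ 2 : ℝ) : ℂ) := by
      rw [← leftSol_sq_add_sq]; push_cast; rfl
    rw [this]
    exact_mod_cast (pow_pos (amplitude_pos _ _ _) 2).ne'
  have hdN : ∀ x, HasDerivAt N (2 * (1 + G x) * leftSol G x * leftSol' G x) x := by
    intro x
    refine (((hw x).pow 2).add ((hw' x).pow 2)).congr_deriv ?_
    push_cast; ring
  have hdP : ∀ x, HasDerivAt P (2 * (1 + G x) * (u x * leftSol' G x)) x := by
    intro x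
    refine (((hu x).mul (hw x)).add ((hu' x).mul (hw' x))).congr_deriv ?_
    linear_combination (-(1 + G x : ℂ)) * hW x
  have hdq : ∀ x, HasDerivAt (fun y => P y / N y) 0 x := by
    intro x
    refine ((hdP x).div (hdN x) (hN0 x)).congr_deriv ?_
    rw [div_eq_zero_iff]; left
    simp only [hN, hP]
    linear_combination (2 * (1 + G x : ℂ) * leftSol' G x * leftSol' G x) * hW x
  have hconst : ∀ x, P x / N x = P 0 := by
    intro x
    have h1 := is_const_of_deriv_eq_zero (fun x => (hdq x).differentiableAt)
      (fun x => (hdq x).deriv) x 0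
    have h2 : N 0 = 1 := by
      have : N 0 = ((amplitude G (leftAngle G) 0 ^ 2 : ℝ) : ℂ) := by
        rw [← leftSol_sq_add_sq]; push_cast; rfl
      rw [this, amplitude_zero]; simp
    simpa [h2] using h1
  intro x
  have h3 := hconst x
  rw [div_eq_iff (hN0 x)] at h3
  change u x = P 0 * _ ∧ u' x = P 0 * _
  have h4 : P x = u x * leftSol G x + u' x * leftSol' G x := rfl
  have h5 : N x = (leftSol G x : ℂ) ^ 2 + (leftSol' G x : ℂ) ^ 2 := rfl
  constructor
  · apply mul_right_cancel₀ (hN0 x)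
    rw [h5] at h3 ⊢
    rw [h4] at h3
    linear_combination (leftSol' G x : ℂ) * hW x + (leftSol G x : ℂ) * h3
  · apply mul_right_cancel₀ (hN0 x)
    rw [h5] at h3 ⊢
    rw [h4] at h3
    linear_combination (-leftSol G x : ℂ) * hW x + (leftSol' G x : ℂ) * h3

theorem sin_totalAngle (G : ℝ → ℝ) :
    leftSol (reflect G) 0 * leftSol' G 0 + leftSol' (reflect G) 0 * leftSol G 0
      = sin (totalAngle G) := by
  simp only [leftSol, leftSol', amplitude_zero, totalAngle, sin_add]
  ring

/-- If the total angle is a multiple of `π`, the left and the right solution are proportional. -/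
theorem leftSol_eq_reflect {G : ℝ → ℝ} (hG : Confining G) (h : sin (totalAngle G) = 0) :
    ∃ c : ℝ, |c| = 1 ∧ ∀ x, leftSol G x = c * leftSol (reflect G) (-x) ∧
      leftSol' G x = -c * leftSol' (reflect G) (-x) := by
  have hr := hG.reflect
  have hu : ∀ x, HasDerivAt (fun y => (leftSol (reflect G) (-y) : ℂ))
      (-leftSol' (reflect G) (-x) : ℂ) x := fun x => by
    simpa using ((hasDerivAt_leftSol hr (-x)).scomp x (hasDerivAt_neg x)).ofReal_comp
  have hu' : ∀ x, HasDerivAt (fun y => (-leftSol' (reflect G) (-y) : ℂ))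
      (G x * leftSol (reflect G) (-x) : ℂ) x := fun x => by
    refine ((hasDerivAt_leftSol' hr (-x)).scomp x (hasDerivAt_neg x)).ofReal_comp.neg.congr_deriv ?_
    simp [reflect]
  have h1 := exists_eq_mul_leftSol hG hu hu' (x₀ := 0) (by
    rw [← sin_totalAngle] at h
    have h' := congrArg (Complex.ofReal) h
    push_cast at h'
    simp only [neg_zero]
    linear_combination h')
  set c : ℝ := leftSol (reflect G) 0 * leftSol G 0 - leftSol' (reflect G) 0 * leftSol' G 0 with hc
  have h2 : ∀ x, leftSol (reflect G) (-x) = c * leftSol G x ∧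
      -leftSol' (reflect G) (-x) = c * leftSol' G x := by
    intro x
    have := h1 x
    simp only [neg_zero] at this
    constructor
    · have := this.1
      rw [hc]
      apply Complex.ofReal_injective
      push_cast
      linear_combination this
    · have := this.2
      rw [hc]
      apply Complex.ofReal_injective
      push_cast
      linear_combination this
  -- Both solutions are normalized to amplitude `1` at `0`.
  have hcsq : c ^ 2 = 1 := by
    have e1 := leftSol_sq_add_sq G 0
    have e2 := leftSol_sq_add_sq (reflect G) 0
    have e3 := h2 0
    rw [amplitude_zero] at e1 e2
    rw [neg_zero] at e3
    have e4 : leftSol' (reflect G) 0 = -(c * leftSol' G 0) := by linarith [e3.2]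
    rw [e3.1, e4] at e2
    linear_combination e2 - c ^ 2 * e1
  refine ⟨c, ?_, fun x => ⟨?_, ?_⟩⟩
  · rcases sq_eq_one_iff.1 hcsq with h | h <;> simp [h]
  · rw [(h2 x).1]; linear_combination (-leftSol G x) * hcsq
  · linear_combination (-leftSol' G x) * hcsq - c * (h2 x).2

theorem abs_leftSol_le_of_sin_eq_zero {G : ℝ → ℝ} (hG : Confining G)
    (hs : sin (totalAngle G) = 0) {M R : ℝ} (hR : 0 ≤ R)
    (hM : ∀ x ∈ Icc (-R) R, |G x| ≤ M) (h : ∀ x, R ≤ |x| → 1 ≤ G x) (x : ℝ) :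
    |leftSol G x| ≤ exp ((1 + M) * R + R) * exp (-|x|) := by
  rcases le_total x 0 with hx | hx
  · rw [abs_of_nonpos hx, neg_neg]
    exact abs_leftSol_le hG hR hM h hx
  · obtain ⟨c, hc, h1⟩ := leftSol_eq_reflect hG hs
    rw [(h1 x).1, abs_mul, hc, one_mul, abs_of_nonneg hx]
    exact abs_leftSol_le hG.reflect hR (fun x hx => hM (-x) ⟨by linarith [hx.2], by linarith [hx.1]⟩)
      (fun x hx => h (-x) (by simpa using hx)) (by linarith)

theorem expDecay_leftSol {G : ℝ → ℝ} (hG : Confining G) (hs : sin (totalAngle G) = 0) :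
    ExpDecay (leftSol G) := by
  obtain ⟨R, hR, h⟩ := hG.exists_radius
  obtain ⟨M, -, hM⟩ := exists_bound_Icc hG.continuous (-R) R
  exact ⟨exp ((1 + M) * R + R), 0, (exp_pos _).le, fun x => by
    simpa using abs_leftSol_le_of_sin_eq_zero hG hs hR hM h x⟩

theorem expDecay_leftSol' {G : ℝ → ℝ} (hG : Confining G) (hs : sin (totalAngle G) = 0) :
    ExpDecay (leftSol' G) := by
  obtain ⟨C, hC⟩ := exists_abs_leftSol'_le hG
  obtain ⟨D, hD⟩ := exists_abs_leftSol'_le hG.reflect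
  obtain ⟨c, hc, h1⟩ := leftSol_eq_reflect hG hs
  refine ⟨max |C| |D|, 0, le_max_of_le_left (abs_nonneg _), fun x => ?_⟩
  simp only [pow_zero, mul_one]
  rcases le_total x 0 with hx | hx
  · rw [abs_of_nonpos hx, neg_neg]
    refine (hC x hx).trans ?_
    gcongr
    exact (le_abs_self C).trans (le_max_left _ _)
  · rw [(h1 x).2, abs_mul, abs_neg, hc, one_mul, abs_of_nonneg hx]
    refine (hD (-x) (by linarith)).trans ?_
    gcongr
    exact (le_abs_self D).trans (le_max_right _ _)

theorem memLp_two_Iic_of_abs_le_exp {f : ℝ → ℝ} (hf : Continuous f) {C : ℝ}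
    (h : ∀ x ≤ 0, |f x| ≤ C * exp x) :
    MemLp (fun x => (f x : ℂ)) 2 (volume.restrict (Iic 0)) := by
  rw [memLp_two_iff_integrable_sq_norm (by fun_prop)]
  have h1 := (integrableOn_exp_mul_Iic (a := 2) (by norm_num) 0).const_mul (C ^ 2)
  refine h1.mono' (by fun_prop) ?_
  filter_upwards [ae_restrict_mem measurableSet_Iic] with x hx
  have hx := h x hx
  rw [norm_pow, norm_norm, Complex.norm_real, Real.norm_eq_abs]
  calc |f x| ^ 2 ≤ (C * exp x) ^ 2 := by gcongr
    _ = C ^ 2 * exp (2 * x) := by rw [mul_pow, ← exp_nat_mul]; norm_num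

/-- A square integrable solution is a multiple of the left solution. -/
theorem wronskian_eq_zero {G : ℝ → ℝ} (hG : Confining G) {u u' : ℝ → ℂ}
    (hu : ∀ x, HasDerivAt u (u' x) x) (hu' : ∀ x, HasDerivAt u' (G x * u x) x)
    (hL : MemLp u 2) : u 0 * leftSol' G 0 - u' 0 * leftSol G 0 = 0 := by
  have hw : ∀ x, HasDerivAt (fun y => (leftSol G y : ℂ)) (leftSol' G x) x :=
    fun x => (hasDerivAt_leftSol hG x).ofReal_comp
  have hw' : ∀ x, HasDerivAt (fun y => (leftSol' G y : ℂ)) (G x * leftSol G x) x :=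
    fun x => by simpa using (hasDerivAt_leftSol' hG x).ofReal_comp
  have huc : Continuous u := continuous_iff_continuousAt.2 fun x => (hu x).continuousAt
  set W := u 0 * leftSol' G 0 - u' 0 * leftSol G 0 with hWdef
  have hW : ∀ x, u x * leftSol' G x - u' x * leftSol G x = W := by
    have hd : ∀ x, HasDerivAt (fun y => u y * leftSol' G y - u' y * leftSol G y) 0 x := by
      intro x
      refine (((hu x).mul (hw' x)).sub ((hu' x).mul (hw x))).congr_deriv ?_
      ring
    intro x
    exact is_const_of_deriv_eq_zero (fun x => (hd x).differentiableAt) (fun x => (hd x).deriv) x 0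
  obtain ⟨C, hC⟩ := exists_abs_leftSol_le hG
  obtain ⟨D, hD⟩ := exists_abs_leftSol'_le hG
  have hi1 : Integrable (fun x => u x * (leftSol G x : ℂ)) (volume.restrict (Iic 0)) :=
    hL.restrict (Iic 0) |>.integrable_mul
      (memLp_two_Iic_of_abs_le_exp (continuous_leftSol hG) hC)
  have hi2 : Integrable (fun x => u x * (leftSol' G x : ℂ)) (volume.restrict (Iic 0)) :=
    hL.restrict (Iic 0) |>.integrable_mul
      (memLp_two_Iic_of_abs_le_exp (continuous_leftSol' hG) hD)
  by_contra hW0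
  set B := ‖u 0 * leftSol G 0‖ + 2 * ∫ x in Iic 0, ‖u x * (leftSol' G x : ℂ)‖ with hB
  -- With `w = leftSol G`, constancy of the Wronskian gives `(u w)' = 2 u w' - W`. Since `u w'` is
  -- integrable on the half-line, `W ≠ 0` would make `u w` grow linearly, although `u w` is
  -- integrable too. No pointwise decay of `u` is required.
  have hlow : ∀ x ≤ 0, ‖W‖ * |x| - B ≤ ‖u x * (leftSol G x : ℂ)‖ := by
    intro x hx
    have hcont : Continuous fun y => 2 * (u y * (leftSol' G y : ℂ)) - W := by
      have := continuous_leftSol' hG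
      fun_prop
    have hftc := intervalIntegral.integral_eq_sub_of_hasDerivAt
      (f := fun y => u y * (leftSol G y : ℂ)) (f' := fun y => 2 * (u y * (leftSol' G y : ℂ)) - W)
      (a := x) (b := 0) (fun y _ => by
        refine ((hu y).mul (hw y)).congr_deriv ?_
        linear_combination (-1 : ℂ) * hW y) (hcont.intervalIntegrable _ _)
    have hc2 : Continuous fun y => 2 * (u y * (leftSol' G y : ℂ)) := by
      have := continuous_leftSol' hG
      fun_prop
    rw [intervalIntegral.integral_sub (hc2.intervalIntegrable _ _)
      (continuous_const.intervalIntegrable _ _), intervalIntegral.integral_const,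
      intervalIntegral.integral_const_mul] at hftc
    have hb : ‖∫ y in x..0, u y * (leftSol' G y : ℂ)‖
        ≤ ∫ y in Iic 0, ‖u y * (leftSol' G y : ℂ)‖ := by
      rw [intervalIntegral.integral_of_le hx]
      refine (norm_integral_le_integral_norm _).trans ?_
      exact setIntegral_mono_set hi2.norm (Eventually.of_forall fun _ => norm_nonneg _)
        (Eventually.of_forall fun y hy => hy.2)
    have he : ((|x| : ℝ) : ℂ) * W = 2 * (∫ y in x..0, u y * (leftSol' G y : ℂ))
        - u 0 * leftSol G 0 + u x * leftSol G x := by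
      rw [abs_of_nonpos hx]
      simp only [zero_sub, Complex.real_smul] at hftc
      push_cast at hftc ⊢
      linear_combination (-1 : ℂ) * hftc
    have hn : ‖W‖ * |x| = ‖((|x| : ℝ) : ℂ) * W‖ := by
      rw [norm_mul, Complex.norm_real, Real.norm_eq_abs, abs_abs, mul_comm]
    rw [hn, he]
    have t1 := norm_add_le (2 * (∫ y in x..0, u y * (leftSol' G y : ℂ))
        - u 0 * leftSol G 0) (u x * leftSol G x)
    have t2 := norm_sub_le (2 * (∫ y in x..0, u y * (leftSol' G y : ℂ))) (u 0 * leftSol G 0)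
    have t3 : ‖2 * (∫ y in x..0, u y * (leftSol' G y : ℂ))‖
        = 2 * ‖∫ y in x..0, u y * (leftSol' G y : ℂ)‖ := by simp
    rw [hB]; linarith
  have hfin := hi1.measure_norm_ge_lt_top one_pos
  have hWpos : 0 < ‖W‖ := norm_pos_iff.2 hW0
  set X := (1 + |B|) / ‖W‖ with hX
  have hXn : 0 ≤ X := by positivity
  have hsub : Iic (-X) ⊆ {x | 1 ≤ ‖u x * (leftSol G x : ℂ)‖} := by
    intro x hx
    have hx := mem_Iic.1 hx
    have h1 := hlow x (by linarith)
    have h2 : X ≤ |x| := by rw [abs_of_nonpos (by linarith)]; linarith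
    have h3 : ‖W‖ * X = 1 + |B| := by rw [hX]; field_simp
    have h4 : ‖W‖ * X ≤ ‖W‖ * |x| := by gcongr
    have := le_abs_self B
    change 1 ≤ ‖u x * (leftSol G x : ℂ)‖
    linarith
  have htop : (volume.restrict (Iic (0 : ℝ))) (Iic (-X)) = ⊤ := by
    rw [Measure.restrict_apply measurableSet_Iic, inter_eq_left.2 (Iic_subset_Iic.2 (by linarith)),
      volume_Iic]
  exact absurd ((htop.symm.trans_le (measure_mono hsub)).trans_lt hfin) (lt_irrefl _)

/-- A nonzero square integrable solution forces the total angle to be a multiple of `π`. -/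
theorem sin_totalAngle_eq_zero {G : ℝ → ℝ} (hG : Confining G) {u u' : ℝ → ℂ}
    (hu : ∀ x, HasDerivAt u (u' x) x) (hu' : ∀ x, HasDerivAt u' (G x * u x) x)
    (hL : MemLp u 2) (hne : u ≠ 0) : sin (totalAngle G) = 0 := by
  have h1 := wronskian_eq_zero hG hu hu' hL
  -- The same argument at `+∞`: `u` is proportional to both decaying solutions, so these have zero
  -- Wronskian, and that Wronskian is the sine of the total angle.
  have h2 := wronskian_eq_zero hG.reflect (u := fun x => u (-x)) (u' := fun x => -u' (-x))
    (fun x => ((hu (-x)).scomp x (hasDerivAt_neg x)).congr_deriv (by simp))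
    (fun x => ((hu' (-x)).scomp x (hasDerivAt_neg x)).neg.congr_deriv (by simp [reflect]))
    (hL.comp_measurePreserving (Measure.measurePreserving_neg _))
  have h3 := exists_eq_mul_leftSol hG hu hu' h1
  set c := u 0 * leftSol G 0 + u' 0 * leftSol' G 0 with hc
  have hc0 : c ≠ 0 := by
    intro h0
    exact hne (funext fun x => by simpa [h0] using (h3 x).1)
  simp only [neg_zero] at h2
  rw [(h3 0).1, (h3 0).2] at h2
  have h4 : c * ((sin (totalAngle G) : ℝ) : ℂ) = 0 := by
    rw [← sin_totalAngle]; push_cast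
    linear_combination h2
  exact_mod_cast (mul_eq_zero.1 h4).resolve_left hc0

end SturmLiouville

/-! ### The harmonic oscillator, existence of eigenvalues, and their numbering. -/

namespace SturmLiouville
open Real Set

theorem ExpDecay.memLp_two {f : ℝ → ℝ} (hf : ExpDecay f) (hc : Continuous f) :
    MemLp (fun x => (f x : ℂ)) 2 := by
  rw [memLp_two_iff_integrable_sq_norm (by fun_prop)]
  have := (hf.mul hf).integrable (hc.mul hc)
  simpa [Complex.norm_real, ← sq] using this

theorem sin_totalAngle_eq_zero_of_expDecay {G : ℝ → ℝ} (hG : Confining G) {u u' : ℝ → ℝ}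
    (hu : ∀ x, HasDerivAt u (u' x) x) (hu' : ∀ x, HasDerivAt u' (G x * u x) x)
    (hd : ExpDecay u) (hne : u ≠ 0) : sin (totalAngle G) = 0 := by
  have hc : Continuous u := continuous_iff_continuousAt.2 fun x => (hu x).continuousAt
  refine sin_totalAngle_eq_zero hG (u := fun x => (u x : ℂ)) (u' := fun x => (u' x : ℂ))
    (fun x => (hu x).ofReal_comp) (fun x => by simpa using (hu' x).ofReal_comp)
    (hd.memLp_two hc) fun h => hne (funext fun x => ?_)
  simpa using congrFun h x

theorem totalAngle_le_of_one_le {G : ℝ → ℝ} (hG : Continuous G) (h : ∀ x, 1 ≤ G x) :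
    totalAngle G ≤ π / 2 := by
  have hc : Confining G := Confining.of_forall (R := 0) hG fun x _ => h x
  have h1 := (hc.isLeftAngle.mem_Icc hG (fun x _ => h x) (le_refl (0 : ℝ))).2
  have h2 := (hc.reflect.isLeftAngle.mem_Icc hc.reflect.continuous (fun x _ => h (-x))
    (le_refl (0 : ℝ))).2
  rw [totalAngle]; linarith

/-- Joint continuity gives convergence on bounded intervals. -/
theorem tendstoLocUnif_of_continuousAt {ι X : Type*} [TopologicalSpace X] {l : Filter ι}
    {F : X → ℝ → ℝ} {φ : ι → X} {a : X} (hφ : Tendsto φ l (𝓝 a))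
    (hF : ∀ x, ContinuousAt (fun z : X × ℝ => F z.1 z.2) (a, x)) :
    TendstoLocUnif (fun i => F (φ i)) l (F a) := by
  intro b ε hε
  apply hφ.eventually
    (p := fun y => ∀ x ∈ Icc (-b) b, |F y x - F a x| ≤ ε)
  refine isCompact_Icc.eventually_forall_of_forall_eventually
    (P := fun y x => |F y x - F a x| ≤ ε) fun x _ => ?_
  have h1 : ContinuousAt (fun z : X × ℝ => F z.1 z.2 - F a z.2) (a, x) := by
    refine (hF x).sub ?_
    have : ContinuousAt (fun z : X × ℝ => F a z.2) (a, x) :=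
      ContinuousAt.comp (f := fun z : X × ℝ => (a, z.2)) (g := fun z : X × ℝ => F z.1 z.2)
        (hF x) (by fun_prop)
    exact this
  have h2 := h1.tendsto
  simp only [sub_self] at h2
  filter_upwards [Metric.tendsto_nhds.1 h2 ε hε] with z hz
  simpa using hz.le

/-- The coefficient `G` for which `p D² u + q u = μ u` reads `u'' = G u`. -/
noncomputable def coeff (p q : ℝ → ℝ) (μ x : ℝ) : ℝ := (q x - μ) / p x

/-- Operators `p D² + q` all of whose eigenvalue equations are confining. -/
structure ConfiningPair (p q : ℝ → ℝ) : Prop where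
  continuous_p : Continuous p
  continuous_q : Continuous q
  pos : ∀ x, 0 < p x
  confining : ∀ μ, Confining (coeff p q μ)

namespace ConfiningPair
variable {p q : ℝ → ℝ}

theorem strictMono_totalAngle (h : ConfiningPair p q) :
    StrictMono fun μ => totalAngle (coeff p q μ) := fun μ ν hμν =>
  totalAngle_anti (h.confining ν) (h.confining μ) fun x => by
    have := h.pos x
    unfold coeff
    gcongr

theorem continuous_totalAngle (h : ConfiningPair p q) :
    Continuous fun μ => totalAngle (coeff p q μ) := by
  rw [continuous_iff_continuousAt]
  intro μ
  obtain ⟨R, -, hR⟩ := (h.confining (μ + 1)).exists_radius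
  have hmono : ∀ ν ≤ μ + 1, ∀ x, R ≤ |x| → 1 ≤ coeff p q ν x := fun ν hν x hx => by
    refine (hR x hx).trans ?_
    have := h.pos x
    unfold coeff
    gcongr
  have hct : ConfinedTendsto (coeff p q) (𝓝 μ) (coeff p q μ) R := by
    constructor
    · exact Eventually.of_forall fun ν => (h.confining ν).continuous
    · exact (h.confining μ).continuous
    · refine tendstoLocUnif_of_continuousAt (φ := id) tendsto_id fun x => ?_
      have := h.continuous_p; have := h.continuous_q
      unfold coeff
      exact ContinuousAt.div (by fun_prop) (by fun_prop) (h.pos x).ne'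
    · filter_upwards [Iic_mem_nhds (show μ < μ + 1 by linarith)] with ν hν using hmono ν hν
    · exact hmono μ (by linarith)
  exact hct.totalAngle

theorem exists_totalAngle_le (h : ConfiningPair p q) :
    ∃ μ, totalAngle (coeff p q μ) ≤ π / 2 := by
  obtain ⟨R, hR0, hR⟩ := (h.confining 0).exists_radius
  obtain ⟨M, hM0, hM⟩ := exists_bound_Icc (h.continuous_q.sub h.continuous_p) (-R) R
  refine ⟨-M, totalAngle_le_of_one_le (h.confining _).continuous fun x => ?_⟩
  have hp := h.pos x
  rw [coeff, le_div_iff₀ hp]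
  rcases le_total R |x| with hx | hx
  · have := hR x hx
    rw [coeff, le_div_iff₀ hp] at this
    linarith
  · have := (abs_le.1 (hM x (abs_le.1 hx))).1
    rw [Pi.sub_apply] at this
    linarith

end ConfiningPair

/-- The coefficient of the harmonic oscillator. -/
def osc (μ z : ℝ) : ℝ := z ^ 2 - μ

theorem coeff_osc (μ : ℝ) : coeff (fun _ => 1) (fun z => z ^ 2) μ = osc μ := by
  funext z; simp [coeff, osc]

theorem one_le_osc {μ z : ℝ} (h : 1 + |μ| ≤ |z|) : 1 ≤ osc μ z := by
  have h1 := le_abs_self μ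
  have h2 := abs_nonneg μ
  rw [osc, ← sq_abs]
  nlinarith

theorem confining_osc (μ : ℝ) : Confining (osc μ) :=
  Confining.of_forall (by unfold osc; fun_prop) fun _ h => one_le_osc h

theorem confiningPair_osc : ConfiningPair (fun _ => 1) fun z => z ^ 2 where
  continuous_p := by fun_prop
  continuous_q := by fun_prop
  pos := fun _ => one_pos
  confining := fun μ => by rw [coeff_osc]; exact confining_osc μ

theorem strictMono_totalAngle_osc : StrictMono fun μ => totalAngle (osc μ) := by
  simpa only [coeff_osc] using confiningPair_osc.strictMono_totalAngle

theorem continuous_totalAngle_osc : Continuous fun μ => totalAngle (osc μ) := by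
  simpa only [coeff_osc] using confiningPair_osc.continuous_totalAngle

theorem totalAngle_osc_le {μ : ℝ} (h : μ ≤ -1) : totalAngle (osc μ) ≤ π / 2 :=
  totalAngle_le_of_one_le (confining_osc μ).continuous fun x => by
    rw [osc]; nlinarith [sq_nonneg x]

theorem leftSol_ne_zero (G : ℝ → ℝ) (hG : Confining G) : leftSol G ≠ 0 := by
  intro h
  have h1 : leftSol' G = 0 := by
    funext x
    have := hasDerivAt_leftSol hG x
    rw [h] at this
    exact this.unique (hasDerivAt_const x 0)
  have := leftSol_sq_add_sq G 0
  rw [h, h1, amplitude_zero] at this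
  simp at this

/-- The annihilation operator lowers eigenvalues of the harmonic oscillator. -/
theorem sin_totalAngle_osc_sub_two {μ : ℝ} (h : sin (totalAngle (osc μ)) = 0) (hμ : μ ≠ 1) :
    sin (totalAngle (osc (μ - 2))) = 0 := by
  have hG := confining_osc μ
  have hu := hasDerivAt_leftSol hG
  have hu' := hasDerivAt_leftSol' hG
  -- For `w = u' + z u` one has `w' = z w + (1 - μ) u`. Differentiating again shows that `w` solves
  -- the equation with `μ - 2`; and `w = 0` would give `u = 0` unless `μ = 1`.
  have hw : ∀ z, HasDerivAt (fun z => leftSol' (osc μ) z + z * leftSol (osc μ) z)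
      (z * (leftSol' (osc μ) z + z * leftSol (osc μ) z) + (1 - μ) * leftSol (osc μ) z) z :=
    fun z => by
      refine ((hu' z).add ((hasDerivAt_id z).mul (hu z))).congr_deriv ?_
      simp only [osc, id]; ring
  refine sin_totalAngle_eq_zero_of_expDecay (confining_osc _) hw (fun z => ?_)
    ((expDecay_leftSol' hG h).add (polyBdd_id.mul_expDecay (expDecay_leftSol hG h))) fun h0 => ?_
  · refine (((hasDerivAt_id z).mul (hw z)).add ((hu z).const_mul (1 - μ))).congr_deriv ?_
    simp only [osc, id]; ring
  · refine leftSol_ne_zero _ hG (funext fun z => ?_)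
    have h1 := hw z
    rw [h0] at h1
    have h2 := h1.unique (hasDerivAt_const z (0 : ℝ))
    have h3 := congrFun h0 z
    simp only [Pi.zero_apply] at h3
    rw [h3, mul_zero, zero_add] at h2
    exact (mul_eq_zero.1 h2).resolve_left (sub_ne_zero.2 hμ.symm)

theorem sin_totalAngle_osc_add_two {μ : ℝ} (h : sin (totalAngle (osc μ)) = 0) (hμ : μ ≠ -1) :
    sin (totalAngle (osc (μ + 2))) = 0 := by
  have hG := confining_osc μ
  have hu := hasDerivAt_leftSol hG
  have hu' := hasDerivAt_leftSol' hG
  have hw : ∀ z, HasDerivAt (fun z => leftSol' (osc μ) z - z * leftSol (osc μ) z)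
      (-(z * (leftSol' (osc μ) z - z * leftSol (osc μ) z)) - (μ + 1) * leftSol (osc μ) z) z :=
    fun z => by
      refine ((hu' z).sub ((hasDerivAt_id z).mul (hu z))).congr_deriv ?_
      simp only [osc, id]; ring
  refine sin_totalAngle_eq_zero_of_expDecay (confining_osc _) hw (fun z => ?_)
    ((expDecay_leftSol' hG h).sub (polyBdd_id.mul_expDecay (expDecay_leftSol hG h))) fun h0 => ?_
  · refine (((hasDerivAt_id z).mul (hw z)).neg.sub ((hu z).const_mul (μ + 1))).congr_deriv ?_
    simp only [osc, id]; ring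
  · refine leftSol_ne_zero _ hG (funext fun z => ?_)
    have h1 := hw z
    rw [h0] at h1
    have h2 := h1.unique (hasDerivAt_const z (0 : ℝ))
    have h3 := congrFun h0 z
    simp only [Pi.zero_apply] at h3
    rw [h3, mul_zero, neg_zero, zero_sub, neg_eq_zero] at h2
    exact (mul_eq_zero.1 h2).resolve_left fun h => hμ (by linarith)

theorem sin_totalAngle_osc_one : sin (totalAngle (osc 1)) = 0 := by
  have hd : ∀ z : ℝ, HasDerivAt (fun z => exp (-z ^ 2 / 2)) (-(z * exp (-z ^ 2 / 2))) z := by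
    intro z
    refine (((hasDerivAt_pow 2 z).neg.div_const 2).exp).congr_deriv ?_
    simp; ring
  refine sin_totalAngle_eq_zero_of_expDecay (confining_osc _) hd (fun z => ?_)
    ⟨exp (1 / 2), 0, (exp_pos _).le, fun z => ?_⟩ fun h => ?_
  · refine (((hasDerivAt_id z).mul (hd z)).neg).congr_deriv ?_
    simp only [osc, id]; ring
  · rw [abs_of_pos (exp_pos _), pow_zero, mul_one, ← exp_add, exp_le_exp]
    nlinarith [sq_nonneg (|z| - 1), sq_abs z]
  · have := congrFun h 0
    simp at this

/-- Lowering by `2` repeatedly either meets `1` or ends below `-1`, where the total angle lies in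
`(0, π/2]` and has nonzero sine. -/
theorem eq_odd_of_sin_totalAngle_osc {μ : ℝ} (h : sin (totalAngle (osc μ)) = 0) :
    ∃ k : ℕ, μ = 2 * k + 1 := by
  have key : ∀ n : ℕ, ∀ μ : ℝ, μ < 2 * n - 1 → sin (totalAngle (osc μ)) = 0 →
      ∃ k : ℕ, μ = 2 * k + 1 := by
    intro n
    induction n with
    | zero =>
      intro μ hμ hs
      have h1 := totalAngle_osc_le (μ := μ) (by simpa using hμ.le)
      have h2 := totalAngle_pos (confining_osc μ)
      exact absurd hs (sin_pos_of_pos_of_lt_pi h2 (by linarith [pi_pos])).ne'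
    | succ n ih =>
      intro μ hμ hs
      by_cases h1 : μ = 1
      · exact ⟨0, by simp [h1]⟩
      · push_cast at hμ
        obtain ⟨k, hk⟩ := ih (μ - 2) (by linarith) (sin_totalAngle_osc_sub_two hs h1)
        exact ⟨k + 1, by push_cast; linarith⟩
  obtain ⟨n, hn⟩ := exists_nat_gt μ
  exact key (n + 1) μ (by push_cast; have : (0 : ℝ) ≤ n := n.cast_nonneg; linarith) h

theorem sin_totalAngle_osc_odd (k : ℕ) : sin (totalAngle (osc (2 * k + 1))) = 0 := by
  induction k with
  | zero => simpa using sin_totalAngle_osc_one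
  | succ k ih =>
    have h := sin_totalAngle_osc_add_two ih (by
      have : (0 : ℝ) ≤ k := k.cast_nonneg
      linarith)
    convert h using 3
    push_cast; ring_nf

/-- The `k`-th eigenvalue of the harmonic oscillator is `2 k + 1`. -/
theorem totalAngle_osc_odd (k : ℕ) : totalAngle (osc (2 * k + 1)) = (k + 1) * π := by
  -- The total angle is a multiple of `π` at odd positive numbers only. By continuity and strict
  -- monotonicity it therefore advances by exactly one multiple between consecutive odd numbers.
  have step : ∀ k : ℕ, k * π ≤ totalAngle (osc (2 * k - 1)) →
      totalAngle (osc (2 * k - 1)) < (k + 1) * π → totalAngle (osc (2 * k + 1)) = (k + 1) * π := by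
    intro k h1 h2
    obtain ⟨j, hj⟩ := sin_eq_zero_iff.1 (sin_totalAngle_osc_odd k)
    have hlt : totalAngle (osc (2 * k - 1)) < totalAngle (osc (2 * k + 1)) :=
      strictMono_totalAngle_osc (by linarith)
    have hjk : (k : ℤ) < j := by
      have h3 : (k : ℝ) * π < j * π := by linarith
      exact_mod_cast lt_of_mul_lt_mul_right h3 pi_pos.le
    have hge : (k + 1) * π ≤ totalAngle (osc (2 * k + 1)) := by
      rw [← hj]
      have : (k : ℝ) + 1 ≤ j := by exact_mod_cast hjk
      gcongr
    obtain ⟨μ, hμ, he⟩ := intermediate_value_Icc (show (2 * k - 1 : ℝ) ≤ 2 * k + 1 by linarith)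
      continuous_totalAngle_osc.continuousOn ⟨h2.le, hge⟩
    simp only at he
    obtain ⟨i, hi⟩ := eq_odd_of_sin_totalAngle_osc (μ := μ) (by
      rw [he]; exact_mod_cast sin_nat_mul_pi (k + 1))
    have hμ1 : 2 * (k : ℝ) - 1 < μ := hμ.1.lt_of_ne fun h => by rw [← h] at he; linarith
    have hik : i = k := by
      rw [hi] at hμ1 hμ
      have e1 : (k : ℝ) < i + 1 := by linarith
      have e2 : (i : ℝ) ≤ k := by linarith [hμ.2]
      have e1' : k < i + 1 := by exact_mod_cast e1
      have e2' : i ≤ k := by exact_mod_cast e2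
      omega
    rw [← he, hi, hik]
  induction k with
  | zero =>
    refine step 0 ?_ ?_
    · simpa using (totalAngle_pos (confining_osc _)).le
    · refine (totalAngle_osc_le (by simp)).trans_lt ?_
      rw [Nat.cast_zero, zero_add, one_mul]
      linarith [pi_pos]
  | succ k ih =>
    have h : (2 * ((k + 1 : ℕ) : ℝ) - 1) = 2 * k + 1 := by push_cast; ring
    refine step (k + 1) ?_ ?_
    · rw [h, ih]; push_cast; rfl
    · rw [h, ih]; push_cast; nlinarith [pi_pos]

/-- Coefficients compared only on `[a, 0]` still compare angles up to `π`: a shift by `π` is again a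
Prüfer angle and starts above `π/4` at `a`. -/
theorem leftAngle_le_add_pi {G₁ G₂ : ℝ → ℝ} (h₁ : Confining G₁) (h₂ : Confining G₂) {a : ℝ}
    (ha : a ≤ 0) (hG₂ : ∀ x ≤ a, 1 ≤ G₂ x) (hle : ∀ x ∈ Icc a 0, G₁ x ≤ G₂ x) :
    leftAngle G₂ 0 ≤ leftAngle G₁ 0 + π := by
  have hs : IsPrufer G₁ fun x => leftAngle G₁ x + π := fun x => by
    simpa using (h₁.isLeftAngle.1 x).add_const π
  refine hs.le_of_le h₁.continuous h₂.isLeftAngle.1 ha hle ?_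
  have e1 := (h₂.isLeftAngle.mem_Icc h₂.continuous hG₂ le_rfl).2
  have e2 := h₁.isLeftAngle.nonneg h₁.continuous a
  linarith [pi_pos]

namespace ConfiningPair
variable {p q : ℝ → ℝ}

theorem exists_le_totalAngle (h : ConfiningPair p q) (n : ℕ) :
    ∃ μ, n * π ≤ totalAngle (coeff p q μ) := by
  -- At this oscillator eigenvalue the total angle is `(n + 2) π`. The comparison on a bounded
  -- interval loses one `π` at each end.
  set ν : ℝ := 2 * ((n + 1 : ℕ) : ℝ) + 1 with hν
  set R := 1 + |ν| with hR
  have hc : Continuous fun x => q x - p x * osc ν x := by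
    have := h.continuous_p; have := h.continuous_q; have := (confining_osc ν).continuous
    fun_prop
  obtain ⟨M, hM0, hM⟩ := exists_bound_Icc hc (-R) R
  have hle : ∀ x ∈ Icc (-R) R, coeff p q M x ≤ osc ν x := by
    intro x hx
    rw [coeff, div_le_iff₀ (h.pos x)]
    have := (abs_le.1 (hM x hx)).2
    linarith
  have hRn : 0 ≤ R := by positivity
  have hl : ∀ x ≤ -R, 1 ≤ osc ν x := fun x hx =>
    one_le_osc (le_trans (by linarith) (neg_le_abs x))
  refine ⟨M, ?_⟩
  have h1 := leftAngle_le_add_pi (h.confining M) (confining_osc ν) (a := -R) (by linarith) hl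
    fun x hx => hle x ⟨hx.1, hx.2.trans hRn⟩
  have h2 := leftAngle_le_add_pi (h.confining M).reflect (confining_osc ν).reflect (a := -R)
    (by linarith) (fun x hx => by
      have := hl x hx
      simpa [reflect, osc] using this)
    fun x hx => hle (-x) ⟨by linarith [hx.2], by linarith [hx.1]⟩
  have h3 := totalAngle_osc_odd (n + 1)
  rw [← hν, totalAngle] at h3
  rw [totalAngle]
  push_cast at h3
  linarith

theorem exists_totalAngle_eq (h : ConfiningPair p q) (n : ℕ) :
    ∃ μ, totalAngle (coeff p q μ) = (n + 1) * π := by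
  obtain ⟨a, ha⟩ := h.exists_totalAngle_le
  obtain ⟨b, hb⟩ := h.exists_le_totalAngle (n + 1)
  push_cast at hb
  have hn : (0 : ℝ) ≤ n := n.cast_nonneg
  have hpi := pi_pos
  have ha' : totalAngle (coeff p q a) ≤ (n + 1) * π := by nlinarith
  have hab : a ≤ b := h.strictMono_totalAngle.le_iff_le.1 (ha'.trans hb)
  obtain ⟨μ, -, hμ⟩ := intermediate_value_Icc hab h.continuous_totalAngle.continuousOn ⟨ha', hb⟩
  exact ⟨μ, hμ⟩

end ConfiningPair

theorem hasDerivAt_of_contDiff_two {u : ℝ → ℂ} (h : ContDiff ℝ 2 u) (x : ℝ) :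
    HasDerivAt u (deriv u x) x ∧ HasDerivAt (deriv u) (deriv (deriv u) x) x := by
  have h' : ContDiff ℝ (1 + 1) u := by simpa [one_add_one_eq_two] using h
  exact ⟨(h.differentiable (by norm_num) x).hasDerivAt,
    ((contDiff_succ_iff_deriv.1 h').2.2.differentiable (by norm_num) x).hasDerivAt⟩

theorem contDiff_two_of_hasDerivAt {u u' u'' : ℝ → ℂ} (h : ∀ x, HasDerivAt u (u' x) x)
    (h' : ∀ x, HasDerivAt u' (u'' x) x) (hc : Continuous u'') : ContDiff ℝ 2 u := by
  have e1 : deriv u = u' := funext fun x => (h x).deriv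
  have e2 : deriv u' = u'' := funext fun x => (h' x).deriv
  rw [← one_add_one_eq_two, contDiff_succ_iff_deriv]
  refine ⟨fun x => (h x).differentiableAt, by simp, ?_⟩
  rw [e1, contDiff_one_iff_deriv, e2]
  exact ⟨fun x => (h' x).differentiableAt, hc⟩

namespace ConfiningPair
variable {p q : ℝ → ℝ}

theorem hasDerivAt_deriv (h : ConfiningPair p q) {μ : ℝ} {u : ℝ → ℂ}
    (hu : u ∈ opEigenspace p q μ) (x : ℝ) :
    HasDerivAt (deriv u) (coeff p q μ x * u x) x := by
  have h1 := (hasDerivAt_of_contDiff_two hu.1 x).2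
  have h2 := hu.2.2 x
  have hp : (p x : ℂ) ≠ 0 := by exact_mod_cast (h.pos x).ne'
  convert h1 using 1
  rw [opApply] at h2
  rw [coeff]; push_cast
  field_simp
  linear_combination h2

theorem opEigenspace_eq_bot (h : ConfiningPair p q) {μ : ℝ}
    (hs : sin (totalAngle (coeff p q μ)) ≠ 0) : opEigenspace p q μ = ⊥ := by
  rw [eq_bot_iff]
  intro u hu
  by_contra h0
  exact hs (sin_totalAngle_eq_zero (h.confining μ)
    (fun x => (hasDerivAt_of_contDiff_two hu.1 x).1) (h.hasDerivAt_deriv hu) hu.2.1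
    fun h1 => h0 (by simpa using h1))

theorem opEigenspace_le_span (h : ConfiningPair p q) (μ : ℝ) :
    opEigenspace p q μ ≤ Submodule.span ℂ {fun x => (leftSol (coeff p q μ) x : ℂ)} := by
  intro u hu
  have hd := fun x => (hasDerivAt_of_contDiff_two hu.1 x).1
  have h1 := exists_eq_mul_leftSol (h.confining μ) hd (h.hasDerivAt_deriv hu)
    (wronskian_eq_zero (h.confining μ) hd (h.hasDerivAt_deriv hu) hu.2.1)
  rw [Submodule.mem_span_singleton]
  exact ⟨_, funext fun x => ((h1 x).1).symm⟩

theorem leftSol_mem_opEigenspace (h : ConfiningPair p q) {μ : ℝ}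
    (hs : sin (totalAngle (coeff p q μ)) = 0) :
    (fun x => (leftSol (coeff p q μ) x : ℂ)) ∈ opEigenspace p q μ := by
  have hG := h.confining μ
  have d1 : ∀ x, HasDerivAt (fun x => (leftSol (coeff p q μ) x : ℂ))
      (leftSol' (coeff p q μ) x : ℂ) x := fun x => (hasDerivAt_leftSol hG x).ofReal_comp
  have d2 : ∀ x, HasDerivAt (fun x => (leftSol' (coeff p q μ) x : ℂ))
      ((coeff p q μ x * leftSol (coeff p q μ) x : ℝ) : ℂ) x :=
    fun x => (hasDerivAt_leftSol' hG x).ofReal_comp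
  refine ⟨contDiff_two_of_hasDerivAt d1 d2 ?_,
    (expDecay_leftSol hG hs).memLp_two (continuous_leftSol hG), fun x => ?_⟩
  · have := continuous_leftSol hG; have := hG.continuous
    fun_prop
  · have e1 : deriv (fun x => (leftSol (coeff p q μ) x : ℂ))
        = fun x => (leftSol' (coeff p q μ) x : ℂ) := funext fun x => (d1 x).deriv
    rw [opApply, e1, (d2 x).deriv, coeff]
    have hp : (p x : ℂ) ≠ 0 := by exact_mod_cast (h.pos x).ne'
    push_cast
    field_simp
    ring

end ConfiningPair

/-- The differential operator extends to an endomorphism of the space of all functions. -/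
theorem exists_end_eq_opApply (p q : ℝ → ℝ) :
    ∃ T : Module.End ℂ (ℝ → ℂ), ∀ u, ContDiff ℝ 2 u → T u = opApply p q u := by
  let S : Submodule ℂ (ℝ → ℂ) :=
    { carrier := {u | ContDiff ℝ 2 u}
      zero_mem' := (contDiff_const : ContDiff ℝ 2 fun _ : ℝ => (0 : ℂ))
      add_mem' := fun {u v} (hu : ContDiff ℝ 2 u) (hv : ContDiff ℝ 2 v) => hu.add hv
      smul_mem' := fun c u (hu : ContDiff ℝ 2 u) => contDiff_const.smul hu }
  have hd1 : ∀ u ∈ S, ∀ v ∈ S, deriv (u + v) = deriv u + deriv v := fun u hu v hv =>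
    funext fun x => ((hasDerivAt_of_contDiff_two hu x).1.add
      (hasDerivAt_of_contDiff_two hv x).1).deriv
  let f : S →ₗ[ℂ] (ℝ → ℂ) :=
    { toFun := fun u => opApply p q u
      map_add' := fun u v => by
        funext x
        have h2 := ((hasDerivAt_of_contDiff_two u.2 x).2.add
          (hasDerivAt_of_contDiff_two v.2 x).2).deriv
        simp only [opApply, Submodule.coe_add, hd1 u u.2 v v.2, h2, Pi.add_apply]
        ring
      map_smul' := fun c u => by
        funext x
        have h1 : deriv (c • (u : ℝ → ℂ)) = c • deriv (u : ℝ → ℂ) := by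
          funext y; exact deriv_const_smul_field c _
        have h2 : deriv (c • deriv (u : ℝ → ℂ)) x = c • deriv (deriv (u : ℝ → ℂ)) x :=
          deriv_const_smul_field c _
        simp only [opApply, Submodule.coe_smul, h1, h2, Pi.smul_apply, smul_eq_mul,
          RingHom.id_apply]
        ring }
  obtain ⟨T, hT⟩ := LinearMap.exists_extend f
  exact ⟨T, fun u hu => LinearMap.congr_fun hT ⟨u, hu⟩⟩

open Classical in
theorem ConfiningPair.isNthEigenvalue {p q : ℝ → ℝ} (h : ConfiningPair p q) {n : ℕ} {lam : ℝ}
    (hl : totalAngle (coeff p q lam) = (n + 1) * π) : IsNthEigenvalue p q n lam := by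
  choose e he using h.exists_totalAngle_eq
  have hpi := pi_pos
  have hen : e n = lam := h.strictMono_totalAngle.injective ((he n).trans hl.symm)
  have hmono : StrictMono e := fun i j hij => by
    apply h.strictMono_totalAngle.lt_iff_lt.1
    simp only [he]
    have : (i : ℝ) < j := by exact_mod_cast hij
    gcongr
  have hs : ∀ k, sin (totalAngle (coeff p q (e k))) = 0 := fun k => by
    rw [he]; exact_mod_cast sin_nat_mul_pi (k + 1)
  set φ : ℕ → ℝ → ℂ := fun k x => (leftSol (coeff p q (e k)) x : ℂ) with hφ
  have hmem : ∀ k, φ k ∈ opEigenspace p q (e k) := fun k => h.leftSol_mem_opEigenspace (hs k)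
  have hφ0 : ∀ k, φ k ≠ 0 := fun k h0 =>
    leftSol_ne_zero _ (h.confining (e k)) (funext fun x => by simpa [hφ] using congrFun h0 x)
  obtain ⟨T, hT⟩ := exists_end_eq_opApply p q
  -- The `φ k` are eigenvectors, for distinct eigenvalues, of the single endomorphism `T`.
  have hind : LinearIndependent ℂ φ := by
    refine T.eigenvectors_linearIndependent' (fun k => (e k : ℂ))
      (Complex.ofReal_injective.comp hmono.injective) φ fun k => ?_
    refine Module.End.hasEigenvector_iff.2 ⟨Module.End.mem_eigenspace_iff.2 ?_, hφ0 k⟩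
    rw [hT _ (hmem k).1]
    exact funext fun x => (hmem k).2.2 x
  constructor
  · change (n : Cardinal) < _
    have hind' : LinearIndependent ℂ
        (fun k : Fin (n + 1) => (⟨φ k, (le_iSup₂ (f := fun τ (_ : τ ∈ Iic lam) =>
          opEigenspace p q τ) (e k) (by
            rw [mem_Iic, ← hen]
            exact hmono.monotone (Nat.lt_succ_iff.1 k.2))) (hmem k)⟩ :
          ↥(⨆ τ ∈ Iic lam, opEigenspace p q τ))) := by
      apply LinearIndependent.of_comp (Submodule.subtype _)
      exact hind.comp (fun k : Fin (n + 1) => (k : ℕ)) Fin.val_injective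
    have := hind'.cardinal_le_rank
    rw [Cardinal.mk_fin] at this
    exact lt_of_lt_of_le (by exact_mod_cast Nat.lt_succ_self n) this
  · intro μ hμ
    by_contra! hlt
    refine absurd (show (n : Cardinal) < _ from hμ) (not_lt.2 ?_)
    -- Below `lam` the total angle is under `(n + 1) π`, so only `e 0, …, e (n - 1)` have nontrivial
    -- eigenspaces, and each of these is a line.
    have hle : (⨆ τ ∈ Iic μ, opEigenspace p q τ)
        ≤ Submodule.span ℂ (((Finset.range n).image φ : Finset (ℝ → ℂ)) : Set (ℝ → ℂ)) := by
      refine iSup₂_le fun τ hτ => ?_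
      by_cases h0 : sin (totalAngle (coeff p q τ)) = 0
      · obtain ⟨j, hj⟩ := sin_eq_zero_iff.1 h0
        have hj0 : 0 < j := by
          have : (0 : ℝ) < j * π := by rw [hj]; exact totalAngle_pos (h.confining τ)
          exact_mod_cast pos_of_mul_pos_left this hpi.le
        have hjn : j < n + 1 := by
          have h1 : totalAngle (coeff p q τ) < totalAngle (coeff p q lam) :=
            h.strictMono_totalAngle (lt_of_le_of_lt hτ hlt)
          rw [hl, ← hj] at h1
          exact_mod_cast lt_of_mul_lt_mul_right h1 hpi.le
        obtain ⟨k, hk⟩ : ∃ k : ℕ, j = k + 1 := ⟨(j - 1).toNat, by omega⟩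
        have hτk : τ = e k := by
          apply h.strictMono_totalAngle.injective
          simp only [he, ← hj, hk]; push_cast; ring
        rw [hτk]
        refine (h.opEigenspace_le_span _).trans (Submodule.span_mono ?_)
        rw [singleton_subset_iff]
        simp only [Finset.coe_image, Finset.coe_range]
        exact ⟨k, by rw [mem_Iio]; omega, rfl⟩
      · rw [h.opEigenspace_eq_bot h0]; exact bot_le
    refine (Submodule.rank_mono hle).trans ((rank_span_finset_le _).trans ?_)
    exact_mod_cast Finset.card_image_le.trans (Finset.card_range n).le

theorem IsNthEigenvalue.unique {p q : ℝ → ℝ} {n : ℕ} {a b : ℝ} (ha : IsNthEigenvalue p q n a)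
    (hb : IsNthEigenvalue p q n b) : a = b := IsLeast.unique ha hb

end SturmLiouville

/-! ### Orthogonality of eigenfunctions and stability of eigenvalues. -/

namespace SturmLiouville
open Real Set

theorem PolyBdd.div_const {f : ℝ → ℝ} (hf : PolyBdd f) (c : ℝ) : PolyBdd fun x => f x / c := by
  simpa [div_eq_mul_inv] using hf.mul (polyBdd_const c⁻¹)

/-- Two eigenfunctions are orthogonal with respect to the difference of their coefficients. -/
theorem integral_coeff_sub_mul_eq_zero {G₁ G₂ : ℝ → ℝ} (h₁ : Confining G₁) (h₂ : Confining G₂)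
    (hs₁ : sin (totalAngle G₁) = 0) (hs₂ : sin (totalAngle G₂) = 0)
    (hb₁ : PolyBdd G₁) (hb₂ : PolyBdd G₂) :
    ∫ x, (G₂ x - G₁ x) * (leftSol G₁ x * leftSol G₂ x) = 0 := by
  have c1 := continuous_leftSol h₁
  have c2 := continuous_leftSol h₂
  have c1' := continuous_leftSol' h₁
  have c2' := continuous_leftSol' h₂
  have d1 := expDecay_leftSol h₁ hs₁
  have d2 := expDecay_leftSol h₂ hs₂
  have d1' := expDecay_leftSol' h₁ hs₁
  have d2' := expDecay_leftSol' h₂ hs₂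
  have g1 := h₁.continuous
  have g2 := h₂.continuous
  refine integral_eq_zero_of_hasDerivAt_of_integrable
    (f := fun x => leftSol G₁ x * leftSol' G₂ x - leftSol' G₁ x * leftSol G₂ x) (fun x => ?_)
    (((hb₂.sub hb₁).mul_expDecay (d1.mul d2)).integrable (by fun_prop))
    (((d1.mul d2').sub (d1'.mul d2)).integrable (by fun_prop))
  refine (((hasDerivAt_leftSol h₁ x).mul (hasDerivAt_leftSol' h₂ x)).sub
    ((hasDerivAt_leftSol' h₁ x).mul (hasDerivAt_leftSol h₂ x))).congr_deriv ?_
  ring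

/-- Eigenvalues of a given total angle depend continuously on the operator. -/
theorem tendsto_eigenvalue {ι : Type*} {l : Filter ι} {p q : ι → ℝ → ℝ} {p₀ q₀ : ℝ → ℝ}
    {Λ : ι → ℝ} {lam₀ t : ℝ} (h : ∀ᶠ i in l, ConfiningPair (p i) (q i))
    (h₀ : ConfiningPair p₀ q₀) (hΛ : ∀ᶠ i in l, totalAngle (coeff (p i) (q i) (Λ i)) = t)
    (hlam : totalAngle (coeff p₀ q₀ lam₀) = t)
    (hc : ∀ᶠ μ in 𝓝 lam₀, Tendsto (fun i => totalAngle (coeff (p i) (q i) μ)) l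
      (𝓝 (totalAngle (coeff p₀ q₀ μ)))) : Tendsto Λ l (𝓝 lam₀) := by
  -- Because the total angle is strictly increasing in the spectral parameter, its convergence at
  -- one test point on each side of `lam₀` traps `Λ`.
  obtain ⟨a, b, hab, hI⟩ := mem_nhds_iff_exists_Ioo_subset.1 hc
  rw [tendsto_order]
  constructor
  · intro y hy
    obtain ⟨z, hz1, hz2⟩ := exists_between (max_lt hy hab.1)
    have hz := hI ⟨(le_max_right _ _).trans_lt hz1, hz2.trans hab.2⟩
    have hlt := h₀.strictMono_totalAngle hz2
    simp only [hlam] at hlt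
    filter_upwards [h, hΛ, (tendsto_order.1 hz).2 _ hlt] with i h1 h2 h3
    rw [← h2] at h3
    exact ((le_max_left _ _).trans_lt hz1).trans (h1.strictMono_totalAngle.lt_iff_lt.1 h3)
  · intro y hy
    obtain ⟨z, hz1, hz2⟩ := exists_between (lt_min hy hab.2)
    have hz := hI ⟨hab.1.trans hz1, hz2.trans_le (min_le_right _ _)⟩
    have hlt := h₀.strictMono_totalAngle hz1
    simp only [hlam] at hlt
    filter_upwards [h, hΛ, (tendsto_order.1 hz).1 _ hlt] with i h1 h2 h3
    rw [← h2] at h3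
    exact (h1.strictMono_totalAngle.lt_iff_lt.1 h3).trans (hz2.trans_le (min_le_left _ _))

/-- Along a convergent family, eigenfunctions satisfy a common exponential bound. -/
theorem ConfinedTendsto.exists_exp_bound {ι : Type*} {l : Filter ι} {G : ι → ℝ → ℝ}
    {G₀ : ℝ → ℝ} {R : ℝ} (h : ConfinedTendsto G l G₀ R)
    (hs : ∀ᶠ i in l, sin (SturmLiouville.totalAngle (G i)) = 0) :
    ∃ C, 0 < C ∧ ∀ᶠ i in l, ∀ x, |SturmLiouville.leftSol (G i) x| ≤ C * exp (-|x|) := by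
  obtain ⟨M, hM0, hM⟩ := exists_bound_Icc h.cont₀ (-|R|) |R|
  refine ⟨exp ((1 + (1 + M)) * |R| + |R|), exp_pos _, ?_⟩
  filter_upwards [h.confining, hs, h.conf, h.unif |R| 1 one_pos] with i h1 h2 h3 h4
  refine abs_leftSol_le_of_sin_eq_zero h1 h2 (abs_nonneg R) (fun x hx => ?_)
    fun x hx => h3 x ((le_abs_self R).trans hx)
  calc |G i x| = |(G i x - G₀ x) + G₀ x| := by ring_nf
    _ ≤ 1 + M := (abs_add_le _ _).trans (add_le_add (h4 x hx) (hM x hx))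

end SturmLiouville

/-! ### The perturbed operators are confining, locally uniformly in the parameters. -/

namespace PerturbedOperator
open Real Set SturmLiouville

theorem half_le_weight {a b : ℝ} (h : a ^ 2 / 2 ≤ b ^ 2) (x : ℝ) :
    1 / 2 ≤ 1 + a * x + b ^ 2 * x ^ 2 := by
  have h1 : a ^ 2 / 2 * x ^ 2 ≤ b ^ 2 * x ^ 2 := by gcongr
  nlinarith [sq_nonneg (1 + a * x)]

theorem half_le_pertP {θ : Params} (h : θ ∈ admissible) (x : ℝ) : 1 / 2 ≤ pertP θ x :=
  half_le_weight h.1 x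

/-- With `y = |x|`, the well contributes at least `y^(2ν) / (4 ν²) - η² / 2`, and every other term
is at most a multiple of `y^ν` once `y ≥ 1`; here `ν ≥ 2` absorbs `β₁² x²`. The constant `K` sums
these multiples, and `y ≥ 4 ν² K` suffices. -/
theorem exists_radius_pert {ν : ℕ} (hν : 2 ≤ ν) (l : ℕ) (η B : ℝ) (hB : 0 ≤ B) :
    ∃ R, ∀ θ ∈ admissible, (∀ i, |θ.1 i| ≤ B) → (∀ i, |θ.2 i| ≤ B) → ∀ μ, |μ| ≤ B →
      ∀ x, R ≤ |x| → 1 ≤ coeff (pertP θ) (pertQ ν l η θ) μ x := by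
  set K := η ^ 2 / 2 + (2 * l + 1) * (1 + B) + B + 1 + B + B ^ 2 with hK
  have hK0 : 0 ≤ K := by positivity
  have hν0 : (0 : ℝ) < ν := by exact_mod_cast (by omega : 0 < ν)
  refine ⟨max 1 (4 * ν ^ 2 * K), fun θ hθ h1 h2 μ hμ x hx => ?_⟩
  have hp : 0 < pertP θ x := by linarith [half_le_pertP hθ x]
  rw [coeff, le_div_iff₀ hp, one_mul]
  set y := |x| with hy
  have hy1 : 1 ≤ y := (le_max_left _ _).trans hx
  have hyK : 4 * ν ^ 2 * K ≤ y := (le_max_right _ _).trans hx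
  have hyν : y ≤ y ^ ν := le_self_pow₀ hy1 (by omega)
  have hyν2 : y ^ 2 ≤ y ^ ν := pow_le_pow_right₀ hy1 hν
  have hyν0 : 1 ≤ y ^ ν := one_le_pow₀ hy1
  have hx2 : x ^ 2 = y ^ 2 := by rw [hy, sq_abs]
  have e1 : pertP θ x ≤ 1 + B * y + B ^ 2 * y ^ 2 := by
    have a1 : θ.1 0 * x ≤ B * y := by
      calc _ ≤ |θ.1 0 * x| := le_abs_self _
        _ = |θ.1 0| * y := abs_mul _ _
        _ ≤ B * y := by gcongr; exact h1 0
    have a2 : θ.2 0 ^ 2 ≤ B ^ 2 := by rw [← sq_abs]; gcongr; exact h2 0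
    rw [pertP, hx2]
    have : θ.2 0 ^ 2 * y ^ 2 ≤ B ^ 2 * y ^ 2 := by gcongr
    linarith
  have e2 : (y ^ ν) ^ 2 / (2 * ν ^ 2) - η ^ 2 ≤ (η - x ^ ν / ν) ^ 2 := by
    have : (y ^ ν) ^ 2 / (2 * ν ^ 2) = (x ^ ν / ν) ^ 2 / 2 := by
      rw [hy, ← abs_pow, sq_abs]; field_simp
    rw [this]
    nlinarith [sq_nonneg (2 * η - x ^ ν / ν)]
  have e3 : 1 / 2 * (η - x ^ ν / ν) ^ 2
      ≤ (1 + θ.1 1 * x + θ.2 1 ^ 2 * x ^ 2) * (η - x ^ ν / ν) ^ 2 := by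
    gcongr; exact half_le_weight hθ.2 x
  have e4 : (2 * l + 1) * (1 + θ.1 2 * x) * x ^ (ν - 1) ≤ (2 * l + 1) * (1 + B) * y ^ ν := by
    have a1 : |1 + θ.1 2 * x| ≤ (1 + B) * y := by
      calc _ ≤ |1| + |θ.1 2 * x| := abs_add_le _ _
        _ = 1 + |θ.1 2| * y := by rw [abs_one, abs_mul]
        _ ≤ 1 + B * y := by gcongr; exact h1 2
        _ ≤ _ := by linarith
    calc _ ≤ |(2 * l + 1) * (1 + θ.1 2 * x) * x ^ (ν - 1)| := le_abs_self _
      _ = (2 * l + 1) * |1 + θ.1 2 * x| * y ^ (ν - 1) := by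
        rw [abs_mul, abs_mul, abs_pow, abs_of_nonneg (by positivity : (0 : ℝ) ≤ 2 * l + 1)]
      _ ≤ (2 * l + 1) * ((1 + B) * y) * y ^ (ν - 1) := by gcongr
      _ = (2 * l + 1) * (1 + B) * (y ^ (ν - 1) * y) := by ring
      _ = _ := by rw [← pow_succ, Nat.sub_add_cancel (by omega)]
  have e5 : K * y ^ ν ≤ (y ^ ν) ^ 2 / (4 * ν ^ 2) := by
    rw [le_div_iff₀ (by positivity)]
    calc K * y ^ ν * (4 * ν ^ 2) = (4 * ν ^ 2 * K) * y ^ ν := by ring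
      _ ≤ y ^ ν * y ^ ν := by gcongr; linarith
      _ = _ := by ring
  have e6 : (y ^ ν) ^ 2 / (4 * ν ^ 2) = 1 / 2 * ((y ^ ν) ^ 2 / (2 * ν ^ 2)) := by
    field_simp; norm_num
  have e7 : K * y ^ ν = η ^ 2 / 2 * y ^ ν + (2 * l + 1) * (1 + B) * y ^ ν + B * y ^ ν + y ^ ν
      + B * y ^ ν + B ^ 2 * y ^ ν := by rw [hK]; ring
  have f1 : η ^ 2 / 2 ≤ η ^ 2 / 2 * y ^ ν := le_mul_of_one_le_right (by positivity) hyν0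
  have f2 : B ≤ B * y ^ ν := le_mul_of_one_le_right hB hyν0
  have f3 : B * y ≤ B * y ^ ν := by gcongr
  have f4 : B ^ 2 * y ^ 2 ≤ B ^ 2 * y ^ ν := by gcongr
  have f5 := le_abs_self μ
  rw [pertQ]
  linarith

theorem continuous_pertP (θ : Params) : Continuous (pertP θ) := by unfold pertP; fun_prop

theorem continuous_pertQ (ν l : ℕ) (η : ℝ) (θ : Params) : Continuous (pertQ ν l η θ) := by
  unfold pertQ; fun_prop

theorem confiningPair_pert {ν : ℕ} (hν : 2 ≤ ν) (l : ℕ) (η : ℝ) {θ : Params}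
    (hθ : θ ∈ admissible) : ConfiningPair (pertP θ) (pertQ ν l η θ) where
  continuous_p := continuous_pertP θ
  continuous_q := continuous_pertQ ν l η θ
  pos := fun x => by linarith [half_le_pertP hθ x]
  confining := fun μ => by
    obtain ⟨R, hR⟩ := exists_radius_pert hν l η (‖θ.1‖ + ‖θ.2‖ + |μ|) (by positivity)
    refine Confining.of_forall (R := R) ?_ (hR θ hθ (fun i => ?_) (fun i => ?_) μ ?_)
    · unfold coeff
      exact ((continuous_pertQ ν l η θ).sub continuous_const).div (continuous_pertP θ)
        fun x => ne_of_gt (by linarith [half_le_pertP hθ x])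
    · have := norm_le_pi_norm θ.1 i
      rw [Real.norm_eq_abs] at this
      linarith [norm_nonneg θ.2, abs_nonneg μ]
    · have := norm_le_pi_norm θ.2 i
      rw [Real.norm_eq_abs] at this
      linarith [norm_nonneg θ.1, abs_nonneg μ]
    · linarith [norm_nonneg θ.1, norm_nonneg θ.2]

open Classical in
/-- The `l`-th eigenvalue of the perturbed operator. -/
noncomputable def eigenvalue (ν l : ℕ) (η : ℝ) (θ : Params) : ℝ :=
  if h : ∃ μ, totalAngle (coeff (pertP θ) (pertQ ν l η θ) μ) = (l + 1) * π then h.choose else 0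

/-- The coefficient of the eigenvalue equation at the `l`-th eigenvalue. -/
noncomputable def eigenCoeff (ν l : ℕ) (η : ℝ) (θ : Params) : ℝ → ℝ :=
  coeff (pertP θ) (pertQ ν l η θ) (eigenvalue ν l η θ)

theorem zero_mem_admissible : (0 : Params) ∈ admissible := by simp [admissible]

theorem totalAngle_eigenCoeff {ν : ℕ} (hν : 2 ≤ ν) (l : ℕ) (η : ℝ) {θ : Params}
    (hθ : θ ∈ admissible) : totalAngle (eigenCoeff ν l η θ) = (l + 1) * π := by
  have h := (confiningPair_pert hν l η hθ).exists_totalAngle_eq l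
  rw [eigenCoeff, eigenvalue, dif_pos h]
  exact h.choose_spec

end PerturbedOperator

/-! ### First-order perturbation theory: the derivative of the eigenvalue. -/

namespace PerturbedOperator
open Real Set SturmLiouville

theorem sin_totalAngle_eigenCoeff {ν : ℕ} (hν : 2 ≤ ν) (l : ℕ) (η : ℝ) {θ : Params}
    (hθ : θ ∈ admissible) : sin (totalAngle (eigenCoeff ν l η θ)) = 0 := by
  rw [totalAngle_eigenCoeff hν l η hθ]; exact_mod_cast sin_nat_mul_pi (l + 1)

theorem confining_eigenCoeff {ν : ℕ} (hν : 2 ≤ ν) (l : ℕ) (η : ℝ) {θ : Params}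
    (hθ : θ ∈ admissible) : Confining (eigenCoeff ν l η θ) :=
  (confiningPair_pert hν l η hθ).confining _

theorem isNthEigenvalue_eigenvalue {ν : ℕ} (hν : 2 ≤ ν) (l : ℕ) (η : ℝ) {θ : Params}
    (hθ : θ ∈ admissible) :
    IsNthEigenvalue (pertP θ) (pertQ ν l η θ) l (eigenvalue ν l η θ) :=
  (confiningPair_pert hν l η hθ).isNthEigenvalue (totalAngle_eigenCoeff hν l η hθ)

theorem pertP_zero : pertP 0 = fun _ => 1 := by funext x; simp [pertP]

theorem continuousAt_coeff_pert (ν l : ℕ) (η μ x : ℝ) :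
    ContinuousAt (fun z : (Params × ℝ) × ℝ => coeff (pertP z.1.1) (pertQ ν l η z.1.1) z.1.2 z.2)
      (((0 : Params), μ), x) := by
  unfold coeff
  refine ContinuousAt.div ?_ ?_ (by simp [pertP_zero])
  · unfold pertQ; fun_prop
  · unfold pertP; fun_prop

theorem confinedTendsto_pert {ν : ℕ} (hν : 2 ≤ ν) (l : ℕ) (η : ℝ) {Λ : Params → ℝ} {μ : ℝ}
    (hΛ : Tendsto Λ (𝓝[admissible] 0) (𝓝 μ)) :
    ∃ R, ConfinedTendsto (fun θ => coeff (pertP θ) (pertQ ν l η θ) (Λ θ)) (𝓝[admissible] 0)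
      (coeff (pertP 0) (pertQ ν l η 0) μ) R := by
  obtain ⟨R, hR⟩ := exists_radius_pert hν l η (1 + |μ|) (by positivity)
  have hconf := fun θ hθ μ => ((confiningPair_pert hν l η (θ := θ) hθ).confining μ).continuous
  refine ⟨R, ?_, hconf 0 zero_mem_admissible μ, ?_, ?_, ?_⟩
  · filter_upwards [self_mem_nhdsWithin] with θ hθ using hconf θ hθ _
  · exact tendstoLocUnif_of_continuousAt (X := Params × ℝ)
      (F := fun z => coeff (pertP z.1) (pertQ ν l η z.1) z.2) (φ := fun θ => (θ, Λ θ))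
      (a := ((0 : Params), μ)) ((tendsto_nhdsWithin_of_tendsto_nhds tendsto_id).prodMk_nhds hΛ)
      fun x => continuousAt_coeff_pert ν l η μ x
  · have h1 : ∀ᶠ θ : Params in 𝓝[admissible] 0, ‖θ‖ ≤ 1 := by
      apply eventually_nhdsWithin_of_eventually_nhds
      filter_upwards [Metric.closedBall_mem_nhds (0 : Params) one_pos] with θ hθ
      simpa using hθ
    have h2 : ∀ᶠ θ in 𝓝[admissible] 0, |Λ θ - μ| ≤ 1 := by
      filter_upwards [Metric.tendsto_nhds.1 hΛ 1 one_pos] with θ hθ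
      rw [← Real.dist_eq]; exact hθ.le
    filter_upwards [self_mem_nhdsWithin, h1, h2] with θ hθ h1 h2
    have h0 := abs_nonneg μ
    refine hR θ hθ (fun i => ?_) (fun i => ?_) _ ?_
    · have e1 := norm_le_pi_norm θ.1 i
      rw [Real.norm_eq_abs] at e1
      linarith [norm_fst_le θ]
    · have e1 := norm_le_pi_norm θ.2 i
      rw [Real.norm_eq_abs] at e1
      linarith [norm_snd_le θ]
    · calc |Λ θ| = |(Λ θ - μ) + μ| := by ring_nf
        _ ≤ _ := (abs_add_le _ _).trans (by linarith)
  · exact hR 0 zero_mem_admissible (by simp; positivity) (by simp; positivity) μ (by simp)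

theorem tendsto_eigenvalue_zero {ν : ℕ} (hν : 2 ≤ ν) (l : ℕ) (η : ℝ) :
    Tendsto (eigenvalue ν l η) (𝓝[admissible] 0) (𝓝 (eigenvalue ν l η 0)) := by
  refine tendsto_eigenvalue (p := pertP) (q := pertQ ν l η) (t := (l + 1) * π)
    (eventually_nhdsWithin_of_forall fun θ hθ => confiningPair_pert hν l η hθ)
    (confiningPair_pert hν l η zero_mem_admissible)
    (eventually_nhdsWithin_of_forall fun θ hθ => totalAngle_eigenCoeff hν l η hθ)
    (totalAngle_eigenCoeff hν l η zero_mem_admissible)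
    (Eventually.of_forall fun μ => ?_)
  obtain ⟨R, hR⟩ := confinedTendsto_pert hν l η
    (tendsto_const_nhds (x := μ) (f := 𝓝[admissible] (0 : Params)))
  exact hR.totalAngle

theorem confinedTendsto_eigenCoeff {ν : ℕ} (hν : 2 ≤ ν) (l : ℕ) (η : ℝ) :
    ∃ R, ConfinedTendsto (eigenCoeff ν l η) (𝓝[admissible] 0) (eigenCoeff ν l η 0) R :=
  confinedTendsto_pert hν l η (tendsto_eigenvalue_zero hν l η)

theorem polyBdd_pertQ (ν l : ℕ) (η : ℝ) (θ : Params) : PolyBdd (pertQ ν l η θ) :=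
  ((((polyBdd_const 1).add ((polyBdd_const _).mul polyBdd_id)).add
    ((polyBdd_const _).mul (polyBdd_id.pow 2))).mul
      (((polyBdd_const η).sub ((polyBdd_id.pow ν).div_const ν)).pow 2)).sub
    (((polyBdd_const _).mul ((polyBdd_const 1).add ((polyBdd_const _).mul polyBdd_id))).mul
      (polyBdd_id.pow (ν - 1)))

theorem polyBdd_inv_pertP {θ : Params} (hθ : θ ∈ admissible) : PolyBdd fun x => (pertP θ x)⁻¹ :=
  ⟨2, 0, by norm_num, fun x => by
    have h := half_le_pertP hθ x
    have h0 : 0 < pertP θ x := by linarith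
    rw [abs_of_pos (by positivity), pow_zero, mul_one, inv_le_comm₀ h0 (by norm_num)]
    linarith⟩

theorem polyBdd_eigenCoeff (ν l : ℕ) (η : ℝ) {θ : Params} (hθ : θ ∈ admissible) :
    PolyBdd (eigenCoeff ν l η θ) := by
  have := ((polyBdd_pertQ ν l η θ).sub (polyBdd_const (eigenvalue ν l η θ))).mul
    (polyBdd_inv_pertP hθ)
  simp only [← div_eq_mul_inv] at this
  exact this

/-- The eigenfunction of the unperturbed operator. -/
noncomputable def eigenfunction (ν l : ℕ) (η : ℝ) : ℝ → ℝ := leftSol (eigenCoeff ν l η 0)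

theorem eigenCoeff_zero (ν l : ℕ) (η x : ℝ) :
    eigenCoeff ν l η 0 x = pertQ ν l η 0 x - eigenvalue ν l η 0 := by
  simp [eigenCoeff, coeff, pertP_zero]

/-- The overlap integrals with the perturbed eigenfunctions converge. -/
theorem tendsto_overlap {ν : ℕ} (hν : 2 ≤ ν) (l : ℕ) (η : ℝ) {f : ℝ → ℝ} (hf : PolyBdd f)
    (hfc : Continuous f) :
    Tendsto (fun θ => ∫ x, f x * (eigenfunction ν l η x * leftSol (eigenCoeff ν l η θ) x)
        / pertP θ x) (𝓝[admissible] 0) (𝓝 (∫ x, f x * eigenfunction ν l η x ^ 2)) := by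
  obtain ⟨R, hR⟩ := confinedTendsto_eigenCoeff hν l η
  have hs : ∀ᶠ θ in 𝓝[admissible] 0, sin (totalAngle (eigenCoeff ν l η θ)) = 0 :=
    eventually_nhdsWithin_of_forall fun θ hθ => sin_totalAngle_eigenCoeff hν l η hθ
  obtain ⟨K, hK, hKb⟩ := hR.exists_exp_bound hs
  have h0 := confining_eigenCoeff hν l η zero_mem_admissible
  have hd := hf.mul_expDecay
    (expDecay_leftSol h0 (sin_totalAngle_eigenCoeff hν l η zero_mem_admissible))
  obtain ⟨C, N, hC, hb⟩ := hd
  have hc0 : Continuous (eigenfunction ν l η) := continuous_leftSol h0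
  refine tendsto_integral_filter_of_dominated_convergence
    (fun x => 2 * K * C * (1 + |x|) ^ N * exp (-|x|)) ?_ ?_
    (integrable_one_add_abs_pow_mul_exp _ N) (Eventually.of_forall fun x => ?_)
  · filter_upwards [self_mem_nhdsWithin] with θ hθ
    have := continuous_leftSol (confining_eigenCoeff hν l η hθ)
    have := continuous_pertP θ
    exact (Continuous.div (by fun_prop) this fun x =>
      ne_of_gt (by linarith [half_le_pertP hθ x])).aestronglyMeasurable
  · filter_upwards [self_mem_nhdsWithin, hKb] with θ hθ h1
    refine Eventually.of_forall fun x => ?_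
    have hp := half_le_pertP hθ x
    have hp0 : 0 < pertP θ x := by linarith
    rw [Real.norm_eq_abs, abs_div, abs_of_pos hp0, div_le_iff₀ hp0, ← mul_assoc, abs_mul]
    have e1 : |leftSol (eigenCoeff ν l η θ) x| ≤ K :=
      (h1 x).trans (mul_le_of_le_one_right hK.le (by simp))
    calc _ ≤ (C * (1 + |x|) ^ N * exp (-|x|)) * K := by gcongr; exact hb x
      _ = 2 * K * C * (1 + |x|) ^ N * exp (-|x|) * (1 / 2) := by ring
      _ ≤ _ := by gcongr
  · have e1 : Tendsto (fun θ : Params => pertP θ x) (𝓝[admissible] 0) (𝓝 1) := by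
      have : Continuous fun θ : Params => pertP θ x := by unfold pertP; fun_prop
      have := this.tendsto 0
      simp only [pertP_zero] at this
      exact tendsto_nhdsWithin_of_tendsto_nhds this
    have e2 := hR.leftSol x
    have e3 := ((tendsto_const_nhds (x := f x)).mul
      ((tendsto_const_nhds (x := eigenfunction ν l η x)).mul e2)).div e1 one_ne_zero
    rw [div_one] at e3
    rw [sq]
    exact e3

/-- The overlap of an unperturbed and a perturbed eigenfunction with a weight. -/
noncomputable def overlap (ν l : ℕ) (η : ℝ) (f : ℝ → ℝ) (θ : Params) : ℝ :=
  ∫ x, f x * (eigenfunction ν l η x * leftSol (eigenCoeff ν l η θ) x) / pertP θ x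

/-- The unnormalized expectation of a function in the `l`-th unperturbed eigenstate. -/
noncomputable def moment (ν l : ℕ) (η : ℝ) (f : ℝ → ℝ) : ℝ :=
  ∫ x, f x * eigenfunction ν l η x ^ 2

theorem integral_leftSol_sq_pos {G : ℝ → ℝ} (hG : Confining G) (hs : sin (totalAngle G) = 0) :
    0 < ∫ x, leftSol G x ^ 2 := by
  have hc := continuous_leftSol hG
  obtain ⟨x, hx⟩ := Function.ne_iff.1 (leftSol_ne_zero _ hG)
  refine integral_pos_of_integrable_nonneg_nonzero (x := x) (by fun_prop) ?_
    (fun x => sq_nonneg _) (pow_ne_zero 2 hx)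
  simpa only [sq] using ((expDecay_leftSol hG hs).mul (expDecay_leftSol hG hs)).integrable
    (hc.mul hc)

theorem integrable_overlap {ν : ℕ} (hν : 2 ≤ ν) (l : ℕ) (η : ℝ) {f : ℝ → ℝ} (hf : PolyBdd f)
    (hfc : Continuous f) {θ : Params} (hθ : θ ∈ admissible) :
    Integrable fun x =>
      f x * (eigenfunction ν l η x * leftSol (eigenCoeff ν l η θ) x) / pertP θ x := by
  have h0 := confining_eigenCoeff hν l η zero_mem_admissible
  have h1 := confining_eigenCoeff hν l η hθ
  have d0 : ExpDecay (eigenfunction ν l η) :=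
    expDecay_leftSol h0 (sin_totalAngle_eigenCoeff hν l η zero_mem_admissible)
  have d1 := expDecay_leftSol h1 (sin_totalAngle_eigenCoeff hν l η hθ)
  have c0 : Continuous (eigenfunction ν l η) := continuous_leftSol h0
  have c1 := continuous_leftSol h1
  have c2 := continuous_pertP θ
  have h := (polyBdd_inv_pertP hθ).mul_expDecay (hf.mul_expDecay (d0.mul d1))
  simp only [mul_comm (pertP θ _)⁻¹, ← div_eq_mul_inv] at h
  exact h.integrable (Continuous.div (by fun_prop) c2 fun x =>
      ne_of_gt (by linarith [half_le_pertP hθ x]))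

theorem overlap_add {ν : ℕ} (hν : 2 ≤ ν) (l : ℕ) (η : ℝ) {θ : Params} (hθ : θ ∈ admissible)
    {f g : ℝ → ℝ} (hf : PolyBdd f) (hfc : Continuous f) (hg : PolyBdd g) (hgc : Continuous g) :
    overlap ν l η (fun x => f x + g x) θ = overlap ν l η f θ + overlap ν l η g θ := by
  rw [overlap, overlap, overlap, ← integral_add (integrable_overlap hν l η hf hfc hθ)
    (integrable_overlap hν l η hg hgc hθ)]
  congr 1; funext x; ring

theorem overlap_const_mul (ν l : ℕ) (η c : ℝ) (f : ℝ → ℝ) (θ : Params) :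
    overlap ν l η (fun x => c * f x) θ = c * overlap ν l η f θ := by
  rw [overlap, overlap, ← integral_const_mul]
  congr 1; funext x; ring

/-- The weights that give the derivatives of the eigenvalue with respect to `α₁, α₂, α₃`. -/
noncomputable def weight (ν l : ℕ) (η : ℝ) : Fin 3 → ℝ → ℝ :=
  ![fun x => -(x * eigenCoeff ν l η 0 x), fun x => x * (η - x ^ ν / ν) ^ 2,
    fun x => -((2 * l + 1) * (x * x ^ (ν - 1)))]

theorem polyBdd_weight (ν l : ℕ) (η : ℝ) (j : Fin 3) : PolyBdd (weight ν l η j) := by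
  fin_cases j
  · exact (polyBdd_id.mul (polyBdd_eigenCoeff ν l η zero_mem_admissible)).neg
  · exact polyBdd_id.mul (((polyBdd_const η).sub ((polyBdd_id.pow ν).div_const ν)).pow 2)
  · exact ((polyBdd_const _).mul (polyBdd_id.mul (polyBdd_id.pow (ν - 1)))).neg

theorem continuous_weight {ν : ℕ} (hν : 2 ≤ ν) (l : ℕ) (η : ℝ) (j : Fin 3) :
    Continuous (weight ν l η j) := by
  have := (confining_eigenCoeff hν l η zero_mem_admissible).continuous
  fin_cases j <;> simp only [weight] <;>
    first
    | exact (continuous_id.mul this).neg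
    | exact (by fun_prop : Continuous fun x : ℝ => x * (η - x ^ ν / ν) ^ 2)
    | exact (by fun_prop : Continuous fun x : ℝ => -((2 * l + 1) * (x * x ^ (ν - 1))))

/-- This is the orthogonality relation for the coefficients at `θ` and at `0`, written out without
approximation. The division by `pertP` inside `overlap` stems from the form `(q - λ) / p` of the
coefficient. -/
theorem eigenvalue_sub_mul_overlap {ν : ℕ} (hν : 2 ≤ ν) (l : ℕ) (η : ℝ) {θ : Params}
    (hθ : θ ∈ admissible) :
    (eigenvalue ν l η θ - eigenvalue ν l η 0) * overlap ν l η (fun _ => 1) θ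
      = (∑ j, θ.1 j * overlap ν l η (weight ν l η j) θ)
        + θ.2 0 ^ 2 * overlap ν l η (fun x => x * weight ν l η 0 x) θ
        + θ.2 1 ^ 2 * overlap ν l η (fun x => x * weight ν l η 1 x) θ := by
  have h := integral_coeff_sub_mul_eq_zero
    (confining_eigenCoeff hν l η zero_mem_admissible) (confining_eigenCoeff hν l η hθ)
    (sin_totalAngle_eigenCoeff hν l η zero_mem_admissible) (sin_totalAngle_eigenCoeff hν l η hθ)
    (polyBdd_eigenCoeff ν l η zero_mem_admissible) (polyBdd_eigenCoeff ν l η hθ)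
  have pw := polyBdd_weight ν l η
  have cw := continuous_weight hν l η
  have px := fun j => polyBdd_id.mul (pw j)
  have cx := fun j => continuous_id.mul (cw j)
  rw [Fin.sum_univ_three]
  have key : overlap ν l η (fun x => θ.1 0 * weight ν l η 0 x + θ.1 1 * weight ν l η 1 x
      + θ.1 2 * weight ν l η 2 x + θ.2 0 ^ 2 * (x * weight ν l η 0 x)
      + θ.2 1 ^ 2 * (x * weight ν l η 1 x) + -(eigenvalue ν l η θ - eigenvalue ν l η 0) * 1) θ
      = 0 := by
    rw [← h, overlap]
    refine integral_congr_ae (Eventually.of_forall fun x => ?_)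
    have hp : pertP θ x ≠ 0 := ne_of_gt (by linarith [half_le_pertP hθ x])
    have e1 : eigenCoeff ν l η θ x * pertP θ x = pertQ ν l η θ x - eigenvalue ν l η θ := by
      rw [eigenCoeff, coeff]; field_simp
    have e2 := eigenCoeff_zero ν l η x
    have e3 : weight ν l η 0 x = -(x * eigenCoeff ν l η 0 x) := rfl
    have e4 : weight ν l η 1 x = x * (η - x ^ ν / ν) ^ 2 := rfl
    have e5 : weight ν l η 2 x = -((2 * l + 1) * (x * x ^ (ν - 1))) := rfl
    have e6 : pertP θ x = 1 + θ.1 0 * x + θ.2 0 ^ 2 * x ^ 2 := rfl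
    have e7 : pertQ ν l η θ x = (1 + θ.1 1 * x + θ.2 1 ^ 2 * x ^ 2) * (η - x ^ ν / ν) ^ 2
      - (2 * l + 1) * (1 + θ.1 2 * x) * x ^ (ν - 1) := rfl
    have e8 : pertQ ν l η 0 x = (η - x ^ ν / ν) ^ 2 - (2 * l + 1) * x ^ (ν - 1) := by
      simp [pertQ]
    simp only [e3, e4, e5]
    have e9 : (eigenCoeff ν l η θ x - eigenCoeff ν l η 0 x) * pertP θ x
        = (pertQ ν l η θ x - eigenvalue ν l η θ)
          - eigenCoeff ν l η 0 x * (1 + θ.1 0 * x + θ.2 0 ^ 2 * x ^ 2) := by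
      rw [sub_mul, e1, e6]
    rw [e7] at e9
    rw [e8] at e2
    change _ = (eigenCoeff ν l η θ x - eigenCoeff ν l η 0 x)
      * (eigenfunction ν l η x * leftSol (eigenCoeff ν l η θ) x)
    generalize eigenfunction ν l η x * leftSol (eigenCoeff ν l η θ) x = U
    generalize (η - x ^ ν / (ν : ℝ)) ^ 2 = F at e2 e9 ⊢
    field_simp
    linear_combination (-U) * e9 + U * e2
  have q := fun (c : ℝ) {f : ℝ → ℝ} (hf : PolyBdd f) => (polyBdd_const c).mul hf
  have r := fun (c : ℝ) {f : ℝ → ℝ} (hf : Continuous f) => hf.const_mul c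
  have p1 := (q (θ.1 0) (pw 0)).add (q (θ.1 1) (pw 1))
  have c1 := (r (θ.1 0) (cw 0)).add (r (θ.1 1) (cw 1))
  have p2 := p1.add (q (θ.1 2) (pw 2))
  have c2 := c1.add (r (θ.1 2) (cw 2))
  have p3 := p2.add (q (θ.2 0 ^ 2) (px 0))
  have c3 := c2.add (r (θ.2 0 ^ 2) (cx 0))
  have p4 := p3.add (q (θ.2 1 ^ 2) (px 1))
  have c4 := c3.add (r (θ.2 1 ^ 2) (cx 1))
  rw [overlap_add hν l η hθ p4 c4 (q _ (polyBdd_const 1)) (r _ continuous_const),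
    overlap_add hν l η hθ p3 c3 (q _ (px 1)) (r _ (cx 1)),
    overlap_add hν l η hθ p2 c2 (q _ (px 0)) (r _ (cx 0)),
    overlap_add hν l η hθ p1 c1 (q _ (pw 2)) (r _ (cw 2)),
    overlap_add hν l η hθ (q _ (pw 0)) (r _ (cw 0)) (q _ (pw 1)) (r _ (cw 1))] at key
  simp only [overlap_const_mul] at key
  linarith

/-- The derivative of the eigenvalue at the unperturbed operator. -/
noncomputable def eigenvalueDeriv (ν l : ℕ) (η : ℝ) : Params →L[ℝ] ℝ :=
  ∑ j, (moment ν l η (weight ν l η j) / moment ν l η fun _ => 1) •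
    ((ContinuousLinearMap.proj (R := ℝ) (φ := fun _ : Fin 3 => ℝ) j).comp
      (ContinuousLinearMap.fst ℝ (Fin 3 → ℝ) (Fin 2 → ℝ)))

theorem eigenvalueDeriv_apply (ν l : ℕ) (η : ℝ) (θ : Params) :
    eigenvalueDeriv ν l η θ
      = ∑ j, (moment ν l η (weight ν l η j) / moment ν l η fun _ => 1) * θ.1 j := by
  simp [eigenvalueDeriv]

theorem moment_one_pos {ν : ℕ} (hν : 2 ≤ ν) (l : ℕ) (η : ℝ) : 0 < moment ν l η fun _ => 1 := by
  simpa [moment, eigenfunction] using integral_leftSol_sq_pos (confining_eigenCoeff hν l η zero_mem_admissible)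
    (sin_totalAngle_eigenCoeff hν l η zero_mem_admissible)

/-- Dividing the exact identity by the overlap of the two eigenfunctions leaves ratios that converge
to expectations. The `β` terms carry a square and are `o(θ)`, so only `α` contributes. -/
theorem hasFDerivWithinAt_eigenvalue {ν : ℕ} (hν : 2 ≤ ν) (l : ℕ) (η : ℝ) :
    HasFDerivWithinAt (eigenvalue ν l η) (eigenvalueDeriv ν l η) admissible 0 := by
  rw [hasFDerivWithinAt_iff_isLittleO]
  simp only [sub_zero]
  have hN := moment_one_pos hν l η
  have hJ := tendsto_overlap hν l η (polyBdd_const 1) continuous_const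
  have hw := fun j => tendsto_overlap hν l η (polyBdd_weight ν l η j) (continuous_weight hν l η j)
  have hx := fun j => tendsto_overlap hν l η (polyBdd_id.mul (polyBdd_weight ν l η j))
    (continuous_id.mul (continuous_weight hν l η j))
  change Tendsto (overlap ν l η _) _ (𝓝 (moment ν l η _)) at hJ
  change ∀ j, Tendsto (overlap ν l η _) _ (𝓝 (moment ν l η _)) at hw
  change ∀ j, Tendsto (overlap ν l η _) _ (𝓝 (moment ν l η _)) at hx
  have hα : ∀ j, (fun θ : Params => θ.1 j) =O[𝓝[admissible] 0] fun θ => θ := fun j =>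
    isBigO_of_le _ fun θ => (norm_le_pi_norm θ.1 j).trans (norm_fst_le θ)
  have hβ : ∀ j, (fun θ : Params => θ.2 j) =O[𝓝[admissible] 0] fun θ => θ := fun j =>
    isBigO_of_le _ fun θ => (norm_le_pi_norm θ.2 j).trans (norm_snd_le θ)
  have t1 : ∀ j, (fun θ : Params => θ.1 j * (overlap ν l η (weight ν l η j) θ
      / overlap ν l η (fun _ => 1) θ - moment ν l η (weight ν l η j) / moment ν l η fun _ => 1))
      =o[𝓝[admissible] 0] fun θ => θ := by
    intro j
    have h1 := ((hw j).div hJ hN.ne').sub_const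
      (moment ν l η (weight ν l η j) / moment ν l η fun _ => 1)
    rw [sub_self] at h1
    have h2 := (hα j).norm_right.mul_isLittleO ((isLittleO_one_iff ℝ).2 h1)
    simp only [mul_one] at h2
    exact h2.of_norm_right
  have t2 : ∀ i j, (fun θ : Params => θ.2 i * (θ.2 i *
      (overlap ν l η (fun x => x * weight ν l η j x) θ / overlap ν l η (fun _ => 1) θ)))
      =o[𝓝[admissible] 0] fun θ => θ := by
    intro i j
    have h0 : Tendsto (fun θ : Params => θ.2 i) (𝓝[admissible] 0) (𝓝 0) := by
      have : Continuous fun θ : Params => θ.2 i := by fun_prop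
      exact tendsto_nhdsWithin_of_tendsto_nhds (by simpa using this.tendsto 0)
    have h1 := h0.mul ((hx j).div hJ hN.ne')
    rw [zero_mul] at h1
    have h2 := (hβ i).norm_right.mul_isLittleO ((isLittleO_one_iff ℝ).2 h1)
    simp only [mul_one] at h2
    exact h2.of_norm_right
  refine ((((t1 0).add (t1 1)).add (t1 2)).add ((t2 0 0).add (t2 1 1))).congr' ?_
    EventuallyEq.rfl
  filter_upwards [self_mem_nhdsWithin, (tendsto_order.1 hJ).1 0 hN] with θ hθ hpos
  have e1 := eigenvalue_sub_mul_overlap hν l η hθ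
  rw [eigenvalueDeriv_apply]
  have e2 : eigenvalue ν l η θ - eigenvalue ν l η 0 = _ := (eq_div_iff hpos.ne').2 e1
  rw [e2, Fin.sum_univ_three, Fin.sum_univ_three]
  ring

end PerturbedOperator

/-! ### The scaled potential and its uniform confinement. -/

namespace PerturbedOperator
open Real Set SturmLiouville

/-- The difference quotient `((1 + t)^ν - 1) / (ν t)`. -/
noncomputable def wellSlope (ν : ℕ) (t : ℝ) : ℝ := (∑ j ∈ Finset.range ν, (1 + t) ^ j) / ν

theorem mul_wellSlope (ν : ℕ) (t : ℝ) : t * wellSlope ν t = ((1 + t) ^ ν - 1) / ν := by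
  have := mul_geom_sum (1 + t) ν
  rw [add_sub_cancel_left] at this
  rw [wellSlope, ← this]; ring

/-- The potential in the variable `z`, where `x = x₀ (1 + s z)`. -/
noncomputable def scaledV (ν l : ℕ) (s z : ℝ) : ℝ :=
  (z * wellSlope ν (s * z)) ^ 2 - (2 * l + 1) * (1 + s * z) ^ (ν - 1)

/-- All summands of the geometric sum are nonnegative, and the first and last are `1` and `(1 +
t)^(ν-1)`. -/
theorem wellSlope_sq_ge_of_nonneg {ν : ℕ} (hν : 2 ≤ ν) {t : ℝ} (h : 0 ≤ 1 + t) :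
    (1 + ((1 + t) ^ (ν - 1)) ^ 2) / (4 * ν ^ 2) ≤ wellSlope ν t ^ 2 := by
  have hν0 : (0 : ℝ) < ν := by exact_mod_cast (by omega : 0 < ν)
  have h1 : 1 ≤ ∑ j ∈ Finset.range ν, (1 + t) ^ j := by
    have := Finset.single_le_sum (f := fun j => (1 + t) ^ j) (fun j _ => pow_nonneg h j)
      (Finset.mem_range.2 (by omega : 0 < ν))
    simpa using this
  have h2 : (1 + t) ^ (ν - 1) ≤ ∑ j ∈ Finset.range ν, (1 + t) ^ j :=
    Finset.single_le_sum (f := fun j => (1 + t) ^ j) (fun j _ => pow_nonneg h j)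
      (Finset.mem_range.2 (by omega : ν - 1 < ν))
  have h3 : 0 ≤ (1 + t) ^ (ν - 1) := pow_nonneg h _
  rw [wellSlope, div_pow, div_le_div_iff₀ (by positivity) (by positivity)]
  have h4 : 1 + ((1 + t) ^ (ν - 1)) ^ 2 ≤ 4 * (∑ j ∈ Finset.range ν, (1 + t) ^ j) ^ 2 := by
    nlinarith
  nlinarith [sq_nonneg (ν : ℝ), mul_le_mul_of_nonneg_right h4 (sq_nonneg (ν : ℝ))]

/-- With `a = -(1 + t)` and `Y = a^(ν-1)` the slope is `(1 + Y a) / (ν (1 + a))`. Since `a` and `Y`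
lie on the same side of `1`, `(1 - a)(1 - Y) ≥ 0`, which bounds the slope below by `(1 + Y) / (2
ν)`. -/
theorem wellSlope_sq_ge_of_odd {ν : ℕ} (hν : Odd ν) {t : ℝ} (h : 1 + t ≤ 0) :
    (1 + ((1 + t) ^ (ν - 1)) ^ 2) / (4 * ν ^ 2) ≤ wellSlope ν t ^ 2 := by
  obtain ⟨k, hk⟩ := hν
  have hν0 : (0 : ℝ) < ν := by exact_mod_cast (by omega : 0 < ν)
  obtain ⟨a, ha⟩ : ∃ a, a = -(1 + t) := ⟨_, rfl⟩
  have ha0 : 0 ≤ a := by linarith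
  have hy : 1 + t = -a := by linarith
  have hY : (1 + t) ^ (ν - 1) = a ^ (ν - 1) := by
    rw [hy, Even.neg_pow ⟨k, by omega⟩]
  have hyν : (1 + t) ^ ν = -(a ^ (ν - 1) * a) := by
    rw [hy, Odd.neg_pow ⟨k, hk⟩, ← pow_succ, Nat.sub_add_cancel (by omega)]
  have h1 := mul_wellSlope ν t
  rw [hyν] at h1
  set Y := a ^ (ν - 1) with hYdef
  have hY0 : 0 ≤ Y := by positivity
  rw [hY]
  have h2 : wellSlope ν t = (1 + Y * a) / (ν * (1 + a)) := by
    have ht : t = -(1 + a) := by linarith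
    rw [eq_div_iff (by positivity)]
    rw [eq_div_iff hν0.ne'] at h1
    rw [ht] at h1 ⊢
    linear_combination -h1
  have h3 : 0 ≤ (1 - a) * (1 - Y) := by
    rcases le_total a 1 with h | h
    · exact mul_nonneg (by linarith) (by linarith [pow_le_one₀ (n := ν - 1) ha0 h])
    · exact mul_nonneg_of_nonpos_of_nonpos (by linarith) (by linarith [one_le_pow₀ (n := ν - 1) h])
  have h4 : (1 + Y) / (2 * ν) ≤ wellSlope ν t := by
    rw [h2, div_le_div_iff₀ (by positivity) (by positivity)]
    have : (1 + Y) * (1 + a) ≤ 2 * (1 + Y * a) := by nlinarith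
    nlinarith [mul_le_mul_of_nonneg_right this hν0.le]
  calc (1 + Y ^ 2) / (4 * ν ^ 2) ≤ ((1 + Y) / (2 * ν)) ^ 2 := by
        rw [div_pow, mul_pow]
        norm_num
        gcongr
        nlinarith
    _ ≤ _ := by gcongr

theorem le_scaledV_of_sq_ge {l : ℕ} {Y f z N : ℝ} (hN : 0 < N)
    (hf : (1 + Y ^ 2) / (4 * N ^ 2) ≤ f ^ 2) (hz : 4 * N ^ 2 * (2 * l + 3) ≤ z ^ 2) :
    2 ≤ (z * f) ^ 2 - (2 * l + 1) * Y := by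
  have h1 : (2 * l + 3) * (1 + Y ^ 2) ≤ (z * f) ^ 2 := by
    rw [mul_pow]
    calc (2 * l + 3) * (1 + Y ^ 2)
        = 4 * N ^ 2 * (2 * l + 3) * ((1 + Y ^ 2) / (4 * N ^ 2)) := by field_simp
      _ ≤ z ^ 2 * f ^ 2 := by gcongr
  have hl : (0 : ℝ) ≤ l := l.cast_nonneg
  nlinarith [sq_nonneg (Y - 1), sq_nonneg Y, mul_nonneg hl (sq_nonneg (Y - 1)),
    mul_nonneg hl (sq_nonneg Y)]

/-- The scaled potentials are confining uniformly in the scaling parameter. -/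
theorem two_le_scaledV {ν l : ℕ} (hν : 2 ≤ ν) (hl : 1 ≤ l) {s z : ℝ}
    (hz : 6 * ν * (2 * l + 3) ≤ |z|) : 2 ≤ scaledV ν l s z := by
  have hν0 : (0 : ℝ) < ν := by exact_mod_cast (by omega : 0 < ν)
  have hl' : (1 : ℝ) ≤ l := by exact_mod_cast hl
  have hz2 : 36 * ν ^ 2 * (2 * l + 3) ^ 2 ≤ z ^ 2 := by
    rw [← sq_abs z]
    calc 36 * ν ^ 2 * (2 * l + 3 : ℝ) ^ 2 = (6 * ν * (2 * l + 3)) ^ 2 := by ring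
      _ ≤ |z| ^ 2 := by gcongr
  have hz3 : 4 * ν ^ 2 * (2 * l + 3) ≤ z ^ 2 := by
    refine le_trans ?_ hz2
    have : (2 * l + 3 : ℝ) ≤ (2 * l + 3) ^ 2 := by nlinarith
    have h2 : 0 ≤ (2 * l + 3 : ℝ) := by positivity
    calc 4 * ν ^ 2 * (2 * l + 3) ≤ 4 * ν ^ 2 * (2 * l + 3 : ℝ) ^ 2 := by gcongr
      _ ≤ _ := by gcongr; norm_num
  rw [scaledV]
  rcases le_total 0 (1 + s * z) with h | h
  · exact le_scaledV_of_sq_ge hν0 (wellSlope_sq_ge_of_nonneg hν h) hz3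
  rcases Nat.even_or_odd ν with he | ho
  -- For even `ν` the squared term has a second zero at `1 + s z = -1`, but there the term linear in
  -- `(1 + s z)^(ν-1)` is positive and acts as a barrier.
  · obtain ⟨a, ha⟩ : ∃ a, a = -(1 + s * z) := ⟨_, rfl⟩
    have ha0 : 0 ≤ a := by linarith
    have hy : 1 + s * z = -a := by linarith
    have hodd : Odd (ν - 1) := Nat.Even.sub_odd (by omega) he odd_one
    set Y := a ^ (ν - 1) with hY
    have hY0 : 0 ≤ Y := by positivity
    have e1 : (1 + s * z) ^ (ν - 1) = -Y := by rw [hy, hodd.neg_pow]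
    rw [e1]
    -- Either the barrier alone exceeds `2`, or `l ≥ 1` gives `Y < 2/3`, which keeps away from the
    -- second zero and yields slope at least `1 / (6 ν)`. This case dictates the factor `6 ν` in the
    -- radius.
    rcases le_or_gt 2 ((2 * l + 1) * Y) with h2 | h2
    · nlinarith [sq_nonneg (z * wellSlope ν (s * z))]
    · have hY1 : Y < 2 / 3 := by nlinarith
      have ha1 : a < 1 := by
        by_contra! h1
        linarith [one_le_pow₀ (n := ν - 1) h1]
      have e2 : (1 + s * z) ^ ν = Y * a := by
        rw [hy, he.neg_pow, hY, ← pow_succ, Nat.sub_add_cancel (by omega)]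
      have e3 := mul_wellSlope ν (s * z)
      rw [e2, eq_div_iff hν0.ne'] at e3
      have e4 : s * z = -(1 + a) := by linarith
      have e5 : 1 / (6 * ν) ≤ wellSlope ν (s * z) := by
        rw [div_le_iff₀ (by positivity)]
        rw [e4] at e3 ⊢
        have h5 : (1 + a) * (wellSlope ν (-(1 + a)) * ν) = 1 - Y * a := by linear_combination -e3
        have h6 : 1 / 3 ≤ 1 - Y * a := by nlinarith
        have h7 : 1 / 3 ≤ (1 + a) * (wellSlope ν (-(1 + a)) * ν) := by linarith
        have h8 : 0 < wellSlope ν (-(1 + a)) * ν := by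
          by_contra! h8
          nlinarith
        nlinarith
      have e6 : 2 ≤ (z * wellSlope ν (s * z)) ^ 2 := by
        rw [mul_pow]
        calc (2 : ℝ) ≤ (36 * ν ^ 2 * (2 * l + 3) ^ 2) * (1 / (6 * ν)) ^ 2 := by
              field_simp; nlinarith
          _ ≤ _ := by gcongr
      nlinarith
  · exact le_scaledV_of_sq_ge hν0 (wellSlope_sq_ge_of_odd ho h) hz3

theorem continuous_scaledV (ν l : ℕ) : Continuous fun y : ℝ × ℝ => scaledV ν l y.1 y.2 := by
  unfold scaledV wellSlope; fun_prop

theorem scaledV_zero {ν : ℕ} (hν : 2 ≤ ν) (l : ℕ) (z : ℝ) :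
    scaledV ν l 0 z = osc (2 * l + 1) z := by
  have hν0 : (ν : ℝ) ≠ 0 := by exact_mod_cast (by omega : ν ≠ 0)
  simp [scaledV, wellSlope, osc, hν0]

theorem coeff_one (q : ℝ → ℝ) (μ z : ℝ) : coeff (fun _ => 1) q μ z = q z - μ := by simp [coeff]

/-- The coefficient of the scaled eigenvalue equation. -/
noncomputable def scaledCoeff (ν l : ℕ) (s E : ℝ) : ℝ → ℝ :=
  coeff (fun _ => 1) (scaledV ν l s) E

theorem scaledCoeff_apply (ν l : ℕ) (s E z : ℝ) : scaledCoeff ν l s E z = scaledV ν l s z - E :=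
  coeff_one _ _ _

theorem scaledCoeff_zero {ν : ℕ} (hν : 2 ≤ ν) (l : ℕ) (E : ℝ) :
    scaledCoeff ν l 0 E = osc (2 * l + 1 + E) := by
  funext z
  rw [scaledCoeff_apply, scaledV_zero hν, osc, osc]; ring

theorem continuous_scaledV_right (ν l : ℕ) (s : ℝ) : Continuous (scaledV ν l s) :=
  (continuous_scaledV ν l).comp (by fun_prop : Continuous fun z : ℝ => (s, z))

theorem continuous_scaledCoeff (ν l : ℕ) (s E : ℝ) : Continuous (scaledCoeff ν l s E) := by
  simp only [funext fun z => scaledCoeff_apply ν l s E z]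
  exact (continuous_scaledV_right ν l s).sub continuous_const

theorem confiningPair_scaledV_zero {ν : ℕ} (hν : 2 ≤ ν) (l : ℕ) :
    ConfiningPair (fun _ => 1) (scaledV ν l 0) where
  continuous_p := continuous_const
  continuous_q := continuous_scaledV_right ν l 0
  pos := fun _ => one_pos
  confining := fun μ => by
    have := scaledCoeff_zero hν l μ
    rw [scaledCoeff] at this
    rw [this]; exact confining_osc _

/-- The restriction `μ < 1` matches the bound `2 ≤ scaledV` outside a radius independent of `s`: it
leaves room for `scaledV - Λ ≥ 1`. -/
theorem confinedTendsto_scaledCoeff {ι : Type*} {ν l : ℕ} {L : Filter ι} {s Λ : ι → ℝ} {s₀ μ : ℝ}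
    (hν : 2 ≤ ν) (hl : 1 ≤ l) (hs : Tendsto s L (𝓝 s₀)) (hΛ : Tendsto Λ L (𝓝 μ)) (hμ : μ < 1) :
    ConfinedTendsto (fun i => scaledCoeff ν l (s i) (Λ i)) L (scaledCoeff ν l s₀ μ)
      (6 * ν * (2 * l + 3)) := by
  refine ⟨Eventually.of_forall fun i => continuous_scaledCoeff _ _ _ _,
    continuous_scaledCoeff _ _ _ _, ?_, ?_, ?_⟩
  · refine tendstoLocUnif_of_continuousAt (X := ℝ × ℝ)
      (F := fun y => scaledCoeff ν l y.1 y.2) (φ := fun i => (s i, Λ i)) (a := (s₀, μ))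
      (hs.prodMk_nhds hΛ) fun x => ?_
    simp only [scaledCoeff_apply]
    have := (continuous_scaledV ν l).comp
      (by fun_prop : Continuous fun z : (ℝ × ℝ) × ℝ => (z.1.1, z.2))
    exact (this.sub (by fun_prop : Continuous fun z : (ℝ × ℝ) × ℝ => z.1.2)).continuousAt
  · filter_upwards [(tendsto_order.1 hΛ).2 1 hμ] with i hi x hx
    rw [scaledCoeff_apply]
    linarith [two_le_scaledV hν hl (s := s i) hx]
  · intro x hx
    rw [scaledCoeff_apply]
    linarith [two_le_scaledV hν hl (s := s₀) hx]

end PerturbedOperator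

/-! ### Taylor expansion of the scaled potential; expectations and the hypervirial theorem. -/

namespace PerturbedOperator
open Real Set SturmLiouville Polynomial

/-- The scaled potential as a polynomial in the scaling parameter, with coefficients polynomials
in `z`. -/
noncomputable def scaledPoly (ν l : ℕ) : ℝ[X][X] :=
  (C X * (C (C (ν : ℝ)⁻¹) * ∑ j ∈ Finset.range ν, (1 + C X * X) ^ j)) ^ 2
    - C (C (2 * l + 1 : ℝ)) * (1 + C X * X) ^ (ν - 1)

/-- The scaled potential as a polynomial in `z`. -/
noncomputable def scaledPolyAt (ν l : ℕ) (s : ℝ) : ℝ[X] := (scaledPoly ν l).eval (C s)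

theorem eval_scaledPolyAt (ν l : ℕ) (s z : ℝ) : (scaledPolyAt ν l s).eval z = scaledV ν l s z := by
  simp [scaledPolyAt, scaledPoly, scaledV, wellSlope, eval_finsetSum, div_eq_inv_mul]

theorem exists_eq_taylor_four (p : ℝ[X]) : ∃ g, p = C (p.coeff 0) + C (p.coeff 1) * X
    + C (p.coeff 2) * X ^ 2 + C (p.coeff 3) * X ^ 3 + X ^ 4 * g := by
  have : X ^ 4 ∣ p - (C (p.coeff 0) + C (p.coeff 1) * X + C (p.coeff 2) * X ^ 2
      + C (p.coeff 3) * X ^ 3) := by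
    rw [X_pow_dvd_iff]
    intro d hd
    interval_cases d <;> simp [coeff_X, coeff_X_pow, coeff_C]
  obtain ⟨g, hg⟩ := this
  exact ⟨g, by rw [← hg]; ring⟩

/-- The polynomial is `((1 + X)^(m+1) - 1) / ((m + 1) X)`, and `(k + 1) C(m+1, k+1) = (m + 1) C(m,
k)`. -/
theorem coeff_slope (m k : ℕ) :
    (C ((m + 1 : ℕ) : ℝ)⁻¹ * ∑ j ∈ Finset.range (m + 1), (1 + X : ℝ[X]) ^ j).coeff k
      = (m.choose k : ℝ) / (k + 1) := by
  have h := mul_geom_sum (1 + X : ℝ[X]) (m + 1)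
  rw [add_sub_cancel_left] at h
  have h2 := congrArg (fun p : ℝ[X] => p.coeff (k + 1)) h
  simp only [coeff_X_mul, coeff_sub, coeff_one_add_X_pow, Polynomial.coeff_one] at h2
  rw [coeff_C_mul, h2]
  have h3 := Nat.add_one_mul_choose_eq m k
  have h4 : ((m + 1 : ℕ) : ℝ) * m.choose k = (m + 1).choose (k + 1) * (k + 1) := by
    exact_mod_cast h3
  have h5 : ((m + 1 : ℕ) : ℝ) ≠ 0 := by positivity
  rw [if_neg (by omega), sub_zero, eq_div_iff (by positivity), mul_assoc, ← h4]
  field_simp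

/-- The expansion of the scaled potential up to the fourth order in the scaling parameter. -/
theorem exists_scaledPolyAt_eq {ν : ℕ} (hν : 2 ≤ ν) (l : ℕ) : ∃ (a b : ℝ) (V₄ : ℝ[X][X]), ∀ s,
    scaledPolyAt ν l s = (X ^ 2 - C (2 * l + 1 : ℝ))
      + C s * (C (ν - 1 : ℝ) * (X ^ 3 - C (2 * l + 1 : ℝ) * X))
      + C s ^ 2 * (C ((7 * (ν - 1) ^ 2 - 4 * (ν - 1)) / 12 : ℝ) * X ^ 4
        - C ((2 * l + 1) * ((ν - 1) * (ν - 2) / 2) : ℝ) * X ^ 2)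
      + C s ^ 3 * (C a * X ^ 5 - C b * X ^ 3) + C s ^ 4 * V₄.eval (C s) := by
  obtain ⟨m, rfl⟩ : ∃ m, ν = m + 1 := ⟨ν - 1, by omega⟩
  obtain ⟨g, hg⟩ := exists_eq_taylor_four
    (C ((m + 1 : ℕ) : ℝ)⁻¹ * ∑ j ∈ Finset.range (m + 1), (1 + X : ℝ[X]) ^ j)
  obtain ⟨h, hh⟩ := exists_eq_taylor_four ((1 + X : ℝ[X]) ^ m)
  simp only [coeff_slope] at hg
  simp only [coeff_one_add_X_pow] at hh
  set f₁ : ℝ := (m.choose 1 : ℝ) / ((1 : ℕ) + 1) with hf₁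
  set f₂ : ℝ := (m.choose 2 : ℝ) / ((2 : ℕ) + 1) with hf₂
  set f₃ : ℝ := (m.choose 3 : ℝ) / ((3 : ℕ) + 1) with hf₃
  set b₂ : ℝ := (m.choose 2 : ℝ) with hb₂
  set b₃ : ℝ := (m.choose 3 : ℝ) with hb₃
  obtain ⟨c, hc⟩ : ∃ c : ℝ, c = 2 * l + 1 := ⟨_, rfl⟩
  -- `G` and `H` are the Taylor remainders after the substitution `t = s z`.
  obtain ⟨G, hG⟩ : ∃ G : ℝ[X][X], G = eval₂ (C.comp C) (C X * X) g := ⟨_, rfl⟩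
  obtain ⟨H, hH⟩ : ∃ H : ℝ[X][X], H = eval₂ (C.comp C) (C X * X) h := ⟨_, rfl⟩
  have hg' := fun s : ℝ => congrArg
    (fun p => ((eval₂RingHom (C.comp C) (C X * X : ℝ[X][X])) p).eval (C s)) hg
  have hh' := fun s : ℝ => congrArg
    (fun p => ((eval₂RingHom (C.comp C) (C X * X : ℝ[X][X])) p).eval (C s)) hh
  simp [eval₂_finsetSum, eval₂_pow, ← hG, ← hH, eval_finsetSum] at hg' hh'
  -- The cubic coefficients only need to exist: they will multiply odd moments, which are small, so
  -- their values never enter the result.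
  refine ⟨2 * f₃ + 2 * f₁ * f₂, c * b₃,
    C X ^ 6 * (2 * (1 + C (C f₁) * (C X * X) + C (C f₂) * (C X * X) ^ 2 + C (C f₃) * (C X * X) ^ 3)
      * G + (C X * X) ^ 4 * G ^ 2 + C (C (f₂ ^ 2 + 2 * f₁ * f₃)) + C (C (2 * f₂ * f₃)) * (C X * X)
      + C (C (f₃ ^ 2)) * (C X * X) ^ 2) - C (C c) * C X ^ 4 * H, fun s => ?_⟩
  -- Here `f₁ = m / 2` and `f₂ = m (m - 1) / 6`; the square of the slope has second coefficient `2
  -- f₂ + f₁²`.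
  have e1 : ((7 * (((m + 1 : ℕ) : ℝ) - 1) ^ 2 - 4 * (((m + 1 : ℕ) : ℝ) - 1)) / 12 : ℝ)
      = 2 * f₂ + f₁ ^ 2 := by
    rw [hf₂, hf₁, hb₂, Nat.cast_choose_two]; push_cast; simp; ring
  have e2 : ((m + 1 : ℕ) : ℝ) - 1 = 2 * f₁ := by rw [hf₁]; push_cast; simp; ring
  have e3 : ((2 * l + 1) * ((((m + 1 : ℕ) : ℝ) - 1) * (((m + 1 : ℕ) : ℝ) - 2) / 2) : ℝ)
      = c * b₂ := by
    rw [hb₂, Nat.cast_choose_two, hc]; push_cast; ring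
  have e4 : (m : ℝ[X]) = 2 * C f₁ := by
    rw [← C_ofNat, ← C_mul, ← e2]; simp
  have e5 : C c = C 2 * (l : ℝ[X]) + 1 := by rw [hc]; simp
  rw [e1, e3, e2, ← hc, scaledPolyAt, scaledPoly]
  simp [eval_finsetSum]
  rw [hg' s, hh' s, e4, ← e5, show (C 2 : ℝ[X]) = 2 from rfl]
  ring

/-- A family of polynomials that depends polynomially on a parameter. -/
def PolyFamily (F : ℝ → ℝ[X]) : Prop := ∃ G : ℝ[X][X], ∀ s, F s = G.eval (C s)

namespace PolyFamily
variable {F F' : ℝ → ℝ[X]}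

theorem const (p : ℝ[X]) : PolyFamily fun _ => p := ⟨C p, by simp⟩

theorem param : PolyFamily fun s => C s := ⟨X, by simp⟩

theorem add (h : PolyFamily F) (h' : PolyFamily F') : PolyFamily fun s => F s + F' s := by
  obtain ⟨G, hG⟩ := h
  obtain ⟨G', hG'⟩ := h'
  exact ⟨G + G', by simp [hG, hG']⟩

theorem mul (h : PolyFamily F) (h' : PolyFamily F') : PolyFamily fun s => F s * F' s := by
  obtain ⟨G, hG⟩ := h
  obtain ⟨G', hG'⟩ := h'
  exact ⟨G * G', by simp [hG, hG']⟩

theorem derivative (h : PolyFamily F) : PolyFamily fun s => derivative (F s) := by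
  obtain ⟨G, hG⟩ := h
  obtain ⟨G', h'⟩ : ∃ G' : ℝ[X][X], ∀ s : ℝ, (G.eval (C s)).derivative = G'.eval (C s) := by
    clear hG
    induction G using Polynomial.induction_on' with
    | add p q hp hq =>
      obtain ⟨p', hp⟩ := hp
      obtain ⟨q', hq⟩ := hq
      exact ⟨p' + q', by simp [hp, hq]⟩
    | monomial n a =>
      exact ⟨monomial n a.derivative, fun s => by
        rw [eval_monomial, eval_monomial, ← C_pow, derivative_mul, derivative_C]; ring⟩
  exact ⟨G', fun s => by rw [← h', ← hG]⟩

theorem exists_bound (h : PolyFamily F) : ∃ C, ∃ N : ℕ, 0 ≤ C ∧ ∀ s z, |s| ≤ 1 →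
    |(F s).eval z| ≤ C * (1 + |z|) ^ N := by
  obtain ⟨G, hG⟩ := h
  simp only [hG]
  clear hG
  have add : ∀ {f g : ℝ → ℝ → ℝ}, (∃ C, ∃ N : ℕ, 0 ≤ C ∧ ∀ s z, |s| ≤ 1 →
      |f s z| ≤ C * (1 + |z|) ^ N) → (∃ C, ∃ N : ℕ, 0 ≤ C ∧ ∀ s z, |s| ≤ 1 →
      |g s z| ≤ C * (1 + |z|) ^ N) → ∃ C, ∃ N : ℕ, 0 ≤ C ∧ ∀ s z, |s| ≤ 1 →
      |f s z + g s z| ≤ C * (1 + |z|) ^ N := by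
    rintro f g ⟨C, N, hC, hp⟩ ⟨C', N', hC', hq⟩
    refine ⟨C + C', N + N', by positivity, fun s z hs => ?_⟩
    have h1 : 1 ≤ 1 + |z| := by linarith [abs_nonneg z]
    calc _ ≤ C * (1 + |z|) ^ N + C' * (1 + |z|) ^ N' :=
          (abs_add_le _ _).trans (add_le_add (hp s z hs) (hq s z hs))
      _ ≤ C * (1 + |z|) ^ (N + N') + C' * (1 + |z|) ^ (N + N') := by gcongr <;> omega
      _ = _ := by ring
  induction G using Polynomial.induction_on' with
  | add p q hp hq => simpa only [eval_add] using add hp hq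
  | monomial n a =>
    induction a using Polynomial.induction_on' with
    | add p q hp hq => simpa only [map_add, eval_add] using add hp hq
    | monomial k a =>
      refine ⟨|a|, k, abs_nonneg a, fun s z hs => ?_⟩
      rw [eval_monomial, eval_mul, eval_monomial, eval_pow, eval_C, abs_mul, abs_mul, abs_pow,
        abs_pow]
      have h1 : |s| ^ n ≤ 1 := pow_le_one₀ (abs_nonneg s) hs
      calc _ ≤ |a| * |z| ^ k * 1 := by gcongr
        _ ≤ |a| * (1 + |z|) ^ k := by rw [mul_one]; gcongr; linarith

end PolyFamily

/-- Polynomials are polynomially bounded. -/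
theorem polyBdd_eval (p : ℝ[X]) : PolyBdd fun z => p.eval z := by
  obtain ⟨C, N, hC, h⟩ := (PolyFamily.const p).exists_bound
  exact ⟨C, N, hC, fun z => h 0 z (by simp)⟩

theorem integrable_eval_mul_sq (p : ℝ[X]) {w : ℝ → ℝ} (hc : Continuous w) (hd : ExpDecay w) :
    Integrable fun z => p.eval z * w z ^ 2 := by
  have := p.continuous
  simpa only [sq] using ((polyBdd_eval p).mul_expDecay (hd.mul hd)).integrable (by fun_prop)

open Classical in
/-- The expectation of a polynomial in the state with wave function `w`. -/
noncomputable def expectation (w : ℝ → ℝ) : ℝ[X] →ₗ[ℝ] ℝ :=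
  -- Additivity needs integrability; the zero functional elsewhere makes this a linear map for every
  -- `w`.
  if h : Continuous w ∧ ExpDecay w then
    { toFun := fun p => (∫ z, p.eval z * w z ^ 2) / ∫ z, w z ^ 2
      map_add' := fun p q => by
        rw [← add_div, ← integral_add (integrable_eval_mul_sq p h.1 h.2)
          (integrable_eval_mul_sq q h.1 h.2)]
        simp only [eval_add, add_mul]
      map_smul' := fun a p => by
        simp only [eval_smul, smul_eq_mul, mul_assoc, integral_const_mul, mul_div_assoc,
          RingHom.id_apply] }
  else 0

theorem expectation_apply {w : ℝ → ℝ} (hc : Continuous w) (hd : ExpDecay w) (p : ℝ[X]) :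
    expectation w p = (∫ z, p.eval z * w z ^ 2) / ∫ z, w z ^ 2 := by
  rw [expectation, dif_pos ⟨hc, hd⟩]; rfl

theorem expectation_C_mul (w : ℝ → ℝ) (a : ℝ) (p : ℝ[X]) :
    expectation w (C a * p) = a * expectation w p := by
  rw [← smul_eq_C_mul, map_smul, smul_eq_mul]

theorem expectation_one {G : ℝ → ℝ} (hG : Confining G) (hs : sin (totalAngle G) = 0) :
    expectation (leftSol G) 1 = 1 := by
  rw [expectation_apply (continuous_leftSol hG) (expDecay_leftSol hG hs)]
  simp [(integral_leftSol_sq_pos hG hs).ne']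

/-- The hypervirial theorem. -/
theorem expectation_virial {V : ℝ[X]} {E : ℝ} {G : ℝ → ℝ} (hV : ∀ z, G z = (V - C E).eval z)
    (hG : Confining G) (hs : sin (totalAngle G) = 0) (g : ℝ[X]) :
    expectation (leftSol G) (g * derivative V + 2 * derivative g * (V - C E)
      - C (1 / 2) * derivative (derivative (derivative g))) = 0 := by
  have hw := expDecay_leftSol hG hs
  have hw' := expDecay_leftSol' hG hs
  have cw := continuous_leftSol hG
  have cw' := continuous_leftSol' hG
  rw [expectation_apply cw hw]
  have dp := fun p : ℝ[X] => polyBdd_eval p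
  have cp := fun p : ℝ[X] => p.continuous
  set g₁ := derivative g with hg₁
  set g₂ := derivative g₁ with hg₂
  set g₃ := derivative g₂ with hg₃
  have hi := integrable_eval_mul_sq (g * derivative V + 2 * g₁ * (V - C E) - C (1 / 2) * g₃)
    cw hw
  -- With `w'' = (V - E) w`, the integrand is the derivative of `g ((V - E) w² - w'²) + g' w w' -
  -- g'' w² / 2`, which decays at both ends.
  have key := integral_eq_zero_of_hasDerivAt_of_integrable (f := fun z =>
    g.eval z * ((V - C E).eval z * (leftSol G z * leftSol G z) - leftSol' G z * leftSol' G z)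
      + g₁.eval z * (leftSol G z * leftSol' G z)
      + (-(C (1 / 2) * g₂).eval z) * (leftSol G z * leftSol G z)) (fun z => ?_) hi ?_
  · rw [key, zero_div]
  · have h1 := hasDerivAt_leftSol hG z
    have h2 := hasDerivAt_leftSol' hG z
    rw [hV] at h2
    have := (((g.hasDerivAt z).mul ((((V - C E).hasDerivAt z).mul (h1.mul h1)).sub
      (h2.mul h2))).add ((g₁.hasDerivAt z).mul (h1.mul h2))).add
      ((((C (1 / 2) * g₂).hasDerivAt z).neg).mul (h1.mul h1))
    refine this.congr_deriv ?_
    simp [← hg₁, ← hg₂, ← hg₃]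
    ring
  · have := cp g
    have := cp g₁
    have := cp (V - C E)
    have := cp (C (1 / 2) * g₂)
    refine ExpDecay.integrable ((((dp g).mul_expDecay (((dp _).mul_expDecay (hw.mul hw)).sub
      (hw'.mul hw'))).add ((dp g₁).mul_expDecay (hw.mul hw'))).add
      ((dp _).neg.mul_expDecay (hw.mul hw))) ?_
    fun_prop

end PerturbedOperator

/-! ### Scaled eigenvalues: limit, bounded moments, Hellmann–Feynman formula. -/

namespace PerturbedOperator
open Real Set SturmLiouville Polynomial

/-- The relations between the parameter `η`, the root `x₀` of `x₀^ν = ν η` and the scaling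
parameter `s`. -/
structure Scaling (ν : ℕ) (η x₀ s : ℝ) : Prop where
  pow : x₀ ^ ν = ν * η
  sq : s ^ 2 * x₀ ^ (ν + 1) = 1
  pos : 0 < s

namespace Scaling
variable {ν : ℕ} {η x₀ s : ℝ}

theorem ne_zero (h : Scaling ν η x₀ s) : x₀ ≠ 0 := by
  rintro rfl
  have := h.sq
  simp at this

theorem pow_pos (h : Scaling ν η x₀ s) (hν : 2 ≤ ν) : 0 < x₀ ^ (ν - 1) := by
  have h1 := h.sq
  have h2 : x₀ ^ (ν + 1) = x₀ ^ (ν - 1) * x₀ ^ 2 := by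
    rw [← pow_add]; congr 1; omega
  rw [h2] at h1
  have h3 : 0 < x₀ ^ 2 := by have := h.ne_zero; positivity
  by_contra! h4
  nlinarith [sq_nonneg s, mul_nonpos_of_nonpos_of_nonneg h4 h3.le,
    mul_nonneg (sq_nonneg s) (neg_nonneg.2 (mul_nonpos_of_nonpos_of_nonneg h4 h3.le))]

theorem kinetic (h : Scaling ν η x₀ s) (hν : 2 ≤ ν) (z : ℝ) :
    (η - (x₀ * (1 + s * z)) ^ ν / ν) ^ 2 = x₀ ^ (ν - 1) * (z * wellSlope ν (s * z)) ^ 2 := by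
  have h0 : (ν : ℝ) ≠ 0 := by exact_mod_cast (by omega : ν ≠ 0)
  have h1 := mul_wellSlope ν (s * z)
  have h2 : η = x₀ ^ ν / ν := by rw [h.pow]; field_simp
  have h3 : η - (x₀ * (1 + s * z)) ^ ν / ν = -(x₀ ^ ν * (s * z * wellSlope ν (s * z))) := by
    rw [h1, h2, mul_pow]; ring
  have h4 : (x₀ ^ ν) ^ 2 = x₀ ^ (ν - 1) * x₀ ^ (ν + 1) := by
    rw [← pow_mul, ← pow_add]; congr 1; omega
  rw [h3]
  linear_combination (s * z * wellSlope ν (s * z)) ^ 2 * h4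
    + x₀ ^ (ν - 1) * (z * wellSlope ν (s * z)) ^ 2 * h.sq

theorem pertQ_eq (h : Scaling ν η x₀ s) (hν : 2 ≤ ν) (l : ℕ) (z : ℝ) :
    pertQ ν l η 0 (x₀ * (1 + s * z)) = x₀ ^ (ν - 1) * scaledV ν l s z := by
  have : pertQ ν l η 0 (x₀ * (1 + s * z))
      = (η - (x₀ * (1 + s * z)) ^ ν / ν) ^ 2 - (2 * l + 1) * (x₀ * (1 + s * z)) ^ (ν - 1) := by
    simp [pertQ]
  rw [this, h.kinetic hν, scaledV, mul_pow x₀]; ring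

end Scaling

theorem exists_scaling {ν : ℕ} (hν : 2 ≤ ν) {s : ℝ} (hs : 0 < s) : ∃ η x₀, Scaling ν η x₀ s := by
  have h0 : (ν : ℝ) ≠ 0 := by exact_mod_cast (by omega : ν ≠ 0)
  refine ⟨((s ^ 2)⁻¹ ^ (((ν + 1 : ℕ) : ℝ)⁻¹)) ^ ν / ν, (s ^ 2)⁻¹ ^ (((ν + 1 : ℕ) : ℝ)⁻¹),
    by field_simp, ?_, hs⟩
  rw [rpow_inv_natCast_pow (by positivity) (by omega)]
  field_simp

/-- The bound `two_le_scaledV` handles spectral parameters up to `1` only. For arbitrary ones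
confinement is transferred from the unperturbed operator, as every `s > 0` arises from some `η`. -/
theorem confiningPair_scaledV {ν : ℕ} (hν : 2 ≤ ν) (l : ℕ) {s : ℝ} (hs : 0 < s) :
    ConfiningPair (fun _ => 1) (scaledV ν l s) where
  continuous_p := continuous_const
  continuous_q := continuous_scaledV_right ν l s
  pos := fun _ => one_pos
  confining := fun μ => by
    obtain ⟨η, x₀, h⟩ := exists_scaling hν hs
    have hX := h.pow_pos hν
    -- At this spectral parameter, confinement by `1` in `x` reads `x₀^(ν-1) ≤ x₀^(ν-1) (scaledV -
    -- μ)`, that is, confinement by `1` in `z`.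
    obtain ⟨R, hR0, hR⟩ := ((confiningPair_pert hν l η zero_mem_admissible).confining
      (x₀ ^ (ν - 1) * μ + x₀ ^ (ν - 1) - 1)).exists_radius
    refine Confining.of_forall (R := (R + |x₀|) / (|x₀| * s)) (continuous_scaledCoeff ν l s μ)
      fun z hz => ?_
    have hx0 := abs_pos.2 h.ne_zero
    rw [div_le_iff₀ (by positivity)] at hz
    have h1 : R ≤ |x₀ * (1 + s * z)| := by
      have h2 : |x₀ * (1 + s * z)| = |x₀ * s * z + x₀| := by ring_nf
      have h3 := abs_sub_abs_le_abs_sub (x₀ * s * z) (-x₀)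
      rw [abs_neg, sub_neg_eq_add, abs_mul, abs_mul, abs_of_pos hs] at h3
      rw [h2]; linarith
    have h2 := hR _ h1
    rw [pertP_zero, coeff_one, h.pertQ_eq hν] at h2
    rw [coeff_one]
    have h3 : x₀ ^ (ν - 1) * 1 ≤ x₀ ^ (ν - 1) * (scaledV ν l s z - μ) := by linarith
    exact le_of_mul_le_mul_left h3 hX

open Classical in
/-- The `l`-th eigenvalue of the scaled operator. -/
noncomputable def scaledEigenvalue (ν l : ℕ) (s : ℝ) : ℝ :=
  if h : ∃ E, totalAngle (scaledCoeff ν l s E) = (l + 1) * π then h.choose else 0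

/-- The coefficient of the scaled eigenvalue equation at the `l`-th eigenvalue. -/
noncomputable def scaledEigenCoeff (ν l : ℕ) (s : ℝ) : ℝ → ℝ :=
  scaledCoeff ν l s (scaledEigenvalue ν l s)

theorem totalAngle_scaledEigenCoeff {ν : ℕ} (hν : 2 ≤ ν) (l : ℕ) {s : ℝ} (hs : 0 < s) :
    totalAngle (scaledEigenCoeff ν l s) = (l + 1) * π := by
  have h : ∃ E, totalAngle (scaledCoeff ν l s E) = (l + 1) * π :=
    (confiningPair_scaledV hν l hs).exists_totalAngle_eq l
  rw [scaledEigenCoeff, scaledEigenvalue, dif_pos h]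
  exact h.choose_spec

theorem sin_totalAngle_scaledEigenCoeff {ν : ℕ} (hν : 2 ≤ ν) (l : ℕ) {s : ℝ} (hs : 0 < s) :
    sin (totalAngle (scaledEigenCoeff ν l s)) = 0 := by
  rw [totalAngle_scaledEigenCoeff hν l hs]; exact_mod_cast sin_nat_mul_pi (l + 1)

theorem confining_scaledEigenCoeff {ν : ℕ} (hν : 2 ≤ ν) (l : ℕ) {s : ℝ} (hs : 0 < s) :
    Confining (scaledEigenCoeff ν l s) :=
  (confiningPair_scaledV hν l hs).confining _

theorem scaledEigenCoeff_eq_eval (ν l : ℕ) (s z : ℝ) :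
    scaledEigenCoeff ν l s z = (scaledPolyAt ν l s - C (scaledEigenvalue ν l s)).eval z := by
  rw [scaledEigenCoeff, scaledCoeff_apply, eval_sub, eval_C, eval_scaledPolyAt]

theorem tendsto_scaledEigenvalue_zero {ν l : ℕ} (hν : 2 ≤ ν) (hl : 1 ≤ l) :
    Tendsto (scaledEigenvalue ν l) (𝓝[>] 0) (𝓝 0) := by
  refine tendsto_eigenvalue (p := fun _ _ => 1) (q := scaledV ν l) (t := (l + 1) * π)
    (eventually_nhdsWithin_of_forall fun s hs => confiningPair_scaledV hν l hs)
    (confiningPair_scaledV_zero hν l)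
    (eventually_nhdsWithin_of_forall fun s hs => totalAngle_scaledEigenCoeff hν l hs) ?_ ?_
  · have := scaledCoeff_zero hν l 0
    rw [scaledCoeff] at this
    rw [this, add_zero, totalAngle_osc_odd]
  · filter_upwards [Iio_mem_nhds (one_pos : (0 : ℝ) < 1)] with μ hμ
    exact (confinedTendsto_scaledCoeff hν hl (tendsto_nhdsWithin_of_tendsto_nhds tendsto_id)
      tendsto_const_nhds hμ).totalAngle

theorem continuousAt_scaledEigenvalue {ν l : ℕ} (hν : 2 ≤ ν) (hl : 1 ≤ l) {s : ℝ} (hs : 0 < s)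
    (h : scaledEigenvalue ν l s < 1) : ContinuousAt (scaledEigenvalue ν l) s := by
  refine tendsto_eigenvalue (p := fun _ _ => 1) (q := scaledV ν l) (t := (l + 1) * π)
    ?_ (confiningPair_scaledV hν l hs) ?_ (totalAngle_scaledEigenCoeff hν l hs) ?_
  · filter_upwards [Ioi_mem_nhds hs] with s hs using confiningPair_scaledV hν l hs
  · filter_upwards [Ioi_mem_nhds hs] with s hs using totalAngle_scaledEigenCoeff hν l hs
  · filter_upwards [Iio_mem_nhds h] with μ hμ
    exact (confinedTendsto_scaledCoeff hν hl tendsto_id tendsto_const_nhds hμ).totalAngle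

theorem confinedTendsto_scaledEigenCoeff_zero {ν l : ℕ} (hν : 2 ≤ ν) (hl : 1 ≤ l) :
    ConfinedTendsto (scaledEigenCoeff ν l) (𝓝[>] 0) (scaledCoeff ν l 0 0)
      (6 * ν * (2 * l + 3)) :=
  confinedTendsto_scaledCoeff hν hl (tendsto_nhdsWithin_of_tendsto_nhds tendsto_id)
    (tendsto_scaledEigenvalue_zero hν hl) one_pos

theorem confinedTendsto_scaledEigenCoeff {ν l : ℕ} (hν : 2 ≤ ν) (hl : 1 ≤ l) {s : ℝ} (hs : 0 < s)
    (h : scaledEigenvalue ν l s < 1) :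
    ConfinedTendsto (scaledEigenCoeff ν l) (𝓝 s) (scaledEigenCoeff ν l s)
      (6 * ν * (2 * l + 3)) :=
  confinedTendsto_scaledCoeff hν hl tendsto_id (continuousAt_scaledEigenvalue hν hl hs h) h

/-- The expectation of a polynomial in the `l`-th eigenstate of the scaled operator. -/
noncomputable def mean (ν l : ℕ) (s : ℝ) : ℝ[X] →ₗ[ℝ] ℝ :=
  expectation (leftSol (scaledEigenCoeff ν l s))

theorem mean_apply {ν : ℕ} (hν : 2 ≤ ν) (l : ℕ) {s : ℝ} (hs : 0 < s) (p : ℝ[X]) :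
    mean ν l s p = (∫ z, p.eval z * leftSol (scaledEigenCoeff ν l s) z ^ 2)
      / ∫ z, leftSol (scaledEigenCoeff ν l s) z ^ 2 :=
  expectation_apply (continuous_leftSol (confining_scaledEigenCoeff hν l hs))
    (expDecay_leftSol (confining_scaledEigenCoeff hν l hs)
      (sin_totalAngle_scaledEigenCoeff hν l hs)) p

theorem mean_C_mul (ν l : ℕ) (s a : ℝ) (p : ℝ[X]) : mean ν l s (C a * p) = a * mean ν l s p :=
  expectation_C_mul _ _ _

theorem mean_one {ν : ℕ} (hν : 2 ≤ ν) (l : ℕ) {s : ℝ} (hs : 0 < s) : mean ν l s 1 = 1 :=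
  expectation_one (confining_scaledEigenCoeff hν l hs) (sin_totalAngle_scaledEigenCoeff hν l hs)

theorem mean_virial {ν : ℕ} (hν : 2 ≤ ν) (l : ℕ) {s : ℝ} (hs : 0 < s) (g : ℝ[X]) :
    mean ν l s (g * derivative (scaledPolyAt ν l s)
      + 2 * derivative g * (scaledPolyAt ν l s - C (scaledEigenvalue ν l s))
      - C (1 / 2) * derivative (derivative (derivative g))) = 0 :=
  expectation_virial (scaledEigenCoeff_eq_eval ν l s) (confining_scaledEigenCoeff hν l hs)
    (sin_totalAngle_scaledEigenCoeff hν l hs) g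

/-- Expectations of polynomial families are bounded as the scaling parameter tends to `0`. -/
theorem isBigO_mean {ν l : ℕ} (hν : 2 ≤ ν) (hl : 1 ≤ l) {F : ℝ → ℝ[X]} (hF : PolyFamily F) :
    (fun s => mean ν l s (F s)) =O[𝓝[>] 0] fun _ => (1 : ℝ) := by
  have hpos : ∀ᶠ s : ℝ in 𝓝[>] 0, 0 < s := self_mem_nhdsWithin
  have hle : ∀ᶠ s : ℝ in 𝓝[>] 0, |s| ≤ 1 := by
    filter_upwards [Ioo_mem_nhdsGT (one_pos : (0 : ℝ) < 1)] with s hs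
    rw [abs_of_pos hs.1]; exact hs.2.le
  have hT := confinedTendsto_scaledEigenCoeff_zero hν hl
  obtain ⟨K, hK, hKb⟩ := hT.exists_exp_bound
    (hpos.mono fun s hs => sin_totalAngle_scaledEigenCoeff hν l hs)
  have hsq : ∀ᶠ s in 𝓝[>] 0, ∀ z, leftSol (scaledEigenCoeff ν l s) z ^ 2
      ≤ K ^ 2 * (1 + |z|) ^ 0 * exp (-|z|) := by
    filter_upwards [hKb] with s hs z
    have h1 : exp (-|z|) ≤ 1 := by simp
    calc _ = |leftSol (scaledEigenCoeff ν l s) z| ^ 2 := (sq_abs _).symm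
      _ ≤ (K * exp (-|z|)) ^ 2 := by gcongr; exact hs z
      _ = K ^ 2 * exp (-|z|) * exp (-|z|) := by ring
      _ ≤ K ^ 2 * 1 * exp (-|z|) := by gcongr
      _ = _ := by ring
  have h0 : 0 < ∫ z, leftSol (scaledCoeff ν l 0 0) z ^ 2 := by
    refine integral_leftSol_sq_pos hT.confining₀ ?_
    rw [scaledCoeff_zero hν, add_zero, sin_totalAngle_osc_odd]
  have hN : Tendsto (fun s => ∫ z, leftSol (scaledEigenCoeff ν l s) z ^ 2) (𝓝[>] 0)
      (𝓝 (∫ z, leftSol (scaledCoeff ν l 0 0) z ^ 2)) := by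
    refine tendsto_integral_filter_of_dominated_convergence
      (fun z => K ^ 2 * (1 + |z|) ^ 0 * exp (-|z|)) ?_ ?_
      (integrable_one_add_abs_pow_mul_exp _ 0) (Eventually.of_forall fun z => ?_)
    · filter_upwards [hpos] with s hs
      exact ((continuous_leftSol (confining_scaledEigenCoeff hν l hs)).pow 2).aestronglyMeasurable
    · filter_upwards [hsq] with s hs
      refine Eventually.of_forall fun z => ?_
      rw [Real.norm_eq_abs, abs_of_nonneg (sq_nonneg _)]; exact hs z
    · exact (hT.leftSol z).pow 2
  obtain ⟨B, N, hB, hb⟩ := hF.exists_bound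
  have hI := integrable_one_add_abs_pow_mul_exp (B * K ^ 2) N
  refine IsBigO.of_bound ((∫ z, B * K ^ 2 * (1 + |z|) ^ N * exp (-|z|))
    / ((∫ z, leftSol (scaledCoeff ν l 0 0) z ^ 2) / 2)) ?_
  filter_upwards [hpos, hle, hsq, (tendsto_order.1 hN).1 _ (half_lt_self h0)] with s h1 h2 h3 h4
  rw [mean_apply hν l h1, norm_one, mul_one, norm_div, Real.norm_eq_abs (∫ z, _ ^ 2),
    abs_of_pos ((half_pos h0).trans h4)]
  have h5 : ‖∫ z, (F s).eval z * leftSol (scaledEigenCoeff ν l s) z ^ 2‖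
      ≤ ∫ z, B * K ^ 2 * (1 + |z|) ^ N * exp (-|z|) := by
    refine norm_integral_le_of_norm_le hI (Eventually.of_forall fun z => ?_)
    rw [norm_mul, Real.norm_eq_abs, Real.norm_eq_abs,
      abs_of_nonneg (sq_nonneg (leftSol _ z))]
    calc _ ≤ B * (1 + |z|) ^ N * (K ^ 2 * (1 + |z|) ^ 0 * exp (-|z|)) :=
          mul_le_mul (hb s z h2) (h3 z) (sq_nonneg _) (by positivity)
      _ = _ := by ring
  have h6 := half_pos h0
  exact div_le_div₀ ((norm_nonneg _).trans h5) h5 h6 h4.le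

theorem eval_eval_C (P : ℝ[X][X]) (t z : ℝ) :
    (P.eval (C t)).eval z = (P.map (evalRingHom z)).eval t := by
  induction P using Polynomial.induction_on' with
  | add p q hp hq => simp [hp, hq]
  | monomial n a => simp

theorem hasDerivAt_eval_eval_C (P : ℝ[X][X]) (t z : ℝ) :
    HasDerivAt (fun t => (P.eval (C t)).eval z) ((P.derivative.eval (C t)).eval z) t := by
  simp only [eval_eval_C]
  rw [← derivative_map]
  exact Polynomial.hasDerivAt _ t

/-- The Hellmann–Feynman formula. -/
theorem hasDerivAt_scaledEigenvalue {ν l : ℕ} (hν : 2 ≤ ν) (hl : 1 ≤ l) {s : ℝ} (hs : 0 < s)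
    (hs1 : s < 1) (h : scaledEigenvalue ν l s < 1) :
    HasDerivAt (scaledEigenvalue ν l) (mean ν l s ((derivative (scaledPoly ν l)).eval (C s))) s := by
  rw [hasDerivAt_iff_tendsto_slope, mean_apply hν l hs]
  have hT := confinedTendsto_scaledEigenCoeff hν hl hs h
  have hpos : ∀ᶠ t : ℝ in 𝓝 s, 0 < t := Ioi_mem_nhds hs
  have hlt : ∀ᶠ t : ℝ in 𝓝 s, t < 1 := Iio_mem_nhds hs1
  obtain ⟨K, hK, hKb⟩ := hT.exists_exp_bound
    (hpos.mono fun s hs => sin_totalAngle_scaledEigenCoeff hν l hs)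
  have hw : ∀ t, 0 < t → Continuous (leftSol (scaledEigenCoeff ν l t)) := fun t ht =>
    continuous_leftSol (confining_scaledEigenCoeff hν l ht)
  obtain ⟨B, N, hB, hb⟩ := PolyFamily.exists_bound
    (F := fun s => (derivative (scaledPoly ν l)).eval (C s)) ⟨_, fun _ => rfl⟩
  let D : ℝ → ℝ → ℝ := fun t z => slope (fun t => (scaledPolyAt ν l t).eval z) s t
  have hDc : ∀ t, Continuous (D t) := fun t => by
    have h1 := (scaledPolyAt ν l t).continuous
    have h2 := (scaledPolyAt ν l s).continuous
    simp only [D, slope_def_field]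
    fun_prop
  have hDb : ∀ t ∈ Ioo (0 : ℝ) 1, ∀ z, |D t z| ≤ B * (1 + |z|) ^ N := fun t ht z => by
    have h1 := (convex_Icc (-1 : ℝ) 1).norm_image_sub_le_of_norm_hasDerivWithin_le
      (f := fun t => (scaledPolyAt ν l t).eval z)
      (f' := fun t => ((derivative (scaledPoly ν l)).eval (C t)).eval z)
      (C := B * (1 + |z|) ^ N) (x := s) (y := t)
      (fun t _ => (hasDerivAt_eval_eval_C (scaledPoly ν l) t z).hasDerivWithinAt)
      (fun t ht => hb t z (abs_le.2 ht)) ⟨by linarith, hs1.le⟩ ⟨by linarith [ht.1], ht.2.le⟩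
    simp only [D, slope_def_field, abs_div]
    exact div_le_of_le_mul₀ (abs_nonneg _) (by positivity) h1
  -- One dominated convergence argument serves both numerator and denominator of the difference
  -- quotient.
  have hlim : ∀ {g : ℝ → ℝ → ℝ} {g₀ : ℝ → ℝ} {B : ℝ} {N : ℕ}, 0 ≤ B → (∀ t, Continuous (g t)) →
      (∀ t ∈ Ioo (0 : ℝ) 1, ∀ z, |g t z| ≤ B * (1 + |z|) ^ N) →
      (∀ z, Tendsto (fun t => g t z) (𝓝[≠] s) (𝓝 (g₀ z))) →
      Tendsto (fun t => ∫ z, g t z * (leftSol (scaledEigenCoeff ν l s) z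
        * leftSol (scaledEigenCoeff ν l t) z)) (𝓝[≠] s)
        (𝓝 (∫ z, g₀ z * leftSol (scaledEigenCoeff ν l s) z ^ 2)) := by
    intro g g₀ B N hB hc hb hlim
    refine tendsto_integral_filter_of_dominated_convergence
      (fun z => B * K ^ 2 * (1 + |z|) ^ N * exp (-|z|)) ?_ ?_
      (integrable_one_add_abs_pow_mul_exp _ N) (Eventually.of_forall fun z => ?_)
    · filter_upwards [nhdsWithin_le_nhds hpos] with t ht
      exact ((hc t).mul ((hw s hs).mul (hw t ht))).aestronglyMeasurable
    · filter_upwards [nhdsWithin_le_nhds hpos, nhdsWithin_le_nhds hlt, nhdsWithin_le_nhds hKb]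
        with t h1 h2 h3
      refine Eventually.of_forall fun z => ?_
      have e1 : |leftSol (scaledEigenCoeff ν l t) z| ≤ K :=
        (h3 z).trans (mul_le_of_le_one_right hK.le (by simp))
      rw [norm_mul, norm_mul, Real.norm_eq_abs, Real.norm_eq_abs, Real.norm_eq_abs]
      calc _ ≤ B * (1 + |z|) ^ N * (K * exp (-|z|) * K) := by
            gcongr
            · exact hb t ⟨h1, h2⟩ z
            · exact hKb.self_of_nhds z
        _ = _ := by ring
    · rw [sq]
      exact (hlim z).mul (tendsto_const_nhds.mul
        ((hT.leftSol z).mono_left nhdsWithin_le_nhds))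
  have h1 := hlim hB hDc hDb (g₀ := fun z => ((derivative (scaledPoly ν l)).eval (C s)).eval z)
    fun z => (hasDerivAt_iff_tendsto_slope.1 (hasDerivAt_eval_eval_C (scaledPoly ν l) s z))
  have h2 := hlim (g := fun _ _ => 1) (g₀ := fun _ => 1) (B := 1) (N := 0) one_pos.le
    (fun _ => continuous_const) (fun _ _ _ => by simp) fun z => tendsto_const_nhds
  simp only [one_mul] at h2
  have h0 := integral_leftSol_sq_pos (confining_scaledEigenCoeff hν l hs)
    (sin_totalAngle_scaledEigenCoeff hν l hs)
  refine (h1.div h2 h0.ne').congr' ?_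
  filter_upwards [nhdsWithin_le_nhds hpos, self_mem_nhdsWithin, (tendsto_order.1 h2).1 0 h0]
    with t ht hne h3
  rw [Pi.div_apply, div_eq_iff h3.ne']
  have hG : ∀ t, PolyBdd (scaledEigenCoeff ν l t) := fun t => by
    simp only [funext fun z => scaledEigenCoeff_eq_eval ν l t z]
    exact polyBdd_eval _
  -- Orthogonality says that the slope of the eigenvalue times the overlap equals the integral of
  -- the slope of the potential against the same product of eigenfunctions.
  have h4 := integral_coeff_sub_mul_eq_zero (confining_scaledEigenCoeff hν l hs)
    (confining_scaledEigenCoeff hν l ht) (sin_totalAngle_scaledEigenCoeff hν l hs)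
    (sin_totalAngle_scaledEigenCoeff hν l ht) (hG s) (hG t)
  have hd : ∀ t, 0 < t → ExpDecay (leftSol (scaledEigenCoeff ν l t)) := fun t ht =>
    expDecay_leftSol (confining_scaledEigenCoeff hν l ht) (sin_totalAngle_scaledEigenCoeff hν l ht)
  have hi1 : Integrable fun z => (t - s)⁻¹ * ((scaledEigenCoeff ν l t z - scaledEigenCoeff ν l s z)
      * (leftSol (scaledEigenCoeff ν l s) z * leftSol (scaledEigenCoeff ν l t) z)) := by
    refine Integrable.const_mul ?_ _
    refine (((hG t).sub (hG s)).mul_expDecay ((hd s hs).mul (hd t ht))).integrable ?_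
    have := hw s hs
    have := hw t ht
    have := (confining_scaledEigenCoeff hν l ht).continuous
    have := (confining_scaledEigenCoeff hν l hs).continuous
    fun_prop
  have hi2 : Integrable fun z => slope (scaledEigenvalue ν l) s t *
      (leftSol (scaledEigenCoeff ν l s) z * leftSol (scaledEigenCoeff ν l t) z) :=
    (((hd s hs).mul (hd t ht)).integrable ((hw s hs).mul (hw t ht))).const_mul _
  rw [← integral_const_mul]
  have h5 := integral_add hi1 hi2
  rw [integral_const_mul, h4, mul_zero, zero_add] at h5
  rw [← h5]
  congr 1
  funext z
  simp only [D, slope_def_field, scaledEigenCoeff_eq_eval, eval_sub, eval_C]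
  ring

end PerturbedOperator

/-! ### Orders in `s`, the moment recursion and the expansion of the eigenvalue. -/

namespace PerturbedOperator
open Real Set SturmLiouville Polynomial

/-- The function is `O(s^k)` as `s` tends to `0` from the right. -/
def IsOrder (k : ℕ) (f : ℝ → ℝ) : Prop := f =O[𝓝[>] 0] fun s => s ^ k

namespace IsOrder
variable {j k : ℕ} {f g : ℝ → ℝ}

theorem add (hf : IsOrder k f) (hg : IsOrder k g) : IsOrder k fun s => f s + g s :=
  IsBigO.add hf hg

theorem const_mul (c : ℝ) (hf : IsOrder k f) : IsOrder k fun s => c * f s :=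
  IsBigO.const_mul_left hf c

theorem sub (hf : IsOrder k f) (hg : IsOrder k g) : IsOrder k fun s => f s - g s :=
  IsBigO.sub hf hg

theorem mul (hf : IsOrder j f) (hg : IsOrder k g) : IsOrder (j + k) fun s => f s * g s := by
  simpa only [IsOrder, pow_add] using IsBigO.mul hf hg

theorem pow_mul (j : ℕ) (hf : IsOrder k f) : IsOrder (j + k) fun s => s ^ j * f s :=
  IsOrder.mul (f := fun s => s ^ j) (isBigO_refl _ _) hf

theorem mono (hf : IsOrder k f) (h : j ≤ k) : IsOrder j f := by
  refine IsBigO.trans hf (IsBigO.of_bound 1 ?_)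
  filter_upwards [Ioo_mem_nhdsGT (one_pos : (0 : ℝ) < 1)] with s hs
  rw [one_mul, norm_pow, norm_pow, Real.norm_eq_abs, abs_of_pos hs.1]
  exact pow_le_pow_of_le_one hs.1.le hs.2.le h

theorem const (c : ℝ) : IsOrder 0 fun _ => c := by
  simpa [IsOrder] using isBigO_const_const c (one_ne_zero : (1 : ℝ) ≠ 0) (𝓝[>] (0 : ℝ))

theorem congr (hf : IsOrder k f) (h : ∀ᶠ s in 𝓝[>] 0, f s = g s) : IsOrder k g :=
  IsBigO.congr' hf h EventuallyEq.rfl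

/-- The mean value inequality on `[t, s]` followed by `t → 0`; the limit of `f` at `0` replaces a
value there. -/
theorem of_hasDerivAt {f' : ℝ → ℝ} (hf : ∀ᶠ s in 𝓝[>] 0, HasDerivAt f (f' s) s)
    (hf' : IsOrder k f') (h0 : Tendsto f (𝓝[>] 0) (𝓝 0)) : IsOrder (k + 1) f := by
  obtain ⟨C, hC⟩ := IsBigO.bound hf'
  obtain ⟨δ, hδ, hsub⟩ := mem_nhdsGT_iff_exists_Ioo_subset.1 (hf.and hC)
  rw [mem_Ioi] at hδ
  refine IsBigO.of_bound C ?_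
  filter_upwards [Ioo_mem_nhdsGT hδ] with s hs
  have hC0 : 0 ≤ C := by
    have h1 := (hsub hs).2
    have h2 : 0 < ‖s ^ k‖ := norm_pos_iff.2 (pow_ne_zero _ hs.1.ne')
    by_contra! h3
    nlinarith [norm_nonneg (f' s)]
  have key : ∀ᶠ t in 𝓝[>] 0, ‖f s - f t‖ ≤ C * s ^ k * s := by
    filter_upwards [Ioo_mem_nhdsGT hs.1] with t ht
    have h1 := (convex_Icc t s).norm_image_sub_le_of_norm_hasDerivWithin_le
      (f := f) (f' := f') (C := C * s ^ k) (x := t) (y := s)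
      (fun x hx => (hsub ⟨ht.1.trans_le hx.1, hx.2.trans_lt hs.2⟩).1.hasDerivWithinAt)
      (fun x hx => ?_) ⟨le_rfl, ht.2.le⟩ ⟨ht.2.le, le_rfl⟩
    · refine h1.trans ?_
      rw [Real.norm_eq_abs, abs_of_pos (by linarith [ht.2])]
      have := pow_nonneg hs.1.le k
      gcongr
      linarith [ht.1]
    · refine (hsub ⟨ht.1.trans_le hx.1, hx.2.trans_lt hs.2⟩).2.trans ?_
      have hx0 := ht.1.le.trans hx.1
      rw [norm_pow, Real.norm_eq_abs, abs_of_nonneg hx0]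
      gcongr
      exact hx.2
  have h2 := le_of_tendsto ((tendsto_const_nhds.sub h0).norm) key
  rw [sub_zero] at h2
  rw [norm_pow, Real.norm_eq_abs s, abs_of_pos hs.1, pow_succ, ← mul_assoc]
  exact h2

end IsOrder

theorem isOrder_mean {ν l : ℕ} (hν : 2 ≤ ν) (hl : 1 ≤ l) {F : ℝ → ℝ[X]} (hF : PolyFamily F) :
    IsOrder 0 fun s => mean ν l s (F s) := by
  simpa [IsOrder] using isBigO_mean hν hl hF

theorem PolyFamily.X_pow_virial {U : ℝ → ℝ[X]} (hU : PolyFamily U) (n : ℕ) :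
    PolyFamily fun s => X ^ n * Polynomial.derivative (U s) + C (2 * n : ℝ) * X ^ (n - 1) * U s :=
  ((PolyFamily.const _).mul hU.derivative).add ((PolyFamily.const _).mul hU)

/-- The recursion for the moments of the eigenstate. -/
theorem moment_recursion {ν l : ℕ} (hν : 2 ≤ ν) {m c A B s : ℝ} {U : ℝ → ℝ[X]}
    (hV : ∀ s, scaledPolyAt ν l s = (X ^ 2 - C c) + C s * (C m * (X ^ 3 - C c * X))
      + C s ^ 2 * (C A * X ^ 4 - C B * X ^ 2) + C s ^ 3 * U s) (hs : 0 < s) {n : ℕ} (hn : n ≤ 4) :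
    (2 * n + 2) * mean ν l s (X ^ (n + 1))
      - 2 * n * (c + scaledEigenvalue ν l s) * mean ν l s (X ^ (n - 1))
      - n * (n - 1) * (n - 2) / 2 * mean ν l s (X ^ (n - 3))
      + s * (m * ((2 * n + 3) * mean ν l s (X ^ (n + 2)) - (2 * n + 1) * c * mean ν l s (X ^ n)))
      + s ^ 2 * ((2 * n + 4) * A * mean ν l s (X ^ (n + 3))
        - (2 * n + 2) * B * mean ν l s (X ^ (n + 1)))
      + s ^ 3 * mean ν l s (X ^ n * derivative (U s) + C (2 * n : ℝ) * X ^ (n - 1) * U s) = 0 := by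
  obtain ⟨E, hE⟩ : ∃ E, E = scaledEigenvalue ν l s := ⟨_, rfl⟩
  rw [← mean_virial hν l hs (X ^ n), hV s, ← hE]
  -- The truncated exponents `n - 1` and `n - 3` are harmless: they truncate only when their
  -- coefficients `2 n` and `n (n - 1)(n - 2)` vanish.
  have key : X ^ n * derivative ((X ^ 2 - C c) + C s * (C m * (X ^ 3 - C c * X))
      + C s ^ 2 * (C A * X ^ 4 - C B * X ^ 2) + C s ^ 3 * U s)
      + 2 * derivative (X ^ n) * ((X ^ 2 - C c) + C s * (C m * (X ^ 3 - C c * X))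
      + C s ^ 2 * (C A * X ^ 4 - C B * X ^ 2) + C s ^ 3 * U s - C E)
      - C (1 / 2) * derivative (derivative (derivative (X ^ n)))
      = C (2 * n + 2 : ℝ) * X ^ (n + 1) + C (-(2 * n * (c + E))) * X ^ (n - 1)
        + C (-(n * (n - 1) * (n - 2) / 2 : ℝ)) * X ^ (n - 3)
        + C (s * m * (2 * n + 3)) * X ^ (n + 2) + C (-(s * m * (2 * n + 1) * c)) * X ^ n
        + C (s ^ 2 * (2 * n + 4) * A) * X ^ (n + 3) + C (-(s ^ 2 * (2 * n + 2) * B)) * X ^ (n + 1)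
        + C (s ^ 3) * (X ^ n * derivative (U s) + C (2 * n : ℝ) * X ^ (n - 1) * U s) := by
    have hC : ∀ k, derivative (C s ^ k) = 0 := fun k => by rw [← C_pow, derivative_C]
    apply Polynomial.funext
    intro z
    interval_cases n <;>
      simp [hC] <;> ring
  rw [key]
  generalize X ^ n * derivative (U s) + C (2 * n : ℝ) * X ^ (n - 1) * U s = W
  simp only [LinearMap.map_add, mean_C_mul]
  ring

theorem eval_derivative_scaledPoly {ν l : ℕ} {m c A B a b : ℝ} {V₄ : ℝ[X][X]}
    (hV : ∀ s, scaledPolyAt ν l s = (X ^ 2 - C c) + C s * (C m * (X ^ 3 - C c * X))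
      + C s ^ 2 * (C A * X ^ 4 - C B * X ^ 2) + C s ^ 3 * (C a * X ^ 5 - C b * X ^ 3)
      + C s ^ 4 * V₄.eval (C s)) (s : ℝ) :
    (derivative (scaledPoly ν l)).eval (C s) = C m * X ^ 3 + C (-(m * c)) * X
      + C (2 * s * A) * X ^ 4 + C (-(2 * s * B)) * X ^ 2
      + C (3 * s ^ 2 * a) * X ^ 5 + C (-(3 * s ^ 2 * b)) * X ^ 3
      + C (s ^ 3) * (4 * V₄.eval (C s) + C s * (derivative V₄).eval (C s)) := by
  have h : scaledPoly ν l = C (X ^ 2 - C c) + X * C (C m * (X ^ 3 - C c * X))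
      + X ^ 2 * C (C A * X ^ 4 - C B * X ^ 2) + X ^ 3 * C (C a * X ^ 5 - C b * X ^ 3)
      + X ^ 4 * V₄ := by
    -- Polynomials over `ℝ[X]` that agree at the infinitely many constants `C s` are equal.
    refine eq_of_infinite_eval_eq _ _ ((Set.infinite_range_of_injective C_injective).mono ?_)
    rintro _ ⟨s, rfl⟩
    have := hV s
    rw [scaledPolyAt] at this
    simp only [mem_ofPred_eq, this, eval_add, eval_mul, eval_C, eval_X, eval_pow]
  have hC : ∀ k, derivative ((C X : ℝ[X][X]) ^ k) = 0 := fun k => by rw [← C_pow, derivative_C]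
  rw [h]
  apply Polynomial.funext
  intro z
  simp [hC]
  ring

/-- The expansions of the eigenvalue and of the first moment in the scaling parameter. -/
theorem isOrder_scaledEigenvalue {ν l : ℕ} (hν : 2 ≤ ν) (hl : 1 ≤ l) :
    IsOrder 1 (fun s => mean ν l s X) ∧
    IsOrder 2 (fun s => mean ν l s (X ^ 2) - (2 * l + 1) / 2) ∧
    IsOrder 1 (fun s => mean ν l s (X ^ 3)) ∧
    IsOrder 4 (fun s => scaledEigenvalue ν l s - (ν - 1) * l * (l + 1) / 2 * s ^ 2) := by
  obtain ⟨a, b, V₄, hV⟩ := exists_scaledPolyAt_eq hν l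
  obtain ⟨c, hc⟩ : ∃ c : ℝ, c = 2 * l + 1 := ⟨_, rfl⟩
  obtain ⟨m, hm⟩ : ∃ m : ℝ, m = ν - 1 := ⟨_, rfl⟩
  obtain ⟨A, hA⟩ : ∃ A : ℝ, A = (7 * m ^ 2 - 4 * m) / 12 := ⟨_, rfl⟩
  obtain ⟨B, hB⟩ : ∃ B : ℝ, B = c * (m * (m - 1) / 2) := ⟨_, rfl⟩
  have hB' : c * (m * ((ν : ℝ) - 2) / 2) = B := by rw [hB, hm]; ring
  rw [← hm, ← hc, ← hA, hB'] at hV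
  have hpos : ∀ᶠ s : ℝ in 𝓝[>] 0, 0 < s := self_mem_nhdsWithin
  have hU : PolyFamily fun s => C a * X ^ 5 - C b * X ^ 3 + C s * V₄.eval (C s) :=
    (PolyFamily.const _).add (PolyFamily.param.mul ⟨V₄, fun _ => rfl⟩)
  have hrec := fun {s : ℝ} (hs : 0 < s) {n : ℕ} (hn : n ≤ 4) =>
    moment_recursion (m := m) (c := c) (A := A) (B := B) (U := fun s => C a * X ^ 5 - C b * X ^ 3 + C s * V₄.eval (C s)) hν
      (fun s => by rw [hV s]; ring) hs hn
  have hderiv := eval_derivative_scaledPoly hV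
  have hD : ∀ᶠ s in 𝓝[>] 0, HasDerivAt (scaledEigenvalue ν l)
      (mean ν l s ((derivative (scaledPoly ν l)).eval (C s))) s := by
    filter_upwards [Ioo_mem_nhdsGT (one_pos : (0 : ℝ) < 1),
      (tendsto_order.1 (tendsto_scaledEigenvalue_zero hν hl)).2 1 one_pos] with s hs h1
    exact hasDerivAt_scaledEigenvalue hν hl hs.1 hs.2 h1
  have hE0 := tendsto_scaledEigenvalue_zero hν hl
  obtain ⟨E, hE⟩ : ∃ E, E = scaledEigenvalue ν l := ⟨_, rfl⟩
  obtain ⟨Z, hZ⟩ : ∃ Z : ℕ → ℝ → ℝ, Z = fun (k : ℕ) s => mean ν l s (X ^ k) := ⟨_, rfl⟩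
  obtain ⟨R, hR⟩ : ∃ R : ℕ → ℝ → ℝ, R = fun (n : ℕ) s => mean ν l s (X ^ n * derivative
    ((C a * X ^ 5 - C b * X ^ 3 + C s * V₄.eval (C s) : ℝ[X])) + C (2 * n : ℝ) * X ^ (n - 1)
    * (C a * X ^ 5 - C b * X ^ 3 + C s * V₄.eval (C s))) := ⟨_, rfl⟩
  obtain ⟨T, hT⟩ : ∃ T : ℝ → ℝ, T = fun s => mean ν l s
    (4 * V₄.eval (C s) + C s * (derivative V₄).eval (C s)) := ⟨_, rfl⟩
  have oZ : ∀ k, IsOrder 0 (Z k) := fun k => by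
    rw [hZ]; exact isOrder_mean hν hl (PolyFamily.const _)
  have oR : ∀ n, IsOrder 0 (R n) := fun n => by
    rw [hR]; exact isOrder_mean hν hl (hU.X_pow_virial n)
  have oT : IsOrder 0 T := by
    rw [hT]
    exact isOrder_mean hν hl (((PolyFamily.const 4).mul ⟨V₄, fun _ => rfl⟩).add
      (PolyFamily.param.mul ⟨_, fun _ => rfl⟩))
  have hrec' : ∀ n ≤ 4, ∀ s, 0 < s → (2 * n + 2) * Z (n + 1) s
      - 2 * n * (c + E s) * Z (n - 1) s - n * (n - 1) * (n - 2) / 2 * Z (n - 3) s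
      + s * (m * ((2 * n + 3) * Z (n + 2) s - (2 * n + 1) * c * Z n s))
      + s ^ 2 * ((2 * n + 4) * A * Z (n + 3) s - (2 * n + 2) * B * Z (n + 1) s)
      + s ^ 3 * R n s = 0 := fun n hn s hs => by
    rw [hZ, hE, hR]; exact hrec hs hn
  have hD' : ∀ᶠ s in 𝓝[>] 0, HasDerivAt E (m * (Z 3 s - c * Z 1 s)
      + 2 * s * (A * Z 4 s - B * Z 2 s) + 3 * s ^ 2 * (a * Z 5 s - b * Z 3 s) + s ^ 3 * T s) s := by
    filter_upwards [hD] with s hs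
    rw [hE, hZ, hT]
    refine hs.congr_deriv ?_
    rw [hderiv]
    simp only [map_add, mean_C_mul, pow_one]
    ring
  have hZ0 : ∀ s, 0 < s → Z 0 s = 1 := fun s hs => by
    rw [hZ]; simpa using mean_one hν l hs
  have hZ1 : Z 1 = fun s => mean ν l s X := by rw [hZ]; simp
  have hZ2 : Z 2 = fun s => mean ν l s (X ^ 2) := by rw [hZ]
  have hZ3 : Z 3 = fun s => mean ν l s (X ^ 3) := by rw [hZ]
  rw [← hE] at hE0
  rw [← hE, ← hZ1, ← hc, ← hm, ← hZ3]
  simp only [← congrFun hZ2]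
  clear hV hU hrec hderiv hD hE hZ hR hT hZ1 hZ2 hZ3
  have r0 := fun s hs => hrec' 0 (by norm_num) s hs
  have r1 := fun s hs => hrec' 1 (by norm_num) s hs
  have r2 := fun s hs => hrec' 2 (by norm_num) s hs
  have r3 := fun s hs => hrec' 3 (by norm_num) s hs
  have r4 := fun s hs => hrec' 4 (by norm_num) s hs
  norm_num at r0 r1 r2 r3 r4
  clear hrec'
  have oE : IsOrder 0 E := by
    have := hE0.isBigO_one ℝ
    simpa [IsOrder] using this
  -- `s² t n` collects everything in the `n`-th recursion beyond first order; in the first pass only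
  -- boundedness of `t n` counts.
  obtain ⟨t, ht⟩ : ∃ t : ℕ → ℝ → ℝ, t = fun n s => (2 * n + 4) * A * Z (n + 3) s
      - (2 * n + 2) * B * Z (n + 1) s + s ^ 1 * R n s := ⟨_, rfl⟩
  have ot : ∀ n, IsOrder 0 (t n) := fun n => by
    rw [ht]
    exact (((oZ _).const_mul _).sub ((oZ _).const_mul _)).add (((oR n).pow_mul 1).mono (by simp))
  -- The odd moments are of first order.
  have o1 : IsOrder 1 (Z 1) := by
    refine IsOrder.congr (f := fun s => (-1 / 2) * (s ^ 1 * (m * (3 * Z 2 s - c * Z 0 s)))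
      + (-1 / 2) * (s ^ 2 * t 0 s)) ((((((oZ 2).const_mul 3).sub ((oZ 0).const_mul c)).const_mul
      m).pow_mul 1).const_mul _ |>.add ((((ot 0).pow_mul 2).mono (by norm_num)).const_mul _)) ?_
    filter_upwards [hpos] with s hs
    rw [ht]
    push_cast
    linear_combination (-1 / 2) * r0 s hs
  have o3 : IsOrder 1 (Z 3) := by
    refine IsOrder.congr (f := fun s => (4 * c / 6) * Z 1 s + (4 / 6) * (E s * Z 1 s)
      + (-1 / 6) * (s ^ 1 * (m * (7 * Z 4 s - 5 * c * Z 2 s))) + (-1 / 6) * (s ^ 2 * t 2 s))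
      ((((o1.const_mul _).add ((oE.mul o1).const_mul _)).add
      ((((((oZ 4).const_mul 7).sub ((oZ 2).const_mul (5 * c))).const_mul m).pow_mul 1).const_mul
      _)).add ((((ot 2).pow_mul 2).mono (by norm_num)).const_mul _)) ?_
    filter_upwards [hpos] with s hs
    rw [ht]
    push_cast
    linear_combination (-1 / 6) * r2 s hs
  have o5 : IsOrder 1 (Z 5) := by
    refine IsOrder.congr (f := fun s => (8 * c / 10) * Z 3 s + (8 / 10) * (E s * Z 3 s)
      + (12 / 10) * Z 1 s
      + (-1 / 10) * (s ^ 1 * (m * (11 * Z 6 s - 9 * c * Z 4 s))) + (-1 / 10) * (s ^ 2 * t 4 s))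
      (((((o3.const_mul _).add ((oE.mul o3).const_mul _)).add (o1.const_mul _)).add
      ((((((oZ 6).const_mul 11).sub ((oZ 4).const_mul (9 * c))).const_mul m).pow_mul 1).const_mul
      _)).add ((((ot 4).pow_mul 2).mono (by norm_num)).const_mul _)) ?_
    filter_upwards [hpos] with s hs
    rw [ht]
    push_cast
    linear_combination (-1 / 10) * r4 s hs
  -- With odd moments of order `s`, every term of the Hellmann–Feynman formula is `O(s)`, and
  -- integration gains one order.
  have oE2 : IsOrder 2 E := by
    refine IsOrder.of_hasDerivAt (k := 1) hD' ?_ hE0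
    refine IsOrder.congr (f := fun s => m * (Z 3 s - c * Z 1 s)
      + s ^ 1 * (2 * (A * Z 4 s - B * Z 2 s)) + s ^ 2 * (3 * (a * Z 5 s - b * Z 3 s))
      + s ^ 3 * T s) (((((o3.sub (o1.const_mul c)).const_mul m).add
      (((((oZ 4).const_mul A).sub ((oZ 2).const_mul B)).const_mul 2).pow_mul 1)).add
      ((((((oZ 5).const_mul a).sub ((oZ 3).const_mul b)).const_mul 3).pow_mul 2).mono
      (by norm_num))).add ((oT.pow_mul 3).mono (by norm_num))) ?_
    exact Eventually.of_forall fun s => by ring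
  -- The even moments up to the second order.
  have o2 : IsOrder 2 fun s => Z 2 s - c / 2 := by
    refine IsOrder.congr (f := fun s => (1 / 2) * E s
      + (-1 / 4) * (s ^ 1 * (m * (5 * Z 3 s - 3 * c * Z 1 s))) + (-1 / 4) * (s ^ 2 * t 1 s))
      (((oE2.const_mul _).add (((((o3.const_mul 5).sub (o1.const_mul (3 * c))).const_mul
      m).pow_mul 1).const_mul _)).add (((ot 1).pow_mul 2).const_mul _)) ?_
    filter_upwards [hpos] with s hs
    have h0 := hZ0 s hs
    have := r1 s hs
    rw [h0] at this
    rw [ht]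
    push_cast
    linear_combination (-1 / 4) * this
  have o4 : IsOrder 2 fun s => Z 4 s - 3 * (c ^ 2 + 1) / 8 := by
    refine IsOrder.congr (f := fun s => (6 * c / 8) * (Z 2 s - c / 2) + (6 / 8) * (E s * Z 2 s)
      + (-1 / 8) * (s ^ 1 * (m * (9 * Z 5 s - 7 * c * Z 3 s))) + (-1 / 8) * (s ^ 2 * t 3 s))
      ((((o2.const_mul _).add ((oE2.mul (oZ 2)).const_mul _)).add
      (((((o5.const_mul 9).sub (o3.const_mul (7 * c))).const_mul m).pow_mul 1).const_mul
      _)).add (((ot 3).pow_mul 2).const_mul _)) ?_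
    filter_upwards [hpos] with s hs
    have h0 := hZ0 s hs
    have := r3 s hs
    rw [h0] at this
    rw [ht]
    push_cast
    linear_combination (-1 / 8) * this
  -- The odd moments up to the third order.
  have o1' : IsOrder 3 fun s => Z 1 s + m * c / 4 * s := by
    refine IsOrder.congr (f := fun s => (-1 / 2) * (s ^ 1 * (3 * m * (Z 2 s - c / 2)))
      + (-1 / 2) * (s ^ 2 * (4 * A * Z 3 s - 2 * B * Z 1 s)) + (-1 / 2) * (s ^ 3 * R 0 s))
      (((((o2.const_mul _).pow_mul 1).const_mul _).add
      ((((o3.const_mul _).sub (o1.const_mul _)).pow_mul 2).const_mul _)).add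
      (((oR 0).pow_mul 3).const_mul _)) ?_
    filter_upwards [hpos] with s hs
    have h0 := hZ0 s hs
    have := r0 s hs
    rw [h0] at this
    linear_combination (-1 / 2) * this
  have o3' : IsOrder 3 fun s => Z 3 s + m * (3 * c ^ 2 + 7) / 16 * s := by
    refine IsOrder.congr (f := fun s => (4 * c / 6) * (Z 1 s + m * c / 4 * s)
      + (4 / 6) * (E s * Z 1 s)
      + (-1 / 6) * (s ^ 1 * (7 * m * (Z 4 s - 3 * (c ^ 2 + 1) / 8) - 5 * c * m * (Z 2 s - c / 2)))
      + (-1 / 6) * (s ^ 2 * (8 * A * Z 5 s - 6 * B * Z 3 s)) + (-1 / 6) * (s ^ 3 * R 2 s))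
      (((((o1'.const_mul _).add ((oE2.mul o1).const_mul _)).add
      ((((o4.const_mul _).sub (o2.const_mul _)).pow_mul 1).const_mul _)).add
      ((((o5.const_mul _).sub (o3.const_mul _)).pow_mul 2).const_mul _)).add
      (((oR 2).pow_mul 3).const_mul _)) ?_
    filter_upwards [hpos] with s hs
    linear_combination (-1 / 6) * r2 s hs
  refine ⟨o1, o2, o3, ?_⟩
  -- Inserting the moments into `E'`, the terms in `m²` cancel and `m (c² - 1) s / 4` remains; here
  -- `c² - 1 = 4 l (l + 1)`. The `s²` term is `O(s³)` because it carries odd moments.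
  have hfin : IsOrder 4 fun s => E s - m * (c ^ 2 - 1) / 8 * s ^ 2 := by
    refine IsOrder.of_hasDerivAt (k := 3) (f' := fun s => (m * (Z 3 s - c * Z 1 s)
      + 2 * s * (A * Z 4 s - B * Z 2 s) + 3 * s ^ 2 * (a * Z 5 s - b * Z 3 s) + s ^ 3 * T s)
      - m * (c ^ 2 - 1) / 8 * (2 * s)) ?_ ?_ ?_
    · filter_upwards [hD'] with s hs
      exact hs.sub (((hasDerivAt_pow 2 s).const_mul _).congr_deriv (by norm_num))
    · refine IsOrder.congr (f := fun s => m * ((Z 3 s + m * (3 * c ^ 2 + 7) / 16 * s)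
        - c * (Z 1 s + m * c / 4 * s))
        + s ^ 1 * (2 * (A * (Z 4 s - 3 * (c ^ 2 + 1) / 8) - B * (Z 2 s - c / 2)))
        + s ^ 2 * (3 * (a * Z 5 s - b * Z 3 s)) + s ^ 3 * T s)
        (((((o3'.sub (o1'.const_mul c)).const_mul m).add
        ((((o4.const_mul A).sub (o2.const_mul B)).const_mul 2).pow_mul 1)).add
        ((((o5.const_mul a).sub (o3.const_mul b)).const_mul 3).pow_mul 2)).add
        (oT.pow_mul 3)) ?_
      exact Eventually.of_forall fun s => by simp only [hA, hB]; ring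
    · have : Tendsto (fun s : ℝ => m * (c ^ 2 - 1) / 8 * s ^ 2) (𝓝[>] 0) (𝓝 0) := by
        have h : Continuous fun s : ℝ => m * (c ^ 2 - 1) / 8 * s ^ 2 := by fun_prop
        exact tendsto_nhdsWithin_of_tendsto_nhds (by simpa using h.tendsto 0)
      simpa using hE0.sub this
  refine hfin.congr (Eventually.of_forall fun s => ?_)
  simp only [hc]
  ring

end PerturbedOperator

/-! ### Expectations of the scaled weights. -/

namespace PerturbedOperator
open Real Set SturmLiouville Polynomial

/-- The scaled kinetic well `(η - x^ν/ν)²` as a polynomial in `z`. -/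
noncomputable def scaledWell (ν : ℕ) (s : ℝ) : ℝ[X] :=
  (X * (C (ν : ℝ)⁻¹ * ∑ j ∈ Finset.range ν, (1 + C s * X) ^ j)) ^ 2

theorem eval_scaledWell (ν : ℕ) (s z : ℝ) :
    (scaledWell ν s).eval z = (z * wellSlope ν (s * z)) ^ 2 := by
  simp [scaledWell, wellSlope, eval_finsetSum, div_eq_inv_mul]

theorem scaledPolyAt_eq_scaledWell_sub (ν l : ℕ) (s : ℝ) :
    scaledPolyAt ν l s = scaledWell ν s - C (2 * l + 1 : ℝ) * (1 + C s * X) ^ (ν - 1) := by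
  simp [scaledPolyAt, scaledPoly, scaledWell, eval_finsetSum]

/-- The scaled weights of the derivatives of the eigenvalue. -/
noncomputable def scaledWeight (ν l : ℕ) (s : ℝ) : Fin 3 → ℝ[X] :=
  ![C (-1) * ((1 + C s * X) * (scaledPolyAt ν l s - C (scaledEigenvalue ν l s))),
    (1 + C s * X) * scaledWell ν s, C (-(2 * l + 1) : ℝ) * (1 + C s * X) ^ ν]

/-- The last two weights combine to `(1 + s X)` times the scaled potential, which cancels against
the first and leaves the eigenvalue. This is why the sum of the derivatives is so much smaller than
each of them. -/
theorem sum_scaledWeight {ν : ℕ} (hν : 2 ≤ ν) (l : ℕ) (s : ℝ) :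
    ∑ j, scaledWeight ν l s j = C (scaledEigenvalue ν l s) * (1 + C s * X) := by
  have h : (1 + C s * X : ℝ[X]) ^ ν = (1 + C s * X) ^ (ν - 1) * (1 + C s * X) := by
    rw [← pow_succ, Nat.sub_add_cancel (by omega)]
  rw [Fin.sum_univ_three]
  simp only [scaledWeight, scaledPolyAt_eq_scaledWell_sub, Matrix.cons_val_zero,
    Matrix.cons_val_one, Matrix.cons_val, h, C_neg, C_1]
  ring

/-- The first weight is evaluated by a virial identity and the third by the binomial expansion; in
both the term of order `s` comes with an odd moment. The second follows from the sum. -/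
theorem isOrder_mean_scaledWeight {ν l : ℕ} (hν : 2 ≤ ν) (hl : 1 ≤ l) (j : Fin 3) :
    IsOrder 2 fun s => mean ν l s (scaledWeight ν l s j)
      - (![(2 * l + 1) / 2, (2 * l + 1) / 2, -(2 * l + 1)] : Fin 3 → ℝ) j := by
  have hpos : ∀ᶠ s : ℝ in 𝓝[>] 0, 0 < s := self_mem_nhdsWithin
  obtain ⟨o1, o2, o3, oE⟩ := isOrder_scaledEigenvalue hν hl
  have oE2 : IsOrder 2 (scaledEigenvalue ν l) := by
    refine ((oE.mono (by norm_num : 2 ≤ 4)).add (((IsOrder.const 1).pow_mul 2).const_mul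
      ((ν - 1) * l * (l + 1) / 2))).congr (Eventually.of_forall fun s => by ring)
  have h0 : IsOrder 2 fun s => mean ν l s (scaledWeight ν l s 0) - (2 * l + 1) / 2 := by
    obtain ⟨a, b, V₄, hV⟩ := exists_scaledPolyAt_eq hν l
    obtain ⟨c, hc⟩ : ∃ c : ℝ, c = 2 * l + 1 := ⟨_, rfl⟩
    obtain ⟨m, hm⟩ : ∃ m : ℝ, m = ν - 1 := ⟨_, rfl⟩
    rw [← hm, ← hc] at hV
    obtain ⟨p, hp⟩ : ∃ p : ℝ[X], p = C ((7 * m ^ 2 - 4 * m) / 12) * X ^ 4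
      - C (c * (m * (ν - 2) / 2)) * X ^ 2 := ⟨_, rfl⟩
    obtain ⟨U, hU⟩ : ∃ U : ℝ → ℝ[X], U = fun s => p + C s * ((C a * X ^ 5 - C b * X ^ 3)
      + C s * V₄.eval (C s)) := ⟨_, rfl⟩
    have fU : PolyFamily U := by
      rw [hU]
      exact (PolyFamily.const _).add (PolyFamily.param.mul ((PolyFamily.const _).add
        (PolyFamily.param.mul ⟨V₄, fun _ => rfl⟩)))
    have hV' : ∀ s, scaledPolyAt ν l s = (X ^ 2 - C c) + C s * (C m * (X ^ 3 - C c * X))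
        + C s ^ 2 * U s := fun s => by rw [hV s, hU, ← hp]; ring
    obtain ⟨W, hW⟩ : ∃ W : ℝ → ℝ[X], W = fun s => C (1 / 2) * X ^ 2 * (C m * (3 * X ^ 2 - C c))
      + (X + C s * (C (1 / 2) * X ^ 2)) * derivative (U s) := ⟨_, rfl⟩
    have fW : PolyFamily W := by
      rw [hW]
      exact (PolyFamily.const _).add (((PolyFamily.const _).add (PolyFamily.param.mul
        (PolyFamily.const _))).mul fU.derivative)
    have key : ∀ s, 0 < s → mean ν l s (scaledWeight ν l s 0)
        = mean ν l s (X ^ 2) + (1 / 2) * (s ^ 1 * ((3 * m + 1) * mean ν l s (X ^ 3)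
          - m * c * mean ν l s X)) + (1 / 2) * (s ^ 2 * mean ν l s (W s)) := by
      intro s hs
      -- The test function `X + s X² / 2` has derivative `1 + s X`, so `2 g' (V - E)` is `-2` times
      -- the first weight, and its third derivative vanishes.
      have h1 := mean_virial hν l hs (X + C s * (C (1 / 2) * X ^ 2))
      have hC : ∀ k, derivative (C s ^ k) = 0 := fun k => by rw [← C_pow, derivative_C]
      have e1 : derivative (X + C s * (C (1 / 2) * X ^ 2) : ℝ[X]) = 1 + C s * X := by
        apply Polynomial.funext; intro z; simp [-mul_eq_mul_left_iff]; ring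
      have e2 : derivative (derivative (1 + C s * X : ℝ[X])) = 0 := by simp
      have e3 : derivative (scaledPolyAt ν l s) = 2 * X + C s * (C m * (3 * X ^ 2 - C c))
          + C s ^ 2 * derivative (U s) := by
        rw [hV' s]; apply Polynomial.funext; intro z; simp [hC]; ring
      have e4 : (X + C s * (C (1 / 2) * X ^ 2)) * derivative (scaledPolyAt ν l s)
          = C 2 * X ^ 2 + C (s * (3 * m + 1)) * X ^ 3 + C (-(s * m * c)) * X
            + C (s ^ 2) * W s := by
        rw [e3, hW]; apply Polynomial.funext; intro z; simp; ring
      have e5 : 2 * (1 + C s * X) * (scaledPolyAt ν l s - C (scaledEigenvalue ν l s))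
          = C (-2) * scaledWeight ν l s 0 := by
        simp only [scaledWeight, Matrix.cons_val_zero]
        rw [show (C (-2) : ℝ[X]) = -2 by simp [show (C 2 : ℝ[X]) = 2 from rfl], C_neg, C_1]
        ring
      rw [e1, e2, e4, e5, mul_zero, sub_zero] at h1
      simp only [LinearMap.map_add, mean_C_mul] at h1
      linear_combination (-1 / 2) * h1
    refine ((o2.add ((((o3.const_mul (3 * m + 1)).sub (o1.const_mul (m * c))).pow_mul 1).const_mul
      (1 / 2))).add (((isOrder_mean hν hl fW).pow_mul 2).const_mul (1 / 2))).congr ?_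
    filter_upwards [hpos] with s hs
    rw [key s hs]
    ring
  have h2 : IsOrder 2 fun s => mean ν l s ((1 + C s * X) ^ ν) - 1 := by
    obtain ⟨k, hk⟩ := powAddExpansion (1 : ℝ[X][X]) (C X * X) ν
    have hk' : ∀ s : ℝ, (1 + C s * X : ℝ[X]) ^ ν = 1 + C (ν * s : ℝ) * X
        + C (s ^ 2) * (X ^ 2 * k.eval (C s)) := fun s => by
      have := congrArg (fun p : ℝ[X][X] => p.eval (C s)) hk
      simp at this
      rw [this]
      simp
      ring
    refine (((o1.pow_mul 1).const_mul ν).add ((isOrder_mean hν hl ((PolyFamily.const (X ^ 2)).mul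
      (F' := fun s => k.eval (C s)) ⟨k, fun _ => rfl⟩)).pow_mul 2)).congr ?_
    filter_upwards [hpos] with s hs
    rw [hk']
    simp only [LinearMap.map_add, mean_C_mul, mean_one hν l hs]
    ring
  fin_cases j
  · exact h0
  · refine (((oE2.add (oE2.mul ((o1.pow_mul 1).mono (Nat.zero_le _)))).sub h0).add
      (h2.const_mul (2 * l + 1))).congr ?_
    filter_upwards [hpos] with s hs
    have h3 := congrArg (mean ν l s) (sum_scaledWeight hν l s)
    rw [Fin.sum_univ_three, mean_C_mul, map_add, map_add, map_add, mean_C_mul,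
      mean_one hν l hs] at h3
    have h4 : mean ν l s (scaledWeight ν l s 2)
        = -(2 * l + 1) * mean ν l s ((1 + C s * X) ^ ν) := mean_C_mul _ _ _ _ _
    simp only [Fin.mk_one, Matrix.cons_val_one, Matrix.cons_val_zero]
    rw [h4] at h3
    linear_combination -h3
  · refine (h2.const_mul (-(2 * l + 1))).congr (Eventually.of_forall fun s => ?_)
    have h4 : mean ν l s (scaledWeight ν l s 2)
        = -(2 * l + 1) * mean ν l s ((1 + C s * X) ^ ν) := mean_C_mul _ _ _ _ _
    simp only [Fin.reduceFinMk, Matrix.cons_val]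
    rw [h4]; ring

end PerturbedOperator

/-! ### Affine changes of variable and the numbering of eigenvalues. -/

namespace SturmLiouville
open Real Set

/-- Eigenfunctions of `D² + q` composed with an affine map. -/
theorem comp_affine_mem_opEigenspace {q V : ℝ → ℝ} {a b Y μ : ℝ} (ha : a ≠ 0) (hY : a ^ 2 * Y = 1)
    (h : ∀ z, q (b + a * z) = Y * V z) {u : ℝ → ℂ}
    (hu : u ∈ opEigenspace (fun _ => 1) q (Y * μ)) :
    (fun z => u (b + a * z)) ∈ opEigenspace (fun _ => 1) V μ := by
  obtain ⟨h1, h2, h3⟩ := hu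
  refine ⟨h1.comp (by fun_prop), ?_, fun z => ?_⟩
  · have hc : Continuous fun z => u (b + a * z) := h1.continuous.comp (by fun_prop)
    rw [memLp_two_iff_integrable_sq_norm hc.aestronglyMeasurable]
    rw [memLp_two_iff_integrable_sq_norm h1.continuous.aestronglyMeasurable] at h2
    exact (h2.comp_add_left b).comp_mul_left' ha
  · have e1 : deriv (fun z => u (b + a * z)) = fun z => a • deriv u (b + a * z) := by
      funext z
      rw [deriv_comp_mul_left a (fun z => u (b + z)) z, deriv_comp_const_add]
    have e2 : deriv (fun z => a • deriv u (b + a * z)) z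
        = a • a • deriv (deriv u) (b + a * z) := by
      rw [deriv_fun_const_smul_field, deriv_comp_mul_left a (fun z => deriv u (b + z)) z,
        deriv_comp_const_add]
    have h4 := h3 (b + a * z)
    rw [opApply, h] at h4
    rw [opApply, e1, e2]
    have hYc : (a : ℂ) ^ 2 * (Y : ℂ) = 1 := by exact_mod_cast hY
    push_cast at h4 ⊢
    simp only [Complex.real_smul]
    linear_combination (a : ℂ) ^ 2 * h4 + ((μ : ℂ) - V z) * u (b + a * z) * hYc

/-- The affine change of variables as a linear equivalence on functions. -/
noncomputable def compAffine (a b : ℝ) (ha : a ≠ 0) : (ℝ → ℂ) ≃ₗ[ℂ] (ℝ → ℂ) :=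
  LinearEquiv.funCongrLeft ℂ ℂ ((Equiv.mulLeft₀ a ha).trans (Equiv.addLeft b))

theorem map_compAffine_opEigenspace {q V : ℝ → ℝ} {a b Y : ℝ} (ha : a ≠ 0) (hY : a ^ 2 * Y = 1)
    (h : ∀ z, q (b + a * z) = Y * V z) (μ : ℝ) :
    (opEigenspace (fun _ => 1) q (Y * μ)).map (compAffine a b ha).toLinearMap
      = opEigenspace (fun _ => 1) V μ := by
  apply le_antisymm
  · rintro _ ⟨u, hu, rfl⟩
    exact comp_affine_mem_opEigenspace ha hY h hu
  · intro v hv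
    have hY0 : Y ≠ 0 := by rintro rfl; simp at hY
    have hv' : (fun x => v (-b / a + a⁻¹ * x)) ∈ opEigenspace (fun _ => 1) q (Y * μ) := by
      refine comp_affine_mem_opEigenspace (Y := Y⁻¹) (q := V) (inv_ne_zero ha) ?_ (fun x => ?_) ?_
      · rw [inv_pow, ← mul_inv, hY, inv_one]
      · have := h (-b / a + a⁻¹ * x)
        rw [eq_inv_mul_iff_mul_eq₀ hY0, ← this]
        congr 1
        field_simp
        ring
      · rwa [inv_mul_cancel_left₀ hY0]
    refine ⟨_, hv', ?_⟩
    funext z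
    change v (-b / a + a⁻¹ * (b + a * z)) = v z
    congr 1
    field_simp
    ring

/-- Composition with the affine map is a linear equivalence matching eigenspaces at `Y μ` and `μ`,
so ranks agree; `Y > 0` preserves the order. -/
theorem isNthEigenvalue_of_scaled {q V : ℝ → ℝ} {a b Y : ℝ} (ha : a ≠ 0) (hY : a ^ 2 * Y = 1)
    (h : ∀ z, q (b + a * z) = Y * V z) {n : ℕ} {E : ℝ}
    (hE : IsNthEigenvalue (fun _ => 1) V n E) : IsNthEigenvalue (fun _ => 1) q n (Y * E) := by
  have hY0 : 0 < Y := by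
    by_contra! h0
    nlinarith [mul_nonpos_of_nonneg_of_nonpos (sq_nonneg a) h0]
  have hrank : ∀ μ, Module.rank ℂ ↥(⨆ τ ∈ Iic μ, opEigenspace (fun _ => 1) V τ)
      = Module.rank ℂ ↥(⨆ τ ∈ Iic (Y * μ), opEigenspace (fun _ => 1) q τ) := by
    intro μ
    have e : ⨆ τ ∈ Iic μ, opEigenspace (fun _ => 1) V τ
        = (⨆ τ ∈ Iic (Y * μ), opEigenspace (fun _ => 1) q τ).map
          (compAffine a b ha).toLinearMap := by
      simp only [Submodule.map_iSup, ← map_compAffine_opEigenspace ha hY h]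
      apply le_antisymm
      · refine iSup₂_le fun τ hτ => ?_
        exact le_iSup₂_of_le (Y * τ) (mul_le_mul_of_nonneg_left hτ hY0.le) le_rfl
      · refine iSup₂_le fun τ hτ => ?_
        refine le_iSup₂_of_le (Y⁻¹ * τ) ?_ (by rw [mul_inv_cancel_left₀ hY0.ne'])
        rw [mem_Iic] at hτ ⊢
        rwa [inv_mul_le_iff₀ hY0]
    rw [e]
    exact ((compAffine a b ha).submoduleMap _).rank_eq.symm
  constructor
  · rw [mem_ofPred_eq, ← hrank]; exact hE.1
  · intro μ hμ
    have : E ≤ Y⁻¹ * μ := hE.2 (by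
      rw [mem_ofPred_eq] at hμ ⊢
      rwa [hrank, mul_inv_cancel_left₀ hY0.ne'])
    rwa [le_inv_mul_iff₀ hY0] at this

end SturmLiouville

/-! ### Transfer between the original and the scaled operator. -/

namespace PerturbedOperator
open Real Set SturmLiouville Polynomial

namespace Scaling
variable {ν : ℕ} {η x₀ s : ℝ}

theorem sq_mul_pow (h : Scaling ν η x₀ s) (hν : 2 ≤ ν) : (x₀ * s) ^ 2 * x₀ ^ (ν - 1) = 1 := by
  rw [← h.sq, mul_pow, mul_right_comm, ← pow_add, mul_comm]
  congr 2; omega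

theorem mul_ne_zero (h : Scaling ν η x₀ s) : x₀ * s ≠ 0 :=
  _root_.mul_ne_zero h.ne_zero h.pos.ne'

theorem pertQ_affine (h : Scaling ν η x₀ s) (hν : 2 ≤ ν) (l : ℕ) (z : ℝ) :
    pertQ ν l η 0 (x₀ + x₀ * s * z) = x₀ ^ (ν - 1) * scaledV ν l s z := by
  rw [← h.pertQ_eq hν]; congr 1; ring

theorem eigenvalue_eq (h : Scaling ν η x₀ s) (hν : 2 ≤ ν) (l : ℕ) :
    eigenvalue ν l η 0 = x₀ ^ (ν - 1) * scaledEigenvalue ν l s := by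
  have h1 := isNthEigenvalue_eigenvalue hν l η zero_mem_admissible
  rw [pertP_zero] at h1
  exact h1.unique (isNthEigenvalue_of_scaled h.mul_ne_zero (h.sq_mul_pow hν) (h.pertQ_affine hν l)
    ((confiningPair_scaledV hν l h.pos).isNthEigenvalue (totalAngle_scaledEigenCoeff hν l h.pos)))

/-- The two eigenfunctions are normalized at different points, so the factor is left unspecified; it
cancels in quotients of moments. -/
theorem exists_eigenfunction_eq (h : Scaling ν η x₀ s) (hν : 2 ≤ ν) (l : ℕ) : ∃ k : ℝ, ∀ z,
    eigenfunction ν l η (x₀ + x₀ * s * z) ^ 2 = k * leftSol (scaledEigenCoeff ν l s) z ^ 2 := by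
  have h1 := (confiningPair_pert hν l η zero_mem_admissible).leftSol_mem_opEigenspace
    (sin_totalAngle_eigenCoeff hν l η zero_mem_admissible)
  rw [pertP_zero, h.eigenvalue_eq hν l] at h1
  have h2 := (confiningPair_scaledV hν l h.pos).opEigenspace_le_span _
    (comp_affine_mem_opEigenspace h.mul_ne_zero (h.sq_mul_pow hν) (h.pertQ_affine hν l) h1)
  obtain ⟨k, hk⟩ := Submodule.mem_span_singleton.1 h2
  refine ⟨‖k‖ ^ 2, fun z => ?_⟩
  have h3 := congrArg (fun w : ℂ => ‖w‖ ^ 2) (congrFun hk z)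
  simp only [Pi.smul_apply, smul_eq_mul, norm_mul, mul_pow, Complex.norm_real, Real.norm_eq_abs,
    sq_abs] at h3
  rw [eigenfunction, eigenCoeff, pertP_zero, h.eigenvalue_eq hν l]
  exact h3.symm

theorem moment_eq (h : Scaling ν η x₀ s) (hν : 2 ≤ ν) (l : ℕ) : ∃ k : ℝ, ∀ f,
    moment ν l η f
      = k * ∫ z, f (x₀ * (1 + s * z)) * leftSol (scaledEigenCoeff ν l s) z ^ 2 := by
  obtain ⟨k, hk⟩ := h.exists_eigenfunction_eq hν l
  refine ⟨|x₀ * s| * k, fun f => ?_⟩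
  have h1 := Measure.integral_comp_mul_left
    (fun x => f (x₀ + x) * eigenfunction ν l η (x₀ + x) ^ 2) (x₀ * s)
  rw [integral_add_left_eq_self (fun x => f x * eigenfunction ν l η x ^ 2), smul_eq_mul,
    abs_inv, eq_inv_mul_iff_mul_eq₀ (abs_ne_zero.2 h.mul_ne_zero)] at h1
  rw [moment, ← h1, mul_assoc, ← integral_const_mul k]
  congr 2
  funext z
  rw [hk, show x₀ * (1 + s * z) = x₀ + x₀ * s * z by ring]
  ring

theorem moment_div_moment_one (h : Scaling ν η x₀ s) (hν : 2 ≤ ν) (l : ℕ) {f : ℝ → ℝ} {c : ℝ}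
    {p : ℝ[X]} (hf : ∀ z, f (x₀ * (1 + s * z)) = c * p.eval z) :
    moment ν l η f / moment ν l η (fun _ => 1) = c * mean ν l s p := by
  obtain ⟨k, hk⟩ := h.moment_eq hν l
  have h1 := moment_one_pos hν l η
  rw [hk] at h1 ⊢
  rw [hk]
  have hk0 : k ≠ 0 := by rintro rfl; simp at h1
  rw [mul_div_mul_left _ _ hk0, mean_apply hν l h.pos]
  simp only [hf, mul_assoc, integral_const_mul, one_mul, mul_div_assoc]

/-- Each weight is `x` times a part of the operator; these scale by `x₀` and `x₀^(ν-1)`, whose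
product is `x₀^ν = ν η`. -/
theorem eigenvalueDeriv_eq (h : Scaling ν η x₀ s) (hν : 2 ≤ ν) (l : ℕ) (j : Fin 3) :
    eigenvalueDeriv ν l η (Pi.single j 1, 0) = x₀ ^ ν * mean ν l s (scaledWeight ν l s j) := by
  have h1 : x₀ ^ ν = x₀ * x₀ ^ (ν - 1) := by
    rw [← pow_succ', Nat.sub_add_cancel (by omega)]
  rw [eigenvalueDeriv_apply]
  rw [Finset.sum_eq_single j (fun i _ hi => by simp [hi]) (by simp)]
  simp only [Pi.single_eq_same, mul_one]
  refine h.moment_div_moment_one hν l fun z => ?_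
  fin_cases j
  · change -(x₀ * (1 + s * z) * eigenCoeff ν l η 0 (x₀ * (1 + s * z))) = x₀ ^ ν * eval z
      (C (-1) * ((1 + C s * X) * (scaledPolyAt ν l s - C (scaledEigenvalue ν l s))))
    rw [eigenCoeff_zero, h.eigenvalue_eq hν, h.pertQ_eq hν, h1]
    simp [eval_scaledPolyAt]
    ring
  · change x₀ * (1 + s * z) * (η - (x₀ * (1 + s * z)) ^ ν / ν) ^ 2 = x₀ ^ ν * eval z
      ((1 + C s * X) * scaledWell ν s)
    rw [h.kinetic hν, h1]
    simp [eval_scaledWell]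
    ring
  · change -((2 * l + 1) * (x₀ * (1 + s * z) * (x₀ * (1 + s * z)) ^ (ν - 1))) = x₀ ^ ν * eval z
      (C (-(2 * l + 1) : ℝ) * (1 + C s * X) ^ ν)
    rw [← pow_succ', Nat.sub_add_cancel (by omega), mul_pow]
    simp
    ring

end Scaling

end PerturbedOperator

/-! ### Asymptotics in `η`. -/

namespace PerturbedOperator
open Real Set SturmLiouville Polynomial

namespace Scaling
variable {ν : ℕ} {η x₀ s : ℝ}

theorem abs_pow (h : Scaling ν η x₀ s) : |x₀| ^ ν = ν * |η| := by
  rw [← _root_.abs_pow, h.pow, abs_mul, Nat.abs_cast]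

theorem sq_mul_abs_pow (h : Scaling ν η x₀ s) : s ^ 2 * |x₀| ^ (ν + 1) = 1 := by
  have := congrArg abs h.sq
  rwa [abs_mul, _root_.abs_pow, _root_.abs_pow, abs_one, abs_of_pos h.pos] at this

theorem abs_eq (h : Scaling ν η x₀ s) (hν : 2 ≤ ν) : |x₀| = (ν * |η|) ^ ((1 : ℝ) / ν) := by
  rw [← h.abs_pow, one_div, pow_rpow_inv_natCast (abs_nonneg _) (by omega)]

theorem inv_abs_pow (h : Scaling ν η x₀ s) (hν : 2 ≤ ν) (k : ℕ) :
    (|x₀| ^ k)⁻¹ = (ν : ℝ) ^ (-(k : ℝ) / ν) * |η| ^ (-(k : ℝ) / ν) := by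
  rw [h.abs_eq hν, ← rpow_natCast, ← rpow_mul (by positivity), ← rpow_neg (by positivity),
    ← mul_rpow (by positivity) (abs_nonneg _)]
  congr 1
  ring

/-- This power and the next two convert orders in `s` into powers of `|x₀| = (ν |η|)^(1/ν)`, hence
into the exponents `-2/ν`, `-(ν+3)/ν` and `-1/ν`. -/
theorem pow_mul_sq (h : Scaling ν η x₀ s) (hν : 2 ≤ ν) :
    x₀ ^ (ν - 1) * s ^ 2 = (|x₀| ^ 2)⁻¹ := by
  refine eq_inv_of_mul_eq_one_left ?_
  rw [sq_abs, ← h.sq, mul_right_comm, ← pow_add, mul_comm]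
  congr 2; omega

theorem abs_pow_mul_four (h : Scaling ν η x₀ s) (hν : 2 ≤ ν) :
    |x₀ ^ (ν - 1) * s ^ 4| = (|x₀| ^ (ν + 3))⁻¹ := by
  refine eq_inv_of_mul_eq_one_left ?_
  rw [abs_mul, _root_.abs_pow, _root_.abs_pow, abs_of_pos h.pos]
  calc |x₀| ^ (ν - 1) * s ^ 4 * |x₀| ^ (ν + 3)
      = s ^ 4 * (|x₀| ^ (ν - 1) * |x₀| ^ (ν + 3)) := by ring
    _ = s ^ 4 * |x₀| ^ ((ν + 1) * 2) := by rw [← pow_add]; congr 2; omega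
    _ = (s ^ 2 * |x₀| ^ (ν + 1)) ^ 2 := by rw [pow_mul]; ring
    _ = 1 := by rw [h.sq_mul_abs_pow, one_pow]

theorem abs_pow_mul_sq (h : Scaling ν η x₀ s) : |x₀ ^ ν * s ^ 2| = (|x₀| ^ 1)⁻¹ := by
  refine eq_inv_of_mul_eq_one_left ?_
  rw [abs_mul, _root_.abs_pow, _root_.abs_pow, abs_of_pos h.pos, ← h.sq_mul_abs_pow]
  ring

end Scaling

section
variable {ν : ℕ} {L : Filter ℝ} {x₀ s : ℝ → ℝ}

theorem isBigO_inv_abs_pow (hν : 2 ≤ ν) (hS : ∀ᶠ η in L, Scaling ν η (x₀ η) (s η)) (k : ℕ) :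
    (fun η => (|x₀ η| ^ k)⁻¹) =O[L] fun η => |η| ^ (-(k : ℝ) / ν) := by
  refine (isBigO_const_mul_self ((ν : ℝ) ^ (-(k : ℝ) / ν)) _ _).congr' ?_ EventuallyEq.rfl
  filter_upwards [hS] with η h using (h.inv_abs_pow hν k).symm

theorem tendsto_abs_root (hν : 2 ≤ ν) (hS : ∀ᶠ η in L, Scaling ν η (x₀ η) (s η))
    (hL : Tendsto (fun η => |η|) L atTop) : Tendsto (fun η => |x₀ η|) L atTop := by
  have hν0 : (0 : ℝ) < ν := by exact_mod_cast (by omega : 0 < ν)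
  refine ((tendsto_rpow_atTop (by positivity : 0 < (1 : ℝ) / ν)).comp
    (hL.const_mul_atTop hν0)).congr' ?_
  filter_upwards [hS] with η h using (h.abs_eq hν).symm

theorem tendsto_scaling (hν : 2 ≤ ν) (hS : ∀ᶠ η in L, Scaling ν η (x₀ η) (s η))
    (hL : Tendsto (fun η => |η|) L atTop) : Tendsto s L (𝓝[>] 0) := by
  refine tendsto_nhdsWithin_iff.2 ⟨?_, hS.mono fun η h => h.pos⟩
  have h1 := ((tendsto_pow_atTop (by omega : ν + 1 ≠ 0)).comp
    (tendsto_abs_root hν hS hL)).inv_tendsto_atTop.sqrt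
  rw [sqrt_zero] at h1
  refine h1.congr' ?_
  filter_upwards [hS] with η h
  change √(|x₀ η| ^ (ν + 1))⁻¹ = s η
  rw [← eq_inv_of_mul_eq_one_left h.sq_mul_abs_pow, sqrt_sq h.pos.le]

/-- The asymptotics of the eigenvalue and of its derivatives, along a filter that tends to
`±∞`. -/
theorem asymptotics_eigenvalue {l : ℕ} (hν : 2 ≤ ν) (hl : 1 ≤ l)
    (hS : ∀ᶠ η in L, Scaling ν η (x₀ η) (s η)) (hL : Tendsto (fun η => |η|) L atTop) :
    ((fun η => eigenvalue ν l η 0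
        - 1 / 2 * ((ν : ℝ) - 1) * l * (l + 1) * (ν : ℝ) ^ (-(2 : ℝ) / ν) * |η| ^ (-(2 : ℝ) / ν))
      =O[L] fun η => |η| ^ (-((ν : ℝ) + 3) / ν)) ∧
    (∀ j : Fin 3, (fun η => eigenvalueDeriv ν l η (Pi.single j 1, 0)
        - (![(2 * l + 1) * ν / 2, (2 * l + 1) * ν / 2, -((2 * l + 1) * ν)] : Fin 3 → ℝ) j * η)
      =O[L] fun η => |η| ^ (-(1 : ℝ) / ν)) ∧
    ((fun η => (∑ j : Fin 3, eigenvalueDeriv ν l η (Pi.single j 1, 0))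
        - x₀ η * eigenvalue ν l η 0)
      =O[L] fun η => |η| ^ (-(2 : ℝ) / ν)) := by
  have hs := tendsto_scaling hν hS hL
  obtain ⟨o1, -, -, oE⟩ := isOrder_scaledEigenvalue hν hl
  refine ⟨?_, fun j => ?_, ?_⟩
  · have h1 := isBigO_inv_abs_pow hν hS (ν + 3)
    push_cast at h1
    refine IsBigO.trans ?_ h1
    have h2 := (isBigO_refl (fun η => x₀ η ^ (ν - 1)) L).mul (oE.comp_tendsto hs)
    refine (h2.trans ?_).congr' ?_ EventuallyEq.rfl
    · refine IsBigO.of_bound 1 ?_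
      filter_upwards [hS] with η h
      rw [one_mul, Real.norm_eq_abs, Function.comp, h.abs_pow_mul_four hν, Real.norm_eq_abs]
      exact le_abs_self _
    · filter_upwards [hS] with η h
      have h2 := h.inv_abs_pow hν 2
      push_cast at h2
      rw [h.eigenvalue_eq hν, mul_assoc _ ((ν : ℝ) ^ _), ← h2, ← h.pow_mul_sq hν]
      simp only [Function.comp]
      ring
  · have h1 := isBigO_inv_abs_pow hν hS 1
    push_cast at h1
    refine IsBigO.trans ?_ h1
    have h2 := (isBigO_refl (fun η => x₀ η ^ ν) L).mul
      ((isOrder_mean_scaledWeight hν hl j).comp_tendsto hs)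
    refine (h2.trans ?_).congr' ?_ EventuallyEq.rfl
    · refine IsBigO.of_bound 1 ?_
      filter_upwards [hS] with η h
      rw [one_mul, Real.norm_eq_abs, Function.comp, h.abs_pow_mul_sq, Real.norm_eq_abs]
      exact le_abs_self _
    · filter_upwards [hS] with η h
      rw [h.eigenvalueDeriv_eq hν, Function.comp, mul_sub, h.pow]
      fin_cases j <;> simp <;> ring
  · have h1 := isBigO_inv_abs_pow hν hS 2
    push_cast at h1
    refine IsBigO.trans ?_ h1
    have oE2 : IsOrder 2 (scaledEigenvalue ν l) :=
      ((oE.mono (by norm_num : 2 ≤ 4)).add (((IsOrder.const 1).pow_mul 2).const_mul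
        ((ν - 1) * l * (l + 1) / 2))).congr (Eventually.of_forall fun s => by ring)
    have h2 := (isBigO_refl (fun η => x₀ η ^ ν) L).mul ((oE2.mul (o1.pow_mul 1)).comp_tendsto hs)
    refine (h2.trans ?_).congr' ?_ EventuallyEq.rfl
    · refine IsBigO.of_bound 1 ?_
      filter_upwards [hS, (tendsto_abs_root hν hS hL).eventually_ge_atTop 1] with η h h3
      -- The correction `x₀ λ s ⟨z⟩` has size `|x₀|^(-ν-2)`, better than the required `|x₀|^(-2)`.
      have h4 : x₀ η ^ ν * s η ^ (2 + (1 + 1)) = x₀ η * (x₀ η ^ (ν - 1) * s η ^ 4) := by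
        rw [← mul_assoc, ← pow_succ', Nat.sub_add_cancel (by omega)]
      rw [one_mul, Real.norm_eq_abs, Function.comp, h4, abs_mul, h.abs_pow_mul_four hν, norm_inv,
        norm_pow, Real.norm_eq_abs, abs_abs]
      generalize |x₀ η| = y at h3
      have hy : 0 < y := by linarith
      rw [show ν + 3 = (ν + 2) + 1 by omega, pow_succ', mul_inv, mul_inv_cancel_left₀ hy.ne']
      gcongr
      omega
    · filter_upwards [hS] with η h
      have h3 : x₀ η ^ ν = x₀ η * x₀ η ^ (ν - 1) := by
        rw [← pow_succ', Nat.sub_add_cancel (by omega)]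
      simp only [h.eigenvalueDeriv_eq hν, h.eigenvalue_eq hν, ← Finset.mul_sum, ← map_sum,
        sum_scaledWeight hν, mean_C_mul, map_add, mean_one hν l h.pos, Function.comp, h3]
      ring
end

theorem scaling_of_pow_eq {ν : ℕ} {η x₀ : ℝ} (h : x₀ ^ ν = ν * η) (h0 : 0 < x₀ ^ (ν + 1)) :
    Scaling ν η x₀ (√(x₀ ^ (ν + 1)))⁻¹ where
  pow := h
  sq := by rw [inv_pow, sq_sqrt h0.le, inv_mul_cancel₀ h0.ne']
  pos := by positivity

theorem scaling_of_pos {ν : ℕ} (hν : 2 ≤ ν) {η : ℝ} (hη : 0 < η) :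
    Scaling ν η ((ν : ℝ) ^ ((1 : ℝ) / ν) * η ^ ((1 : ℝ) / ν))
      (√(((ν : ℝ) ^ ((1 : ℝ) / ν) * η ^ ((1 : ℝ) / ν)) ^ (ν + 1)))⁻¹ := by
  have hν0 : (0 : ℝ) < ν := by exact_mod_cast (by omega : 0 < ν)
  refine scaling_of_pow_eq ?_ (by positivity)
  rw [mul_pow, one_div, rpow_inv_natCast_pow hν0.le (by omega),
    rpow_inv_natCast_pow hη.le (by omega)]

/-- For odd `ν` the root `x₀` is negative, but `ν + 1` is even, so `x₀^(ν+1) > 0` and the same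
scaling applies. -/
theorem scaling_of_neg {ν : ℕ} (hν : 2 ≤ ν) (ho : Odd ν) {η : ℝ} (hη : η < 0) :
    Scaling ν η ((ν : ℝ) ^ ((1 : ℝ) / ν) * -|η| ^ ((1 : ℝ) / ν))
      (√(((ν : ℝ) ^ ((1 : ℝ) / ν) * -|η| ^ ((1 : ℝ) / ν)) ^ (ν + 1)))⁻¹ := by
  have hν0 : (0 : ℝ) < ν := by exact_mod_cast (by omega : 0 < ν)
  have hη' := abs_pos.2 hη.ne
  refine scaling_of_pow_eq ?_ ?_
  · rw [mul_pow, ho.neg_pow, one_div, rpow_inv_natCast_pow hν0.le (by omega),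
      rpow_inv_natCast_pow hη'.le (by omega), abs_of_neg hη, neg_neg]
  · rw [mul_pow, ho.add_one.neg_pow]; positivity

end PerturbedOperator

/-! ### The theorem. -/

open PerturbedOperator in
theorem propositionA3 (ν l : ℕ) (hν : 2 ≤ ν) (hl : 1 ≤ l) :
    ∃ (κ κ₁ κ₂ κ₃ κ₄ : ℝ) (lam : ℝ → Params → ℝ) (dlam : ℝ → Params →L[ℝ] ℝ),
      -- `lam η θ` is the `l`-th eigenvalue of the perturbed operator with parameters `θ`
      (∀ η : ℝ, ∀ θ ∈ admissible, IsNthEigenvalue (pertP θ) (pertQ ν l η θ) l (lam η θ)) ∧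
      -- `dlam η` is its derivative at `α = β = 0` within the admissible parameters
      (∀ η : ℝ, HasFDerivWithinAt (lam η) (dlam η) admissible 0) ∧
      -- the unperturbed eigenvalue
      κ = 1 / 2 * ((ν : ℝ) - 1) * l * (l + 1) * (ν : ℝ) ^ (-(2 : ℝ) / ν) ∧ 0 < κ ∧
      ((fun η : ℝ => lam η 0 - κ * η ^ (-(2 : ℝ) / ν))
        =O[atTop] fun η : ℝ => η ^ (-((ν : ℝ) + 3) / ν)) ∧
      (Odd ν → (fun η : ℝ => lam η 0 - κ * |η| ^ (-(2 : ℝ) / ν))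
        =O[atBot] fun η : ℝ => |η| ^ (-((ν : ℝ) + 3) / ν)) ∧
      -- the derivatives with respect to `α₁, α₂, α₃`
      κ₁ = κ₂ ∧ κ₂ = -κ₃ / 2 ∧
      (∀ j : Fin 3, (fun η : ℝ => dlam η (Pi.single j 1, 0) - ![κ₁, κ₂, κ₃] j * η)
        =O[atTop] fun η : ℝ => η ^ (-(1 : ℝ) / ν)) ∧
      (Odd ν → ∀ j : Fin 3, (fun η : ℝ => dlam η (Pi.single j 1, 0) - ![κ₁, κ₂, κ₃] j * η)
        =O[atBot] fun η : ℝ => |η| ^ (-(1 : ℝ) / ν)) ∧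
      -- their sum; for odd `ν` and `η < 0` the real root `η^(1/ν)` is `-|η|^(1/ν)`
      ((fun η : ℝ => (∑ j : Fin 3, dlam η (Pi.single j 1, 0))
          - κ₄ * η ^ ((1 : ℝ) / ν) * lam η 0)
        =O[atTop] fun η : ℝ => η ^ (-(2 : ℝ) / ν)) ∧
      (Odd ν → (fun η : ℝ => (∑ j : Fin 3, dlam η (Pi.single j 1, 0))
          - κ₄ * (-|η| ^ ((1 : ℝ) / ν)) * lam η 0)
        =O[atBot] fun η : ℝ => |η| ^ (-(2 : ℝ) / ν)) := by
  have hν1 : (1 : ℝ) < ν := by exact_mod_cast (by omega : 1 < ν)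
  have hl0 : (0 : ℝ) < l := by exact_mod_cast hl
  have hpos : ∀ᶠ η : ℝ in atTop, 0 < η := eventually_gt_atTop 0
  obtain ⟨a1, a2, a3⟩ := asymptotics_eigenvalue hν hl
    (hpos.mono fun η hη => scaling_of_pos hν hη) tendsto_abs_atTop_atTop
  have b := fun ho : Odd ν => asymptotics_eigenvalue hν hl
    ((eventually_lt_atBot 0).mono fun η hη => scaling_of_neg hν ho hη) tendsto_abs_atBot_atTop
  -- The `κ_j` are `ν`, from `x₀^ν = ν η`, times the limits of the scaled expectations; `κ₄ =
  -- ν^(1/ν)` is the ratio of `x₀` to `η^(1/ν)`.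
  refine ⟨_, (2 * l + 1) * ν / 2, (2 * l + 1) * ν / 2, -((2 * l + 1) * ν),
    (ν : ℝ) ^ ((1 : ℝ) / ν), eigenvalue ν l, eigenvalueDeriv ν l,
    fun η θ hθ => isNthEigenvalue_eigenvalue hν l η hθ, hasFDerivWithinAt_eigenvalue hν l,
    rfl, ?_, ?_, fun ho => (b ho).1, rfl, by ring, fun j => ?_, fun ho => (b ho).2.1, ?_,
    fun ho => (b ho).2.2⟩
  · have : 0 < (ν : ℝ) - 1 := by linarith
    positivity
  · refine a1.congr' ?_ ?_ <;> filter_upwards [hpos] with η hη <;> rw [abs_of_pos hη]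
  · refine (a2 j).congr' EventuallyEq.rfl ?_
    filter_upwards [hpos] with η hη
    rw [abs_of_pos hη]
  · refine a3.congr' EventuallyEq.rfl ?_
    filter_upwards [hpos] with η hη
    rw [abs_of_pos hη]
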